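/- Let $A$ be a unital algebra over a field $\mathbb k$, and let $(\Omega,\mathrm d)$ be a differential graded algebra with $\Omega^0=A$, generated by $A$ and $\mathrm dA$ (only degrees $\le 2$ are used). All bimodules are $A$-bimodules over $\mathbb k$, and $\otimes=\otimes_A$. A bimodule connection on a bimodule $E$ is a linear map $\nabla_E:E\to\Omega^1\otimes E$ with a bimodule map $\sigma_E:E\otimes\Omega^1\to\Omega^1\otimes E$ such that $\nabla_E(ae)=\mathrm da\otimes e+a\nabla_Ee$ and $\nabla_E(ea)=(\nabla_Ee)a+\sigma_E(e\otimes\mathrm da)$. Write $\nabla_{E\otimes F}=\nabla_E\otimes\mathrm{id}+(\sigma_E\otimes\mathrm{id})(\mathrm{id}\otimes\nabla_F)$. Let $(\nabla,\sigma)$ be a bimodule connection on $\Omega^1$ which is torsion free ($\wedge\nabla=\mathrm d$), flat ($(\mathrm d\otimes\mathrm{id}-\mathrm{id}\wedge\nabla)\nabla=0$), $\wedge$-compatible ($\nabla_{\Omega^2}(\eta\wedge\omega)=(\mathrm{id}\otimes\wedge)\nabla_{\Omega^1\otimes\Omega^1}(\eta\otimes\omega)$ is a well-defined bimodule connection on $\Omega^2$),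 extendable ($\omega\otimes(\eta\wedge\zeta)\mapsto(\wedge\otimes\mathrm{id})(\mathrm{id}\otimes\sigma)(\sigma\otimes\mathrm{id})(\omega\otimes\eta\otimes\zeta)$ is a well-defined bimodule map $\Omega^1\otimes\Omega^2\to\Omega^2\otimes\Omega^1$) and Leibniz compatible ($\nabla_{\Omega^1\otimes\Omega^1}\,\sigma=(\mathrm{id}\otimes\sigma)\nabla_{\Omega^1\otimes\Omega^1}$). Let $(\nabla_E,\sigma_E)$ be a bimodule connection on a bimodule $E$ which is flat ($(\mathrm d\otimes\mathrm{id}-\mathrm{id}\wedge\nabla_E)\nabla_E=0$), extendable ($s\otimes(\eta\wedge\zeta)\mapsto(\wedge\otimes\mathrm{id})(\mathrm{id}\otimes\sigma_E)(\sigma_E\otimes\mathrm{id})(s\otimes\eta\otimes\zeta)$ is a well-defined bimodule map $E\otimes\Omega^2\to\Omega^2\otimes E$) and Leibniz compatible ($\nabla_{\Omega^1\otimes E}\,\sigma_E=(\mathrm{id}\otimes\sigma_E)\nabla_{E\otimes\Omega^1}$). Let $\Omega^n_S\subseteq(\Omega^1)^{\otimes n}$ be the joint kernel of the maps $\wedge_i$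 (the wedge product of the factors $i,i+1$, $1\le i<n$), with $\Omega^0_S=A$, $\Omega^1_S=\Omega^1$. Let $\sigma_i$ be $\sigma$ on the factors $i,i+1$, and let the braided binomials $\left[{n\atop m},\sigma\right]$ on $(\Omega^1)^{\otimes n}$ be given by $\left[{n\atop 0},\sigma\right]=\left[{n\atop n},\sigma\right]=\mathrm{id}$ and, for $0<m<n$, $\left[{n\atop m},\sigma\right]=\left(\mathrm{id}\otimes\left[{n-1\atop m-1},\sigma\right]\right)\sigma_1\cdots\sigma_{n-m}+\mathrm{id}\otimes\left[{n-1\atop m},\sigma\right]$. Put $\sigma^n_E=\sigma_{E,n}\cdots\sigma_{E,1}:E\otimes(\Omega^1)^{\otimes n}\to(\Omega^1)^{\otimes n}\otimes E$, where $\sigma_{E,i}$ is $\sigma_E$ on the factors $i,i+1$. Let $\nabla^n_E=\nabla_{(\Omega^1)^{\otimes(n-1)}\otimes E}\cdots\nabla_{\Omega^1\otimes E}\nabla_E:E\to(\Omega^1)^{\otimes n}\otimes E$, with $\nabla^0_E=\mathrm{id}$, and let $\nabla^n:A\to(\Omega^1)^{\otimes n}$ be the same for $E=A$, $\nabla_A=\mathrm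 d$. Let $k\ge 0$. Assume that for every $n\le k$ the canonical map $\Omega^n_S\otimes E\to(\Omega^1)^{\otimes n}\otimes E$ is injective with image the joint kernel of the maps $\wedge_i\otimes\mathrm{id}_E$, $1\le i<n$, so that $\Omega^n_S\otimes E$ is identified with this joint kernel. (This is automatic if $E$ is flat as a left $A$-module, e.g. finitely generated projective, and always for $k\le 1$.) Then the following hold. (1) The maps $\left[{i+j\atop j},\sigma\right]$ restrict to bimodule maps $\odot:\Omega^i_S\otimes\Omega^j_S\to\Omega^{i+j}_S$ for all $i,j$. For $n\le k$ the map $\sigma^n_E$ restricts to a bimodule map $\sigma_{E,\Omega_S}:E\otimes\Omega^n_S\to\Omega^n_S\otimes E$. Moreover $\nabla^n$ has values in $\Omega^n_S$ for all $n$, and $\nabla^n_E$ has values in $\Omega^n_S\otimes E$ for $n\le k$. Put $\eta\odot_E(\omega\otimes s)=(\eta\odot\omega)\otimes s$ and $(\omega\otimes s)\odot_E\eta=\omega\odot\sigma_{E,\Omega_S}(s\otimes\eta)$. (2) For every $m\le k$ the space $\mathcal J^m_E=\bigoplus_{i=0}^m\Omega^i_S\otimes E$ is an $A$-bimodule under $$a\bullet_m(\omega_j\otimes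 s)=\sum_{i=j}^m\nabla^{i-j}a\odot_E(\omega_j\otimes s),\qquad(\omega_j\otimes s)\bullet_m a=\sum_{i=j}^m(\omega_j\otimes s)\odot_E\nabla^{i-j}a$$ for $a\in A$, $s\in E$, $\omega_j\in\Omega^j_S$, $0\le j\le m$, and $j^m_E:E\to\mathcal J^m_E$, $j^m_E(s)=\sum_{i=0}^m\nabla^i_Es$, is a bimodule map. (3) For every $1\le m\le k$ the projection $\pi_m:\mathcal J^m_E\to\mathcal J^{m-1}_E$ that quotients out $\Omega^m_S\otimes E$ is a surjective bimodule map for the bullet actions, and $\pi_m\circ j^m_E=j^{m-1}_E$. -/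

import Mathlib

open scoped TensorProduct RightActions

universe v u

namespace NCJet

/-! ### Bimodules over a `k`-algebra and their tensor product over the algebra -/

/-- An `A`-bimodule over the ground field `k`: commuting left and right actions of `A`, with `k`
acting in the same way from both sides. The right action `x · a` is written `x <• a`. -/
structure BiMod (k : Type v) (A : Type u) [Field k] [Ring A] [Algebra k A] where
  carrier : Type u
  [addCommGroup : AddCommGroup carrier]
  [moduleK : Module k carrier]
  [moduleL : Module A carrier]
  [moduleR : Module Aᵐᵒᵖ carrier]
  [smulComm : SMulCommClass A Aᵐᵒᵖ carrier]
  [towerL : IsScalarTower k A carrier]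
  [towerR : IsScalarTower k Aᵐᵒᵖ carrier]

variable {k : Type v} {A : Type u} [Field k] [Ring A] [Algebra k A]

instance : CoeSort (BiMod k A) (Type u) := ⟨BiMod.carrier⟩

attribute [instance] BiMod.addCommGroup BiMod.moduleK BiMod.moduleL BiMod.moduleR
  BiMod.smulComm BiMod.towerL BiMod.towerR

/-- The algebra `A` as a bimodule over itself. -/
abbrev BiMod.self (k : Type v) (A : Type u) [Field k] [Ring A] [Algebra k A] : BiMod k A where
  carrier := A

/-- An element of `A`, seen in the bimodule `A`. -/
def toSelf (k : Type v) {A : Type u} [Field k] [Ring A] [Algebra k A] (a : A) :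
    BiMod.self k A := a

theorem toSelf_mul (a b : A) : toSelf k (a * b) = a • toSelf k b := rfl
theorem toSelf_mul' (a b : A) : toSelf k (a * b) = toSelf k a <• b := rfl

/-- The zero bimodule. -/
def BiMod.zero (k : Type v) (A : Type u) [Field k] [Ring A] [Algebra k A] : BiMod k A where
  carrier := PUnit.{u + 1}

/-- The relations `m a ⊗ n = m ⊗ a n` inside `M ⊗[k] N`. -/
def balancedRel (M N : BiMod k A) : Submodule k (M ⊗[k] N) :=
  Submodule.span k {t | ∃ (m : M) (a : A) (n : N), t = (m <• a) ⊗ₜ[k] n - m ⊗ₜ[k] (a • n)}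

/-- The vector space underlying `M ⊗_A N`. -/
def BT (M N : BiMod k A) : Type u := (M ⊗[k] N) ⧸ balancedRel M N

namespace BT

variable {M N P Q : BiMod k A}

instance : AddCommGroup (BT M N) := inferInstanceAs (AddCommGroup ((M ⊗[k] N) ⧸ balancedRel M N))
instance : Module k (BT M N) := inferInstanceAs (Module k ((M ⊗[k] N) ⧸ balancedRel M N))

/-- `(m, n) ↦ m ⊗ n` as a `k`-bilinear map. -/
def mkL (M N : BiMod k A) : M →ₗ[k] N →ₗ[k] BT M N :=
  (TensorProduct.mk k M N).compr₂ (balancedRel M N).mkQ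

/-- The elementary tensor `m ⊗ n`. -/
def mk (m : M) (n : N) : BT M N := mkL M N m n

theorem mk_balanced (m : M) (a : A) (n : N) : mk (m <• a) n = mk m (a • n) :=
  (Submodule.Quotient.eq (balancedRel M N)).2 (Submodule.subset_span ⟨m, a, n, rfl⟩)

theorem mk_add_left (m m' : M) (n : N) : mk (m + m') n = mk m n + mk m' n := by simp [mk]
theorem mk_add_right (m : M) (n n' : N) : mk m (n + n') = mk m n + mk m n' := by simp [mk]
theorem mk_smul_left (c : k) (m : M) (n : N) : mk (c • m) n = c • mk m n := by simp [mk]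
theorem mk_smul_right (c : k) (m : M) (n : N) : mk m (c • n) = c • mk m n := by simp [mk]

theorem induction {p : BT M N → Prop} (h0 : p 0) (hmk : ∀ m n, p (mk m n))
    (hadd : ∀ x y, p x → p y → p (x + y)) (x : BT M N) : p x := by
  obtain ⟨t, rfl⟩ := (balancedRel M N).mkQ_surjective x
  induction t with
  | zero => rw [map_zero]; exact h0
  | tmul m n => exact hmk m n
  | add s t hs ht => rw [map_add]; exact hadd _ _ hs ht

/-- The map out of `M ⊗_A N` given by a balanced `k`-bilinear map. -/
def lift {V : Type*} [AddCommGroup V] [Module k V] (f : M →ₗ[k] N →ₗ[k] V)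
    (hf : ∀ (m : M) (a : A) (n : N), f (m <• a) n = f m (a • n)) : BT M N →ₗ[k] V :=
  (balancedRel M N).liftQ (TensorProduct.lift f) (by
    refine Submodule.span_le.2 ?_
    rintro _ ⟨m, a, n, rfl⟩
    simp [hf])

theorem lift_mk {V : Type*} [AddCommGroup V] [Module k V] (f : M →ₗ[k] N →ₗ[k] V)
    (hf : ∀ (m : M) (a : A) (n : N), f (m <• a) n = f m (a • n)) (m : M) (n : N) : lift f hf (mk m n) = f m n := by
  exact TensorProduct.lift.tmul (f' := f) m n

theorem hom_ext {V : Type*} [AddCommGroup V] [Module k V] {f g : BT M N →ₗ[k] V}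
    (h : ∀ m n, f (mk m n) = g (mk m n)) : f = g := by
  ext x
  induction x using BT.induction with
  | h0 => simp
  | hmk m n => exact h m n
  | hadd x y hx hy => simp [hx, hy]

/-- `a · (m ⊗ n) = (a m) ⊗ n`. -/
def lact (a : A) : BT M N →ₗ[k] BT M N :=
  lift ((mkL M N).comp (Algebra.lsmul k k M a)) (by
    intro m b n
    change mk (a • (m <• b)) n = mk (a • m) (b • n)
    rw [← mk_balanced, smul_comm])

/-- `(m ⊗ n) · a = m ⊗ (n a)`. -/
def ract (a : Aᵐᵒᵖ) : BT M N →ₗ[k] BT M N :=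
  lift ((mkL M N).compl₂ (Algebra.lsmul k k N a)) (by
    intro m b n
    change mk (m <• b) (a • n) = mk m (a • (b • n))
    rw [mk_balanced, smul_comm])

theorem lact_mk (a : A) (m : M) (n : N) : lact a (mk m n) = mk (a • m) n := lift_mk _ _ _ _
theorem ract_mk (a : Aᵐᵒᵖ) (m : M) (n : N) : ract a (mk m n) = mk m (a • n) := lift_mk _ _ _ _

theorem lact_one : lact (1 : A) = (LinearMap.id : BT M N →ₗ[k] BT M N) :=
  hom_ext fun m n => by simp [lact_mk]
theorem lact_mul (a b : A) : (lact (a * b) : BT M N →ₗ[k] BT M N) = lact a ∘ₗ lact b :=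
  hom_ext fun m n => by simp [lact_mk, mul_smul]
theorem lact_add (a b : A) : (lact (a + b) : BT M N →ₗ[k] BT M N) = lact a + lact b :=
  hom_ext fun m n => by simp [lact_mk, add_smul, mk_add_left]
theorem lact_smul (c : k) (a : A) : (lact (c • a) : BT M N →ₗ[k] BT M N) = c • lact a :=
  hom_ext fun m n => by simp [lact_mk, mk_smul_left]
theorem ract_one : ract (1 : Aᵐᵒᵖ) = (LinearMap.id : BT M N →ₗ[k] BT M N) :=
  hom_ext fun m n => by simp [ract_mk]
theorem ract_mul (a b : Aᵐᵒᵖ) : (ract (a * b) : BT M N →ₗ[k] BT M N) = ract a ∘ₗ ract b :=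
  hom_ext fun m n => by simp [ract_mk, mul_smul]
theorem ract_add (a b : Aᵐᵒᵖ) : (ract (a + b) : BT M N →ₗ[k] BT M N) = ract a + ract b :=
  hom_ext fun m n => by simp [ract_mk, add_smul, mk_add_right]
theorem ract_smul (c : k) (a : Aᵐᵒᵖ) : (ract (c • a) : BT M N →ₗ[k] BT M N) = c • ract a :=
  hom_ext fun m n => by simp [ract_mk, mk_smul_right]
theorem lact_ract (a : A) (b : Aᵐᵒᵖ) :
    (lact a : BT M N →ₗ[k] BT M N) ∘ₗ ract b = ract b ∘ₗ lact a :=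
  hom_ext fun m n => by simp [lact_mk, ract_mk]

instance : Module A (BT M N) where
  smul a x := lact a x
  one_smul x := LinearMap.congr_fun lact_one x
  mul_smul a b x := LinearMap.congr_fun (lact_mul a b) x
  smul_zero a := map_zero (lact a)
  smul_add a x y := map_add (lact a) x y
  add_smul a b x := LinearMap.congr_fun (lact_add a b) x
  zero_smul x := by
    have h := LinearMap.congr_fun (lact_smul (M := M) (N := N) (0 : k) (0 : A)) x
    rw [zero_smul, zero_smul] at h
    exact h

instance : Module Aᵐᵒᵖ (BT M N) where
  smul a x := ract a x
  one_smul x := LinearMap.congr_fun ract_one x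
  mul_smul a b x := LinearMap.congr_fun (ract_mul a b) x
  smul_zero a := map_zero (ract a)
  smul_add a x y := map_add (ract a) x y
  add_smul a b x := LinearMap.congr_fun (ract_add a b) x
  zero_smul x := by
    have h := LinearMap.congr_fun (ract_smul (M := M) (N := N) (0 : k) (0 : Aᵐᵒᵖ)) x
    rw [zero_smul, zero_smul] at h
    exact h

instance : SMulCommClass A Aᵐᵒᵖ (BT M N) := ⟨fun a b x => LinearMap.congr_fun (lact_ract a b) x⟩
instance : IsScalarTower k A (BT M N) := ⟨fun c a x => LinearMap.congr_fun (lact_smul c a) x⟩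
instance : IsScalarTower k Aᵐᵒᵖ (BT M N) := ⟨fun c a x => LinearMap.congr_fun (ract_smul c a) x⟩

theorem smul_mk (a : A) (m : M) (n : N) : a • mk m n = mk (a • m) n := lact_mk a m n
theorem mk_ract (a : A) (m : M) (n : N) : mk m n <• a = mk m (n <• a) :=
  ract_mk (MulOpposite.op a) m n

end BT

/-- The bimodule `M ⊗_A N`. -/
def tens (M N : BiMod k A) : BiMod k A where
  carrier := BT M N

/-- The elementary tensor `m ⊗ n` in `M ⊗_A N`. -/
def tm {M N : BiMod k A} (m : M) (n : N) : tens M N := BT.mk m n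

section TensorLemmas

variable {M N : BiMod k A}

theorem tm_balanced (m : M) (a : A) (n : N) : tm (m <• a) n = tm m (a • n) := BT.mk_balanced m a n
theorem tm_add_left (m m' : M) (n : N) : tm (m + m') n = tm m n + tm m' n := BT.mk_add_left m m' n
theorem tm_add_right (m : M) (n n' : N) : tm m (n + n') = tm m n + tm m n' :=
  BT.mk_add_right m n n'
theorem tm_smul_left (c : k) (m : M) (n : N) : tm (c • m) n = c • tm m n := BT.mk_smul_left c m n
theorem tm_smul_right (c : k) (m : M) (n : N) : tm m (c • n) = c • tm m n :=
  BT.mk_smul_right c m n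
theorem smul_tm (a : A) (m : M) (n : N) : a • tm m n = tm (a • m) n := BT.smul_mk a m n
theorem tm_ract (a : A) (m : M) (n : N) : tm m n <• a = tm m (n <• a) := BT.mk_ract a m n

theorem tm_induction {p : tens M N → Prop} (h0 : p 0) (htm : ∀ m n, p (tm m n))
    (hadd : ∀ x y, p x → p y → p (x + y)) (x : tens M N) : p x := BT.induction h0 htm hadd x

/-- `(m, n) ↦ m ⊗ n` as a `k`-bilinear map. -/
def tmL (M N : BiMod k A) : M →ₗ[k] N →ₗ[k] tens M N := BT.mkL M N

/-- The map out of `M ⊗_A N` given by a balanced `k`-bilinear map. -/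
def tlift {V : Type*} [AddCommGroup V] [Module k V] (f : M →ₗ[k] N →ₗ[k] V)
    (hf : ∀ (m : M) (a : A) (n : N), f (m <• a) n = f m (a • n)) : tens M N →ₗ[k] V := BT.lift f hf

theorem tlift_tm {V : Type*} [AddCommGroup V] [Module k V] (f : M →ₗ[k] N →ₗ[k] V)
    (hf : ∀ (m : M) (a : A) (n : N), f (m <• a) n = f m (a • n)) (m : M) (n : N) : tlift f hf (tm m n) = f m n :=
  BT.lift_mk f hf m n

end TensorLemmas

/-! ### Bimodule maps -/

/-- Bimodule maps. -/
structure Hom (M N : BiMod k A) extends M →ₗ[k] N where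
  map_lact : ∀ (a : A) (x : M), toFun (a • x) = a • toFun x
  map_ract : ∀ (a : A) (x : M), toFun (x <• a) = toFun x <• a

namespace Hom

variable {M N P Q : BiMod k A}

instance : CoeFun (Hom M N) (fun _ => M → N) := ⟨fun f => f.toLinearMap⟩

theorem lact (f : Hom M N) (a : A) (x : M) : f (a • x) = a • f x := f.map_lact a x
theorem ract (f : Hom M N) (a : A) (x : M) : f (x <• a) = f x <• a := f.map_ract a x

/-- The identity. -/
def id (M : BiMod k A) : Hom M M := ⟨LinearMap.id, fun _ _ => rfl, fun _ _ => rfl⟩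

/-- Composition `g ∘ f`. -/
def comp (g : Hom N P) (f : Hom M N) : Hom M P :=
  ⟨g.toLinearMap ∘ₗ f.toLinearMap,
    fun a x => (congrArg g (f.map_lact a x)).trans (g.map_lact a _),
    fun a x => (congrArg g (f.map_ract a x)).trans (g.map_ract a _)⟩

/-- The zero map. -/
def zero (M N : BiMod k A) : Hom M N :=
  ⟨0, fun a _ => (smul_zero a).symm, fun a _ => (smul_zero (MulOpposite.op a)).symm⟩

/-- The sum of two bimodule maps. -/
def add (f g : Hom M N) : Hom M N :=
  ⟨f.toLinearMap + g.toLinearMap,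
    fun a x => (congrArg₂ (· + ·) (f.map_lact a x) (g.map_lact a x)).trans (smul_add a _ _).symm,
    fun a x => (congrArg₂ (· + ·) (f.map_ract a x) (g.map_ract a x)).trans
      (smul_add (MulOpposite.op a) _ _).symm⟩

/-- A `k`-linear map out of `M ⊗_A N` that respects both actions on elementary tensors. -/
def ofTens (f : tens M N →ₗ[k] P) (hl : ∀ (a : A) (m : M) (n : N), f (a • tm m n) = a • f (tm m n))
    (hr : ∀ (a : A) (m : M) (n : N), f (tm m n <• a) = f (tm m n) <• a) : Hom (tens M N) P :=
  ⟨f, fun a x => by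
      change f (a • x) = a • f x
      induction x using tm_induction with
      | h0 => simp
      | htm m n => exact hl a m n
      | hadd x y hx hy => rw [smul_add, map_add, map_add, smul_add, hx, hy],
    fun a x => by
      change f (x <• a) = f x <• a
      induction x using tm_induction with
      | h0 => simp
      | htm m n => exact hr a m n
      | hadd x y hx hy => rw [smul_add, map_add, map_add, smul_add, hx, hy]⟩

/-- `f ⊗ g`. -/
def tmap (f : Hom M P) (g : Hom N Q) : Hom (tens M N) (tens P Q) :=
  ofTens (tlift ((tmL P Q).compl₁₂ f.toLinearMap g.toLinearMap) (by
      intro m a n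
      change tm (f (m <• a)) (g n) = tm (f m) (g (a • n))
      rw [f.ract, g.lact]; exact tm_balanced _ _ _))
    (by
      intro a m n
      rw [smul_tm, tlift_tm, tlift_tm]
      change tm (f (a • m)) (g n) = a • tm (f m) (g n)
      rw [f.lact, smul_tm])
    (by
      intro a m n
      rw [tm_ract, tlift_tm, tlift_tm]
      change tm (f m) (g (n <• a)) = tm (f m) (g n) <• a
      rw [g.ract, tm_ract])

theorem tmap_tm (f : Hom M P) (g : Hom N Q) (m : M) (n : N) :
    tmap f g (tm m n) = tm (f m) (g n) := by
  unfold tmap ofTens; dsimp only; rw [tlift_tm]; rfl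

/-- For fixed `p`, the map `M ⊗_A N → M ⊗_A (N ⊗_A P)`, `m ⊗ n ↦ m ⊗ (n ⊗ p)`. -/
def assocAux (M N P : BiMod k A) : tens M N →ₗ[k] P →ₗ[k] tens M (tens N P) :=
  tlift (LinearMap.mk₂ k
      (fun (m : M) (n : N) => (tmL M (tens N P) m) ∘ₗ (tmL N P n))
      (by intros; ext; simp) (by intros; ext; simp) (by intros; ext; simp) (by intros; ext; simp))
    (by
      intro m a n
      ext p
      change tm (m <• a) (tm n p) = tm m (tm (a • n) p)
      rw [tm_balanced, smul_tm])

theorem assocAux_tm (m : M) (n : N) (p : P) : assocAux M N P (tm m n) p = tm m (tm n p) := by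
  unfold assocAux; rw [tlift_tm]; rfl

/-- The associator `(m ⊗ n) ⊗ p ↦ m ⊗ (n ⊗ p)`. -/
def assoc (M N P : BiMod k A) : Hom (tens (tens M N) P) (tens M (tens N P)) :=
  ofTens (tlift (assocAux M N P) (by
      intro x a p
      induction x using tm_induction with
      | h0 => simp
      | htm m n => rw [tm_ract, assocAux_tm, assocAux_tm, tm_balanced]
      | hadd x y hx hy => rw [smul_add, map_add, map_add, LinearMap.add_apply, LinearMap.add_apply,
          hx, hy]))
    (by
      intro a x p
      rw [smul_tm, tlift_tm, tlift_tm]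
      induction x using tm_induction with
      | h0 => simp
      | htm m n => rw [smul_tm, assocAux_tm, assocAux_tm, smul_tm]
      | hadd x y hx hy => rw [smul_add, map_add, map_add, LinearMap.add_apply, LinearMap.add_apply,
          smul_add, hx, hy])
    (by
      intro a x p
      rw [tm_ract, tlift_tm, tlift_tm]
      induction x using tm_induction with
      | h0 => simp
      | htm m n => rw [assocAux_tm, assocAux_tm, tm_ract, tm_ract]
      | hadd x y hx hy => rw [map_add, LinearMap.add_apply, LinearMap.add_apply,
          smul_add, hx, hy])

theorem assoc_tm (m : M) (n : N) (p : P) : assoc M N P (tm (tm m n) p) = tm m (tm n p) := by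
  unfold assoc ofTens; dsimp only; rw [tlift_tm, assocAux_tm]

/-- For fixed `m`, the map `N ⊗_A P → (M ⊗_A N) ⊗_A P`, `n ⊗ p ↦ (m ⊗ n) ⊗ p`. -/
def assocInvAux (M N P : BiMod k A) : M →ₗ[k] tens N P →ₗ[k] tens (tens M N) P :=
  LinearMap.flip (tlift (LinearMap.mk₂ k
      (fun (n : N) (p : P) => ((tmL (tens M N) P).flip p) ∘ₗ ((tmL M N).flip n))
      (by intros; ext; simp) (by intros; ext; simp) (by intros; ext; simp) (by intros; ext; simp))
    (by
      intro n a p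
      ext m
      change tm (tm m (n <• a)) p = tm (tm m n) (a • p)
      rw [← tm_balanced, tm_ract]))

theorem assocInvAux_tm (m : M) (n : N) (p : P) :
    assocInvAux M N P m (tm n p) = tm (tm m n) p := by
  unfold assocInvAux; rw [LinearMap.flip_apply, tlift_tm]; rfl

/-- The inverse associator `m ⊗ (n ⊗ p) ↦ (m ⊗ n) ⊗ p`. -/
def assocInv (M N P : BiMod k A) : Hom (tens M (tens N P)) (tens (tens M N) P) :=
  ofTens (tlift (assocInvAux M N P) (by
      intro m a x
      induction x using tm_induction with
      | h0 => simp
      | htm n p => rw [smul_tm, assocInvAux_tm, assocInvAux_tm, tm_balanced]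
      | hadd x y hx hy => rw [smul_add, map_add, map_add, hx, hy]))
    (by
      intro a m x
      rw [smul_tm, tlift_tm, tlift_tm]
      induction x using tm_induction with
      | h0 => simp
      | htm n p => rw [assocInvAux_tm, assocInvAux_tm, smul_tm, smul_tm]
      | hadd x y hx hy => rw [map_add, map_add, smul_add, hx, hy])
    (by
      intro a m x
      rw [tm_ract, tlift_tm, tlift_tm]
      induction x using tm_induction with
      | h0 => simp
      | htm n p => rw [tm_ract, assocInvAux_tm, assocInvAux_tm, tm_ract]
      | hadd x y hx hy => rw [smul_add, map_add, map_add, smul_add, hx, hy])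

theorem assocInv_tm (m : M) (n : N) (p : P) : assocInv M N P (tm m (tm n p)) = tm (tm m n) p := by
  unfold assocInv ofTens; dsimp only; rw [tlift_tm, assocInvAux_tm]

/-- `(a, m) ↦ a m` as a `k`-bilinear map. -/
def lunitAux (M : BiMod k A) : BiMod.self k A →ₗ[k] M →ₗ[k] M :=
  (Algebra.lsmul k k M : A →ₐ[k] Module.End k M).toLinearMap

/-- `(m, a) ↦ m a` as a `k`-bilinear map. -/
def runitAux (M : BiMod k A) : M →ₗ[k] BiMod.self k A →ₗ[k] M :=
  LinearMap.flip ((Algebra.lsmul k k M : Aᵐᵒᵖ →ₐ[k] Module.End k M).toLinearMap ∘ₗ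
    (MulOpposite.opLinearEquiv k : A ≃ₗ[k] Aᵐᵒᵖ).toLinearMap)

theorem lunitAux_balanced (M : BiMod k A) (a : BiMod.self k A) (b : A) (m : M) :
    lunitAux M (a <• b) m = lunitAux M a (b • m) :=
  (fun (a b : A) => mul_smul a b m) a b

theorem lunitAux_lact (M : BiMod k A) (a : A) (b : BiMod.self k A) (m : M) :
    lunitAux M (a • b) m = a • lunitAux M b m :=
  (fun (a b : A) => mul_smul a b m) a b

theorem lunitAux_ract (M : BiMod k A) (a : A) (b : BiMod.self k A) (m : M) :
    lunitAux M b (m <• a) = lunitAux M b m <• a :=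
  (fun b : A => smul_comm b (MulOpposite.op a) m) b

theorem runitAux_balanced (M : BiMod k A) (m : M) (a : A) (b : BiMod.self k A) :
    runitAux M (m <• a) b = runitAux M m (a • b) :=
  (fun b : A => (mul_smul (MulOpposite.op b) (MulOpposite.op a) m).symm) b

theorem runitAux_lact (M : BiMod k A) (a : A) (m : M) (b : BiMod.self k A) :
    runitAux M (a • m) b = a • runitAux M m b :=
  (fun b : A => (smul_comm a (MulOpposite.op b) m).symm) b

theorem runitAux_ract (M : BiMod k A) (a : A) (m : M) (b : BiMod.self k A) :
    runitAux M m (b <• a) = runitAux M m b <• a :=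
  (fun b : A => mul_smul (MulOpposite.op a) (MulOpposite.op b) m) b

/-- `A ⊗_A M → M`, `a ⊗ m ↦ a m`. -/
def lunit (M : BiMod k A) : Hom (tens (BiMod.self k A) M) M :=
  ofTens (tlift (lunitAux M) (lunitAux_balanced M))
    (by
      intro a b m
      rw [smul_tm, tlift_tm, tlift_tm]
      exact lunitAux_lact M a b m)
    (by
      intro a b m
      rw [tm_ract, tlift_tm, tlift_tm]
      exact lunitAux_ract M a b m)

theorem lunit_tm (a : A) (m : M) : lunit M (tm (toSelf k a) m) = a • m := by
  unfold lunit ofTens; dsimp only; rw [tlift_tm]; rfl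

/-- `M ⊗_A A → M`, `m ⊗ a ↦ m a`. -/
def runit (M : BiMod k A) : Hom (tens M (BiMod.self k A)) M :=
  ofTens (tlift (runitAux M) (runitAux_balanced M))
    (by
      intro a m b
      rw [smul_tm, tlift_tm, tlift_tm]
      exact runitAux_lact M a m b)
    (by
      intro a m b
      rw [tm_ract, tlift_tm, tlift_tm]
      exact runitAux_ract M a m b)

theorem runit_tm (m : M) (a : A) : runit M (tm m (toSelf k a)) = m <• a := by
  unfold runit ofTens; dsimp only; rw [tlift_tm]; rfl

/-- The identification of equal members of a family of bimodules. -/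
def ofEq (F : ℕ → BiMod k A) {m n : ℕ} (h : m = n) : Hom (F m) (F n) := h ▸ Hom.id (F m)

end Hom

/-! ### Differential calculus and connections -/

/-- A differential graded algebra over `A` up to degree two: bimodules `Ω¹`, `Ω²`, the wedge
product `Ω¹ ⊗_A Ω¹ → Ω²` and the differentials `d : A → Ω¹`, `d : Ω¹ → Ω²`, with the graded
Leibniz rule and `d² = 0`, generated in degrees `≤ 2` by `A` and `d A`. -/
structure Calculus (k : Type v) (A : Type u) [Field k] [Ring A] [Algebra k A] where
  Om1 : BiMod k A
  Om2 : BiMod k A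
  d0 : A →ₗ[k] Om1
  d0_mul : ∀ a b : A, d0 (a * b) = a • d0 b + d0 a <• b
  span_d0 : Submodule.span k {w : Om1 | ∃ a b : A, w = a • d0 b} = ⊤
  wedge : Hom (tens Om1 Om1) Om2
  wedge_surjective : Function.Surjective wedge
  d1 : Om1 →ₗ[k] Om2
  d1_smul : ∀ (a : A) (w : Om1), d1 (a • w) = wedge (tm (d0 a) w) + a • d1 w
  d1_ract : ∀ (w : Om1) (a : A), d1 (w <• a) = d1 w <• a - wedge (tm w (d0 a))
  d1_d0 : ∀ a : A, d1 (d0 a) = 0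

variable {C : Calculus k A}

/-- A left connection `∇ : E → Ω¹ ⊗_A E`. -/
structure LeftConn (C : Calculus k A) (E : BiMod k A) where
  nabla : E →ₗ[k] tens C.Om1 E
  nabla_smul : ∀ (a : A) (e : E), nabla (a • e) = tm (C.d0 a) e + a • nabla e

/-- A (left) bimodule connection `∇ : E → Ω¹ ⊗_A E` with generalised braiding
`σ : E ⊗_A Ω¹ → Ω¹ ⊗_A E`. -/
structure BimodConn (C : Calculus k A) (E : BiMod k A) extends LeftConn C E where
  sigma : Hom (tens E C.Om1) (tens C.Om1 E)
  nabla_ract : ∀ (e : E) (a : A), nabla (e <• a) = nabla e <• a + sigma (tm e (C.d0 a))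

/-- The connection `d : A → Ω¹ ⊗_A A` on `A`, `a ↦ d a ⊗ 1` (where `Ω¹ ⊗_A A ≅ Ω¹`). -/
def trivConn (C : Calculus k A) : LeftConn C (BiMod.self k A) where
  nabla := ((tmL C.Om1 (BiMod.self k A)).flip (toSelf k 1)) ∘ₗ C.d0
  nabla_smul := by
    have h : ∀ a b : A, tm (C.d0 (a * b)) (toSelf k (1 : A))
        = tm (C.d0 a) (toSelf k b) + a • tm (C.d0 b) (toSelf k (1 : A)) := by
      intro a b
      rw [C.d0_mul, tm_add_left, smul_tm, tm_balanced, ← toSelf_mul, mul_one, add_comm]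
    exact fun a b => h a b

/-- The braiding `σ_M` applied to the first two factors, `M ⊗ Ω¹ ⊗ F → Ω¹ ⊗ M ⊗ F`. -/
def braidFirst {M : BiMod k A} (s : Hom (tens M C.Om1) (tens C.Om1 M)) (F : BiMod k A) :
    Hom (tens M (tens C.Om1 F)) (tens C.Om1 (tens M F)) :=
  (Hom.assoc C.Om1 M F).comp ((s.tmap (Hom.id F)).comp (Hom.assocInv M C.Om1 F))

theorem braidFirst_tm {M : BiMod k A} (s : Hom (tens M C.Om1) (tens C.Om1 M)) (F : BiMod k A)
    (m : M) (w : C.Om1) (f : F) :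
    braidFirst s F (tm m (tm w f)) = Hom.assoc C.Om1 M F (tm (s (tm m w)) f) := by
  change Hom.assoc C.Om1 M F (s.tmap (Hom.id F) (Hom.assocInv M C.Om1 F (tm m (tm w f)))) = _
  rw [Hom.assocInv_tm, Hom.tmap_tm]; rfl

/-- The tensor product connection
`∇_{M ⊗ F} = ∇_M ⊗ id + (σ_M ⊗ id)(id ⊗ ∇_F) : M ⊗_A F → Ω¹ ⊗_A M ⊗_A F`. -/
def tensorConn {M F : BiMod k A} (D : BimodConn C M) (G : LeftConn C F) :
    LeftConn C (tens M F) where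
  nabla := tlift
    (((tmL (tens C.Om1 M) F).compl₁₂ D.nabla LinearMap.id).compr₂
        (Hom.assoc C.Om1 M F).toLinearMap
      + ((tmL M (tens C.Om1 F)).compl₁₂ LinearMap.id G.nabla).compr₂
        (braidFirst D.sigma F).toLinearMap) (by
      intro m a f
      change Hom.assoc C.Om1 M F (tm (D.nabla (m <• a)) f)
          + braidFirst D.sigma F (tm (m <• a) (G.nabla f))
        = Hom.assoc C.Om1 M F (tm (D.nabla m) (a • f))
          + braidFirst D.sigma F (tm m (G.nabla (a • f)))
      rw [D.nabla_ract, G.nabla_smul, tm_add_left, tm_add_right, map_add, map_add, tm_balanced,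
        tm_balanced, braidFirst_tm, add_assoc])
  nabla_smul := by
    intro a x
    induction x using tm_induction with
    | h0 =>
      have h : tm (M := C.Om1) (N := tens M F) (C.d0 a) 0 = 0 :=
        map_zero (tmL C.Om1 (tens M F) (C.d0 a))
      rw [smul_zero, map_zero, smul_zero, add_zero, h]
    | htm m f =>
      rw [smul_tm, tlift_tm, tlift_tm]
      change Hom.assoc C.Om1 M F (tm (D.nabla (a • m)) f)
          + braidFirst D.sigma F (tm (a • m) (G.nabla f))
        = tm (C.d0 a) (tm m f) + a • (Hom.assoc C.Om1 M F (tm (D.nabla m) f)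
          + braidFirst D.sigma F (tm m (G.nabla f)))
      rw [D.nabla_smul, tm_add_left, map_add, Hom.assoc_tm, smul_add, ← (Hom.assoc C.Om1 M F).lact,
        ← (braidFirst D.sigma F).lact, smul_tm, smul_tm, add_assoc]
    | hadd x y hx hy =>
      rw [smul_add, map_add, hx, hy, map_add, smul_add, tm_add_right]
      abel

theorem tensorConn_tm {M F : BiMod k A} (D : BimodConn C M) (G : LeftConn C F) (m : M) (f : F) :
    (tensorConn D G).nabla (tm m f) = Hom.assoc C.Om1 M F (tm (D.nabla m) f)
      + braidFirst D.sigma F (tm m (G.nabla f)) := by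
  unfold tensorConn; dsimp only; rw [tlift_tm]; rfl

/-- The wedge product of the first two factors, `Ω¹ ⊗ Ω¹ ⊗ F → Ω² ⊗ F`. -/
def wedgeFirst (C : Calculus k A) (F : BiMod k A) :
    Hom (tens C.Om1 (tens C.Om1 F)) (tens C.Om2 F) :=
  (C.wedge.tmap (Hom.id F)).comp (Hom.assocInv C.Om1 C.Om1 F)

theorem wedgeFirst_tm (F : BiMod k A) (w w' : C.Om1) (f : F) :
    wedgeFirst C F (tm w (tm w' f)) = tm (C.wedge (tm w w')) f := by
  change C.wedge.tmap (Hom.id F) (Hom.assocInv C.Om1 C.Om1 F (tm w (tm w' f))) = _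
  rw [Hom.assocInv_tm, Hom.tmap_tm]; rfl

/-- The operator `d ⊗ id - id ∧ ∇ : Ω¹ ⊗_A E → Ω² ⊗_A E`. -/
def extDer {E : BiMod k A} (D : LeftConn C E) : tens C.Om1 E →ₗ[k] tens C.Om2 E :=
  tlift
    ((tmL C.Om2 E).compl₁₂ C.d1 LinearMap.id
      - ((tmL C.Om1 (tens C.Om1 E)).compl₁₂ LinearMap.id D.nabla).compr₂
        (wedgeFirst C E).toLinearMap) (by
      intro w a e
      change tm (C.d1 (w <• a)) e - wedgeFirst C E (tm (w <• a) (D.nabla e))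
        = tm (C.d1 w) (a • e) - wedgeFirst C E (tm w (D.nabla (a • e)))
      have h : tm (C.d1 (w <• a)) e = tm (C.d1 w <• a) e - tm (C.wedge (tm w (C.d0 a))) e := by
        rw [C.d1_ract]
        exact LinearMap.congr_fun (map_sub (tmL C.Om2 E) _ _) e
      rw [h, D.nabla_smul, tm_add_right, map_add, wedgeFirst_tm, tm_balanced, tm_balanced]
      abel)

theorem extDer_tm {E : BiMod k A} (D : LeftConn C E) (w : C.Om1) (e : E) :
    extDer D (tm w e) = tm (C.d1 w) e - wedgeFirst C E (tm w (D.nabla e)) := by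
  unfold extDer; rw [tlift_tm]; rfl

/-- The curvature `R_E = (d ⊗ id - id ∧ ∇_E) ∇_E : E → Ω² ⊗_A E`. -/
def curvature {E : BiMod k A} (D : LeftConn C E) : E →ₗ[k] tens C.Om2 E := extDer D ∘ₗ D.nabla

/-- `∇_E` is flat. -/
def IsFlat {E : BiMod k A} (D : LeftConn C E) : Prop := ∀ e : E, curvature D e = 0

/-- A connection on `Ω¹` is torsion free: `∧ ∇ = d`. -/
def TorsionFree (D : LeftConn C C.Om1) : Prop := ∀ w : C.Om1, C.wedge (D.nabla w) = C.d1 w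

/-- A bimodule connection on `Ω¹` is `∧`-compatible:
`∇_{Ω²}(η ∧ ω) = (∇η) ∧ ω + ∧₂ σ₁ (η ⊗ ∇ω)` is a well-defined bimodule connection on `Ω²`. -/
def WedgeCompatible (D : BimodConn C C.Om1) : Prop :=
  ∃ G : BimodConn C C.Om2, ∀ x : tens C.Om1 C.Om1,
    G.nabla (C.wedge x) = (Hom.id C.Om1).tmap C.wedge ((tensorConn D D.toLeftConn).nabla x)

/-- `(id ⊗ σ_E)(σ_E ⊗ id) : E ⊗ Ω¹ ⊗ Ω¹ → Ω¹ ⊗ Ω¹ ⊗ E`. -/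
def braidTwo {E : BiMod k A} (s : Hom (tens E C.Om1) (tens C.Om1 E)) :
    Hom (tens E (tens C.Om1 C.Om1)) (tens C.Om1 (tens C.Om1 E)) :=
  ((Hom.id C.Om1).tmap s).comp (braidFirst s C.Om1)

/-- A bimodule connection on `E` is extendable: `σ_E` extends to a well-defined bimodule map
`σ_{E,Ω²} : E ⊗_A Ω² → Ω² ⊗_A E`, `e ⊗ η ∧ ζ ↦ (∧ ⊗ id)(id ⊗ σ_E)(σ_E ⊗ id)(e ⊗ η ⊗ ζ)`. -/
def Extendable {E : BiMod k A} (D : BimodConn C E) : Prop :=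
  ∃ s : Hom (tens E C.Om2) (tens C.Om2 E), ∀ (e : E) (x : tens C.Om1 C.Om1),
    s (tm e (C.wedge x)) = wedgeFirst C E (braidTwo D.sigma (tm e x))

/-- A bimodule connection on `E` is Leibniz compatible with one on `Ω¹`: the braiding `σ_E`
intertwines the tensor product connections, `∇_{Ω¹ ⊗ E} σ_E = (id ⊗ σ_E) ∇_{E ⊗ Ω¹}`.
For `E = Ω¹` this reads `∇₂ σ₁ = σ₂ ∇₂`. -/
def LeibnizCompatible (D : BimodConn C C.Om1) {E : BiMod k A} (G : BimodConn C E) : Prop :=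
  ∀ x : tens E C.Om1,
    (tensorConn D G.toLeftConn).nabla (G.sigma x)
      = (Hom.id C.Om1).tmap G.sigma ((tensorConn G D.toLeftConn).nabla x)

/-! ### Tensor powers of `Ω¹`, braidings and quantum symmetric forms -/

/-- `(Ω¹)^{⊗ n} ⊗_A E`, nested to the right. -/
@[reducible] def pre (C : Calculus k A) (E : BiMod k A) : ℕ → BiMod k A
  | 0 => E
  | n + 1 => tens C.Om1 (pre C E n)

/-- `(Ω¹)^{⊗ n}`, realised as `(Ω¹)^{⊗ n} ⊗_A A`. -/
abbrev TP (C : Calculus k A) (n : ℕ) : BiMod k A := pre C (BiMod.self k A) n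

/-- `id^n ⊗ f`. -/
def preMap (C : Calculus k A) {X Y : BiMod k A} (f : Hom X Y) :
    (n : ℕ) → Hom (pre C X n) (pre C Y n)
  | 0 => f
  | n + 1 => (Hom.id C.Om1).tmap (preMap C f n)

/-- `((Ω¹)^{⊗ n} ⊗ X) ⊗ Y ≅ (Ω¹)^{⊗ n} ⊗ (X ⊗ Y)`. -/
def preAssoc (C : Calculus k A) (X Y : BiMod k A) :
    (n : ℕ) → Hom (tens (pre C X n) Y) (pre C (tens X Y) n)
  | 0 => Hom.id _
  | n + 1 => ((Hom.id C.Om1).tmap (preAssoc C X Y n)).comp (Hom.assoc _ _ _)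

/-- `(Ω¹)^{⊗ i} ⊗ ((Ω¹)^{⊗ j} ⊗ X) ≅ (Ω¹)^{⊗ (i + j)} ⊗ X`. -/
def preAdd (C : Calculus k A) (X : BiMod k A) (j : ℕ) :
    (i : ℕ) → Hom (pre C (pre C X j) i) (pre C X (j + i))
  | 0 => Hom.id _
  | i + 1 => (Hom.id C.Om1).tmap (preAdd C X j i)

/-- `(Ω¹)^{⊗ n} ⊗_A X` with `(Ω¹)^{⊗ n}` as above. -/
def attach (C : Calculus k A) (X : BiMod k A) (n : ℕ) : Hom (tens (TP C n) X) (pre C X n) :=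
  (preMap C (Hom.lunit X) n).comp (preAssoc C (BiMod.self k A) X n)

/-- The tensor product `(Ω¹)^{⊗ i} ⊗_A (Ω¹)^{⊗ j} → (Ω¹)^{⊗ (i + j)}`. -/
def concat (C : Calculus k A) (i j : ℕ) : Hom (tens (TP C i) (TP C j)) (TP C (j + i)) :=
  (preAdd C (BiMod.self k A) j i).comp (attach C (TP C j) i)

/-- `σ` applied to the tensor factors `i + 1` and `i + 2` of `(Ω¹)^{⊗ n} ⊗ X`
(the identity if there are no such factors). -/
def sigmaAt (D : BimodConn C C.Om1) (X : BiMod k A) :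
    (n i : ℕ) → Hom (pre C X n) (pre C X n)
  | 0, _ => Hom.id _
  | 1, _ => Hom.id _
  | n + 2, 0 => braidFirst D.sigma (pre C X n)
  | n + 2, i + 1 => (Hom.id C.Om1).tmap (sigmaAt D X (n + 1) i)

/-- `σ₁ σ₂ ⋯ σ_m` on `(Ω¹)^{⊗ n} ⊗ X`. -/
def sigmaChain (D : BimodConn C C.Om1) (X : BiMod k A) (n : ℕ) :
    (m : ℕ) → Hom (pre C X n) (pre C X n)
  | 0 => Hom.id _
  | m + 1 => (sigmaChain D X n m).comp (sigmaAt D X n m)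

/-- The braided binomial `[n choose m, σ]` on `(Ω¹)^{⊗ n} ⊗ X`, for `0 ≤ m ≤ n`: it is `id` for
`m = 0` and `m = n`, and otherwise
`[n, m] = (id ⊗ [n-1, m-1]) σ₁ ⋯ σ_{n-m} + id ⊗ [n-1, m]`. -/
def binom (D : BimodConn C C.Om1) (X : BiMod k A) : (n m : ℕ) → Hom (pre C X n) (pre C X n)
  | 0, _ => Hom.id _
  | _ + 1, 0 => Hom.id _
  | n + 1, m + 1 =>
    if n ≤ m then Hom.id _
    else (((Hom.id C.Om1).tmap (binom D X n m)).comp (sigmaChain D X (n + 1) (n - m))).add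
      ((Hom.id C.Om1).tmap (binom D X n (m + 1)))

/-- The target of `∧` applied to the tensor factors `i + 1` and `i + 2` of `(Ω¹)^{⊗ n} ⊗ X`. -/
@[reducible] def wedgeCod (C : Calculus k A) (X : BiMod k A) : (n i : ℕ) → BiMod k A
  | 0, _ => BiMod.zero k A
  | 1, _ => BiMod.zero k A
  | n + 2, 0 => tens C.Om2 (pre C X n)
  | n + 2, i + 1 => tens C.Om1 (wedgeCod C X (n + 1) i)

/-- `∧` applied to the tensor factors `i + 1` and `i + 2` of `(Ω¹)^{⊗ n} ⊗ X`
(zero if there are no such factors). -/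
def wedgeAt (C : Calculus k A) (X : BiMod k A) :
    (n i : ℕ) → Hom (pre C X n) (wedgeCod C X n i)
  | 0, _ => Hom.zero _ _
  | 1, _ => Hom.zero _ _
  | n + 2, 0 => wedgeFirst C (pre C X n)
  | n + 2, i + 1 => (Hom.id C.Om1).tmap (wedgeAt C X (n + 1) i)

/-- The vector space underlying `Ω^n_S`, the joint kernel of all `∧_i` on `(Ω¹)^{⊗ n}`. -/
def OmS.space (C : Calculus k A) (n : ℕ) : Submodule A (TP C n) where
  carrier := {x | ∀ i, wedgeAt C (BiMod.self k A) n i x = 0}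
  zero_mem' := fun i => map_zero (wedgeAt C (BiMod.self k A) n i).toLinearMap
  add_mem' := fun {x y} hx hy i =>
    (map_add (wedgeAt C (BiMod.self k A) n i).toLinearMap x y).trans
      ((congrArg₂ (· + ·) (hx i) (hy i)).trans (add_zero _))
  smul_mem' := fun a x hx i => ((wedgeAt C (BiMod.self k A) n i).map_lact a x).trans
    ((congrArg (a • ·) (hx i)).trans (smul_zero a))

/-- The right action on `Ω^n_S`. -/
instance (C : Calculus k A) (n : ℕ) : SMul Aᵐᵒᵖ (OmS.space C n) :=
  ⟨fun a x => ⟨a • x.1, fun i =>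
    ((wedgeAt C (BiMod.self k A) n i).map_ract a.unop x.1).trans
      ((congrArg (a • ·) (x.2 i)).trans (smul_zero a))⟩⟩

instance (C : Calculus k A) (n : ℕ) : Module Aᵐᵒᵖ (OmS.space C n) where
  one_smul x := Subtype.ext (one_smul Aᵐᵒᵖ x.1)
  mul_smul a b x := Subtype.ext (mul_smul a b x.1)
  smul_zero a := Subtype.ext (smul_zero a)
  smul_add a x y := Subtype.ext (smul_add a x.1 y.1)
  add_smul a b x := Subtype.ext (add_smul a b x.1)
  zero_smul x := Subtype.ext (zero_smul Aᵐᵒᵖ x.1)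

/-- The sub-bimodule `Ω^n_S ⊆ (Ω¹)^{⊗ n}` of quantum symmetric `n`-forms. -/
def OmS (C : Calculus k A) (n : ℕ) : BiMod k A where
  carrier := OmS.space C n
  smulComm := ⟨fun a b x => Subtype.ext (smul_comm a b x.1)⟩
  towerL := ⟨fun c a x => Subtype.ext (smul_assoc c a x.1)⟩
  towerR := ⟨fun c a x => Subtype.ext (smul_assoc c a x.1)⟩

/-- The inclusion `Ω^n_S → (Ω¹)^{⊗ n}`. -/
def OmS.incl (C : Calculus k A) (n : ℕ) : Hom (OmS C n) (TP C n) :=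
  ⟨(OmS.space C n).subtype.restrictScalars k, fun _ _ => rfl, fun _ _ => rfl⟩

/-- `Ω^n_S ⊗_A E`. -/
abbrev OmSE (C : Calculus k A) (E : BiMod k A) (n : ℕ) : BiMod k A := tens (OmS C n) E

/-- The canonical map `Ω^n_S ⊗_A E → (Ω¹)^{⊗ n} ⊗_A E`. -/
def OmSE.incl (C : Calculus k A) (E : BiMod k A) (n : ℕ) : Hom (OmSE C E n) (pre C E n) :=
  (attach C E n).comp ((OmS.incl C n).tmap (Hom.id E))

/-- Tensoring with `E` preserves the joint kernel `Ω^n_S`: the canonical map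
`Ω^n_S ⊗_A E → (Ω¹)^{⊗ n} ⊗_A E` is injective, and every element killed by all `∧_i ⊗ id_E`
lies in its image. This holds for all `n` if `E` is flat as a left `A`-module, and for all `E`
if `n ≤ 1`. -/
def PreservesOmS (C : Calculus k A) (E : BiMod k A) (n : ℕ) : Prop :=
  Function.Injective (OmSE.incl C E n) ∧
    ∀ y : pre C E n, (∀ i, wedgeAt C E n i y = 0) → ∃ x, OmSE.incl C E n x = y

/-! ### Higher derivatives -/

/-- `∇_{(n,E)}` on `(Ω¹)^{⊗ n} ⊗_A E`. -/
def higherConn (D : BimodConn C C.Om1) {E : BiMod k A} (G : LeftConn C E) :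
    (n : ℕ) → LeftConn C (pre C E n)
  | 0 => G
  | n + 1 => tensorConn D (higherConn D G n)

/-- `∇_E^n = ∇_{(n-1,E)} ⋯ ∇_{(0,E)} : E → (Ω¹)^{⊗ n} ⊗_A E`. -/
def iterNabla (D : BimodConn C C.Om1) {E : BiMod k A} (G : LeftConn C E) :
    (n : ℕ) → E →ₗ[k] pre C E n
  | 0 => LinearMap.id
  | n + 1 => (higherConn D G n).nabla ∘ₗ iterNabla D G n

/-- `σ_E^n = σ_{E,n} ⋯ σ_{E,1} : E ⊗_A (Ω¹)^{⊗ n} → (Ω¹)^{⊗ n} ⊗_A E`. -/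
def sigmaPow {E : BiMod k A} (G : BimodConn C E) : (n : ℕ) → Hom (tens E (TP C n)) (pre C E n)
  | 0 => Hom.runit E
  | n + 1 => ((Hom.id C.Om1).tmap (sigmaPow G n)).comp (braidFirst G.sigma (TP C n))

/-! ### The product of quantum symmetric forms and the jet bimodules -/

/-- The maps from which the jet bimodules of order up to `N` are built, as restrictions to
quantum symmetric forms of maps that are defined on the whole tensor powers. -/
@[ext]
structure SymData (D : BimodConn C C.Om1) {E : BiMod k A} (G : BimodConn C E) (N : ℕ) where
  /-- The product `⊙ = [i + j choose j, σ] : Ω^i_S ⊗_A Ω^j_S → Ω^{i+j}_S`. -/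
  odot : ∀ i j : ℕ, Hom (tens (OmS C i) (OmS C j)) (OmS C (j + i))
  odot_spec : ∀ (i j : ℕ) (x : OmS C i) (y : OmS C j), OmS.incl C (j + i) (odot i j (tm x y))
    = binom D (BiMod.self k A) (j + i) j (concat C i j (tm (OmS.incl C i x) (OmS.incl C j y)))
  /-- The restriction `σ_{E,Ω_S} : E ⊗_A Ω^n_S → Ω^n_S ⊗_A E` of `σ_E^n`. -/
  sigmaS : ∀ n : ℕ, n ≤ N → Hom (tens E (OmS C n)) (OmSE C E n)
  sigmaS_spec : ∀ (n : ℕ) (hn : n ≤ N) (e : E) (x : OmS C n),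
    OmSE.incl C E n (sigmaS n hn (tm e x)) = sigmaPow G n (tm e (OmS.incl C n x))
  /-- `∇^n : A → Ω^n_S`. -/
  deriv : ∀ n : ℕ, A →ₗ[k] OmS C n
  deriv_spec : ∀ (n : ℕ) (a : A),
    OmS.incl C n (deriv n a) = iterNabla D (trivConn C) n (toSelf k a)
  /-- `∇_E^n : E → Ω^n_S ⊗_A E`. -/
  derivE : ∀ n : ℕ, n ≤ N → E →ₗ[k] OmSE C E n
  derivE_spec : ∀ (n : ℕ) (hn : n ≤ N) (s : E),
    OmSE.incl C E n (derivE n hn s) = iterNabla D G.toLeftConn n s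

namespace SymData

variable {D : BimodConn C C.Om1} {E : BiMod k A} {G : BimodConn C E} {N : ℕ}

/-- The left action `η ⊙_E (ω ⊗ s) = (η ⊙ ω) ⊗ s`, `Ω^i_S ⊗_A (Ω^j_S ⊗_A E) → Ω^{i+j}_S ⊗_A E`. -/
def odotL (S : SymData D G N) (i j : ℕ) : Hom (tens (OmS C i) (OmSE C E j)) (OmSE C E (j + i)) :=
  ((S.odot i j).tmap (Hom.id E)).comp (Hom.assocInv _ _ _)

/-- The right action `(ω ⊗ s) ⊙_E η = ω ⊙ σ_{E,Ω_S}(s ⊗ η)`,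
`(Ω^i_S ⊗_A E) ⊗_A Ω^j_S → Ω^{i+j}_S ⊗_A E`. -/
def odotR (S : SymData D G N) (i j : ℕ) (hj : j ≤ N) :
    Hom (tens (OmSE C E i) (OmS C j)) (OmSE C E (j + i)) :=
  (S.odotL i j).comp (((Hom.id (OmS C i)).tmap (S.sigmaS j hj)).comp (Hom.assoc _ _ _))

end SymData

/-- The jet space `J^m_E = ⊕_{i ≤ m} Ω^i_S ⊗_A E`. -/
abbrev Jet (C : Calculus k A) (E : BiMod k A) (m : ℕ) : Type u :=
  (i : Fin (m + 1)) → OmSE C E i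

namespace SymData

variable {D : BimodConn C C.Om1} {E : BiMod k A} {G : BimodConn C E} {N : ℕ}

/-- The left bullet action: the linear extension of
`a •_m x_j = ∑_{i=j}^m ∇^{i-j} a ⊙_E x_j`, `x_j ∈ Ω^j_S ⊗_A E`. -/
def bulletL (S : SymData D G N) (m : ℕ) (a : A) (x : Jet C E m) : Jet C E m := fun i =>
  ∑ j : Fin (m + 1),
    if h : (j : ℕ) ≤ (i : ℕ) then
      Hom.ofEq (OmSE C E) (Nat.add_sub_of_le h)
        (S.odotL ((i : ℕ) - j) j (tm (S.deriv ((i : ℕ) - j) a) (x j)))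
    else 0

/-- The right bullet action: the linear extension of
`x_j •_m a = ∑_{i=j}^m x_j ⊙_E ∇^{i-j} a`, `x_j ∈ Ω^j_S ⊗_A E`. -/
def bulletR (S : SymData D G N) (m : ℕ) (hm : m ≤ N) (x : Jet C E m) (a : A) : Jet C E m := fun i =>
  ∑ j : Fin (m + 1),
    if h : (j : ℕ) ≤ (i : ℕ) then
      Hom.ofEq (OmSE C E) (Nat.sub_add_cancel h)
        (S.odotR j ((i : ℕ) - j) (((Nat.sub_le _ _).trans i.is_le).trans hm)
          (tm (x j) (S.deriv ((i : ℕ) - j) a)))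
    else 0

/-- The jet prolongation map `j^m_E(s) = s + ∇_E s + ⋯ + ∇_E^m s`. -/
def jet (S : SymData D G N) (m : ℕ) (hm : m ≤ N) : E →ₗ[k] Jet C E m :=
  LinearMap.pi fun i => S.derivE i (i.is_le.trans hm)

end SymData

/-- The projection `π_{m+1} : J^{m+1}_E → J^m_E` that quotients out `Ω^{m+1}_S ⊗_A E`. -/
def jetProj (C : Calculus k A) (E : BiMod k A) (m : ℕ) : Jet C E (m + 1) →ₗ[k] Jet C E m where
  toFun x := fun i => x i.castSucc
  map_add' _ _ := rfl
  map_smul' _ _ := rfl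

/-- The maps `l : A × J → J` and `r : J × A → J` make the vector space `J` an `A`-bimodule. -/
structure IsBimodule (k : Type v) {A : Type u} [Field k] [Ring A] [Algebra k A]
    {J : Type*} [AddCommGroup J] [Module k J] (l : A → J → J) (r : J → A → J) : Prop where
  l_one : ∀ x, l 1 x = x
  l_mul : ∀ a b x, l (a * b) x = l a (l b x)
  l_add_left : ∀ a b x, l (a + b) x = l a x + l b x
  l_add_right : ∀ a x y, l a (x + y) = l a x + l a y
  l_smul_left : ∀ (c : k) a x, l (c • a) x = c • l a x
  l_smul_right : ∀ (c : k) a x, l a (c • x) = c • l a x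
  r_one : ∀ x, r x 1 = x
  r_mul : ∀ a b x, r x (a * b) = r (r x a) b
  r_add_left : ∀ a x y, r (x + y) a = r x a + r y a
  r_add_right : ∀ a b x, r x (a + b) = r x a + r x b
  r_smul_left : ∀ (c : k) a x, r (c • x) a = c • r x a
  r_smul_right : ∀ (c : k) a x, r x (c • a) = c • r x a
  l_r : ∀ a b x, r (l a x) b = l a (r x b)

end NCJet

/-! Everything is reduced to identities between left linear maps on the full tensor powers `(Ω¹)^{⊗
n} ⊗ X`, where the symmetric forms sit as joint kernels. Left linear maps are the right generality:
a braiding of leading factors is natural in left linear maps of the tail, and both a ↦ a y and s ↦ s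
a are left linear.

The braided binomials are sums over shuffles of two blocks: `sh` takes the first factor of the
result either from the first block or, after braiding it past the whole first block, from the second
(`binom_glue`). Comparing Leibniz compatibility at x and at x a gives the braid relation
(`LeibnizCompatible.mixedBraid`), and from it the horizontality of the braidings with any tail.
Hence the shuffle maps are associative (`sh_assoc`), commute with the passage of E (`sigmaTail_sh`)
and are horizontal (`sh_isHorizontal`).

If a left linear map f₀ has successive covariant derivatives f₁, f₂, …, the Pascal recursion of the
shuffles gives the binomial theorem ∇ⁿ(f₀ x) = ∑_{p+q=n} sh(f_q ∇^p x) (`iterNabla_apply`). For f₀ =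
(a ↦ a y) and f₀ = (s ↦ s a) the derivatives are a ↦ a ∇^q y and s ↦ σ_E^q(s ⊗ ∇^q a), and the
resulting higher Leibniz rules say that the jet prolongation is a bimodule map. The bullet actions
are the same sums applied to arbitrary jets. Their three multiplicative axioms all become the
associativity `conv_assoc`, together with `dSeq_mul` or `sigmaR_dSeq_mul`.

It remains to see that the maps land in symmetric forms. Torsion freeness gives ∧σ = -∧, so under ∧₁
the shuffles whose first two factors come from different blocks cancel in pairs; all others contain
a wedge inside one block, because ∧-compatibility and extendability let wedges pass through
braidings (`wedgeAt_sh`). Torsion freeness also turns ∧₁∇^{n+2} into the curvature of a tensor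
product of flat extendable connections, which vanishes, and the other ∧_i are horizontal
(`wedgeAt_iterNabla`). For σ_E^n extendability suffices (`wedgeAt_sigmaPow`). The hypothesis on E
then allows lifting to `Ω^n_S ⊗ E`, uniquely. The projections respect the actions because degree n
of a shuffle sum involves only degrees at most n. -/

namespace NCJet

variable {k : Type v} {A : Type u} [Field k] [Ring A] [Algebra k A]

/-! ### Left linear maps and tensor products -/

section LeftLinear

variable {M N P M' P' X Y Z : BiMod k A}

/-- A bimodule map, seen as a left linear map. -/
def Hom.toA (f : Hom M N) : M →ₗ[A] N where
  toFun := f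
  map_add' := map_add f.toLinearMap
  map_smul' := f.lact

@[simp] theorem Hom.toA_apply (f : Hom M N) (x : M) : f.toA x = f x := rfl

theorem tm_zero_left (x : X) : tm (0 : M) x = 0 := LinearMap.congr_fun (map_zero (tmL M X)) x
theorem tm_zero_right (m : M) : tm m (0 : X) = 0 := map_zero (tmL M X m)

/-- Left linear maps out of `M ⊗_A X` agree if they agree on elementary tensors. -/
theorem tens_ext {Z : Type*} [AddCommMonoid Z] [Module A Z] {f g : tens M X →ₗ[A] Z}
    (h : ∀ m x, f (tm m x) = g (tm m x)) : f = g := by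
  ext x
  induction x using tm_induction with
  | h0 => simp
  | htm m n => exact h m n
  | hadd x y hx hy => simp [hx, hy]

theorem tens_extK {Z : Type*} [AddCommMonoid Z] [Module k Z] {f g : tens M X →ₗ[k] Z}
    (h : ∀ m x, f (tm m x) = g (tm m x)) : f = g := by
  ext x
  induction x using tm_induction with
  | h0 => simp
  | htm m n => exact h m n
  | hadd x y hx hy => simp [hx, hy]

theorem wh_balanced (f : X →ₗ[A] Y) (m : M) (a : A) (x : X) :
    (tmL M Y).compl₂ (f.restrictScalars k) (m <• a) x
      = (tmL M Y).compl₂ (f.restrictScalars k) m (a • x) := by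
  change tm (m <• a) (f x) = tm m (f (a • x))
  rw [map_smul, tm_balanced]

/-- `id_M ⊗ f` for a left linear map `f`. -/
def wh (M : BiMod k A) (f : X →ₗ[A] Y) : tens M X →ₗ[A] tens M Y where
  toFun := tlift ((tmL M Y).compl₂ (f.restrictScalars k)) (wh_balanced f)
  map_add' := map_add _
  map_smul' a x := by
    dsimp only [RingHom.id_apply]
    induction x using tm_induction with
    | h0 => simp
    | htm m x =>
      rw [smul_tm, tlift_tm, tlift_tm]
      exact (smul_tm a m (f x)).symm
    | hadd x y hx hy => rw [smul_add, map_add, map_add, smul_add, hx, hy]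

@[simp] theorem wh_tm (f : X →ₗ[A] Y) (m : M) (x : X) : wh M f (tm m x) = tm m (f x) :=
  tlift_tm _ (wh_balanced f) m x

@[simp] theorem wh_id : wh M (LinearMap.id : X →ₗ[A] X) = LinearMap.id :=
  tens_ext fun m x => by simp

@[simp] theorem wh_comp (g : Y →ₗ[A] Z) (f : X →ₗ[A] Y) : wh M (g ∘ₗ f) = wh M g ∘ₗ wh M f :=
  tens_ext fun m x => by simp

@[simp] theorem wh_add (f g : X →ₗ[A] Y) : wh M (f + g) = wh M f + wh M g :=
  tens_ext fun m x => by simp [tm_add_right]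

@[simp] theorem wh_zero : wh M (0 : X →ₗ[A] Y) = 0 :=
  tens_ext fun m x => by simp [tm_zero_right]

theorem tmap_id_apply (f : Hom X Y) (z : tens M X) : (Hom.id M).tmap f z = wh M f.toA z :=
  LinearMap.congr_fun (f := ((Hom.id M).tmap f).toA) (g := wh M f.toA)
    (tens_ext fun m x => by
      rw [Hom.toA_apply, Hom.tmap_tm, wh_tm]; rfl) z

/-- `m ↦ m ⊗ x`. -/
def tmR (M : BiMod k A) (x : X) : M →ₗ[A] tens M X where
  toFun m := tm m x
  map_add' m m' := tm_add_left m m' x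
  map_smul' a m := (smul_tm a m x).symm

@[simp] theorem tmR_apply (m : M) (x : X) : tmR M x m = tm m x := rfl

theorem wh_tmR (f : X →ₗ[A] Y) (x : X) : wh M f ∘ₗ tmR M x = tmR M (f x) := by
  ext m; simp

/-- Absorbs associators into `wh`: with a fixed last factor, reassociating is the same as appending
that factor on the right, which is a left linear operation. Later computations need no explicit
associators. -/
theorem assoc_eq (z : tens M N) (x : X) : Hom.assoc M N X (tm z x) = wh M (tmR N x) z := by
  induction z using tm_induction with
  | h0 => rw [tm_zero_left, map_zero, map_zero]
  | htm m n => rw [Hom.assoc_tm, wh_tm, tmR_apply]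
  | hadd z z' h h' => rw [tm_add_left, map_add, map_add, h, h']

/-- `s : M ⊗ P → P' ⊗ M'` applied to the first two factors of `M ⊗ P ⊗ F`. -/
def tailMap (s : Hom (tens M P) (tens P' M')) (F : BiMod k A) :
    tens M (tens P F) →ₗ[A] tens P' (tens M' F) :=
  ((Hom.assoc P' M' F).comp ((s.tmap (Hom.id F)).comp (Hom.assocInv M P F))).toA

@[simp] theorem tailMap_tm (s : Hom (tens M P) (tens P' M')) (m : M) (p : P) (x : X) :
    tailMap s X (tm m (tm p x)) = wh P' (tmR M' x) (s (tm m p)) := by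
  change Hom.assoc P' M' X (s.tmap (Hom.id X) (Hom.assocInv M P X (tm m (tm p x)))) = _
  rw [Hom.assocInv_tm, Hom.tmap_tm, assoc_eq]; rfl

theorem tens_ext₃ {Z : Type*} [AddCommMonoid Z] [Module A Z] {f g : tens M (tens P X) →ₗ[A] Z}
    (h : ∀ m p x, f (tm m (tm p x)) = g (tm m (tm p x))) : f = g :=
  tens_ext fun m z => by
    induction z using tm_induction with
    | h0 => simp [tm_zero_right]
    | htm p x => exact h m p x
    | hadd z z' h h' => rw [tm_add_right, map_add, map_add, h, h']

/-- The interchange law: `s` acts on the first two factors and `f` on the tail. Left linearity of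
`f` is enough, since the tail stands to the right of the tensor signs. -/
theorem tailMap_natural (s : Hom (tens M P) (tens P' M')) (f : X →ₗ[A] Y) :
    tailMap s Y ∘ₗ wh M (wh P f) = wh P' (wh M' f) ∘ₗ tailMap s X :=
  tens_ext₃ fun m p x => by
    simp only [LinearMap.comp_apply, wh_tm, tailMap_tm, ← wh_tmR, wh_comp]

theorem tailMap_natural_apply (s : Hom (tens M P) (tens P' M')) (f : X →ₗ[A] Y)
    (z : tens M (tens P X)) :
    tailMap s Y (wh M (wh P f) z) = wh P' (wh M' f) (tailMap s X z) :=
  LinearMap.congr_fun (tailMap_natural s f) z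

theorem tailMap_wh_tmR (s : Hom (tens M P) (tens P' M')) (x : X) (z : tens M P) :
    tailMap s X (wh M (tmR P x) z) = wh P' (tmR M' x) (s z) :=
  LinearMap.congr_fun (f := tailMap s X ∘ₗ wh M (tmR P x)) (g := wh P' (tmR M' x) ∘ₗ s.toA)
    (tens_ext fun m p => by simp) z

/-- `w : M ⊗ P → Q` applied to the first two factors of `M ⊗ P ⊗ F`. -/
def tailMul (w : Hom (tens M P) Z) (F : BiMod k A) : tens M (tens P F) →ₗ[A] tens Z F :=
  ((w.tmap (Hom.id F)).comp (Hom.assocInv M P F)).toA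

@[simp] theorem tailMul_tm (w : Hom (tens M P) Z) (m : M) (p : P) (x : X) :
    tailMul w X (tm m (tm p x)) = tm (w (tm m p)) x := by
  change w.tmap (Hom.id X) (Hom.assocInv M P X (tm m (tm p x))) = _
  rw [Hom.assocInv_tm, Hom.tmap_tm]; rfl

theorem tailMul_natural (w : Hom (tens M P) Z) (f : X →ₗ[A] Y) :
    tailMul w Y ∘ₗ wh M (wh P f) = wh Z f ∘ₗ tailMul w X :=
  tens_ext₃ fun m p x => by simp

theorem tailMul_wh_tmR (w : Hom (tens M P) Z) (x : X) (z : tens M P) :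
    tailMul w X (wh M (tmR P x) z) = tm (w z) x :=
  LinearMap.congr_fun (f := tailMul w X ∘ₗ wh M (tmR P x)) (g := tmR Z x ∘ₗ w.toA)
    (tens_ext fun m p => by simp) z

/-- `a ↦ a x`. -/
def smulR (x : X) : BiMod.self k A →ₗ[A] X := LinearMap.toSpanSingleton A X x

theorem smulR_toSelf (x : X) (a : A) : smulR x (toSelf k a) = a • x := rfl

theorem comp_smulR (f : X →ₗ[A] Y) (x : X) : f ∘ₗ smulR x = smulR (f x) := by
  ext; simp [smulR]

theorem smulR_add (x y : X) : smulR (x + y) = smulR x + smulR y := by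
  ext; simp [smulR]

theorem toSelf_surj (u : BiMod.self k A) : ∃ a : A, u = toSelf k a := ⟨u, rfl⟩

theorem lunit_eq (u : BiMod.self k A) (x : X) : Hom.lunit X (tm u x) = smulR x u :=
  Hom.lunit_tm (k := k) u x

end LeftLinear

/-! ### Tensor powers, front moves and shuffles -/

section Shuffles

variable {C : Calculus k A} {X Y Z : BiMod k A}

/-- `id^n ⊗ f` for a left linear map `f`. -/
def preL (C : Calculus k A) {X Y : BiMod k A} (f : X →ₗ[A] Y) : (n : ℕ) → (pre C X n →ₗ[A] pre C Y n)
  | 0 => f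
  | n + 1 => wh C.Om1 (preL C f n)

@[simp] theorem preL_zero_index (f : X →ₗ[A] Y) : preL C f 0 = f := rfl
@[simp] theorem preL_succ (f : X →ₗ[A] Y) (n : ℕ) : preL C f (n + 1) = wh C.Om1 (preL C f n) := rfl

theorem preL_comp (g : Y →ₗ[A] Z) (f : X →ₗ[A] Y) (n : ℕ) :
    preL C (g ∘ₗ f) n = preL C g n ∘ₗ preL C f n := by
  induction n with
  | zero => rfl
  | succ n ih => simp [ih]

theorem preL_id (n : ℕ) : preL C (LinearMap.id : X →ₗ[A] X) n = LinearMap.id := by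
  induction n with
  | zero => rfl
  | succ n ih => simp [ih]

theorem preL_add (f g : X →ₗ[A] Y) (n : ℕ) : preL C (f + g) n = preL C f n + preL C g n := by
  induction n with
  | zero => rfl
  | succ n ih => simp [ih]

theorem preL_zero (n : ℕ) : preL C (0 : X →ₗ[A] Y) n = 0 := by
  induction n with
  | zero => rfl
  | succ n ih => simp [ih]

theorem preL_sum {ι : Type*} (s : Finset ι) (f : ι → (X →ₗ[A] Y)) (n : ℕ) :
    preL C (∑ i ∈ s, f i) n = ∑ i ∈ s, preL C (f i) n :=
  map_sum (AddMonoidHom.mk' (fun f : X →ₗ[A] Y => preL C f n) fun f g => preL_add f g n) f s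

/-- `attach` in terms of left linear maps. -/
theorem attach_eq (n : ℕ) (u : TP C n) (x : X) : attach C X n (tm u x) = preL C (smulR x) n u := by
  change preMap C (Hom.lunit X) n (preAssoc C (BiMod.self k A) X n (tm u x)) = _
  induction n with
  | zero => exact lunit_eq u x
  | succ n ih =>
    induction u using tm_induction with
    | h0 => rw [tm_zero_left, map_zero, map_zero, map_zero]
    | htm m u =>
      change (Hom.id C.Om1).tmap (preMap C (Hom.lunit X) n)
        ((Hom.id C.Om1).tmap (preAssoc C (BiMod.self k A) X n) (Hom.assoc _ _ _ (tm (tm m u) x))) = _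
      rw [Hom.assoc_tm, Hom.tmap_tm, Hom.tmap_tm, preL_succ, wh_tm]
      exact congrArg (tm m) (ih u)
    | hadd u u' h h' => rw [tm_add_left, map_add, map_add, map_add, h, h']

variable (D : BimodConn C C.Om1)

/-- Moves the first factor of the second block in front of the first block of `i` factors. -/
def mv (X : BiMod k A) : (i : ℕ) → (pre C (tens C.Om1 X) i →ₗ[A] tens C.Om1 (pre C X i))
  | 0 => LinearMap.id
  | i + 1 => tailMap D.sigma (pre C X i) ∘ₗ wh C.Om1 (mv X i)

@[simp] theorem mv_zero : mv D X 0 = LinearMap.id := rfl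
@[simp] theorem mv_succ (i : ℕ) :
    mv D X (i + 1) = tailMap D.sigma (pre C X i) ∘ₗ wh C.Om1 (mv D X i) := rfl

theorem mv_natural (f : X →ₗ[A] Y) (i : ℕ) :
    mv D Y i ∘ₗ preL C (wh C.Om1 f) i = wh C.Om1 (preL C f i) ∘ₗ mv D X i := by
  induction i with
  | zero => rfl
  | succ i ih =>
    rw [mv_succ, mv_succ, preL_succ, preL_succ, LinearMap.comp_assoc, ← wh_comp, ih, wh_comp,
      ← LinearMap.comp_assoc, tailMap_natural, LinearMap.comp_assoc]

/-- The extension of a family of maps by keeping the first factor of the first block. -/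
def consL {Y Z : BiMod k A} (f : ∀ i, (pre C Y i →ₗ[A] Z)) :
    ∀ i, (pre C Y i →ₗ[A] tens C.Om1 Z)
  | 0 => 0
  | i + 1 => wh C.Om1 (f i)

/-- The extension of a family of maps by moving the first factor of the second block to the
front. -/
def consR {X Z : BiMod k A} (i : ℕ) (f : ∀ j, (pre C (pre C X j) i →ₗ[A] Z)) :
    ∀ j, (pre C (pre C X j) i →ₗ[A] tens C.Om1 Z)
  | 0 => 0
  | j + 1 => wh C.Om1 (f j) ∘ₗ mv D (pre C X j) i

/-- The braided sum of all shuffles of a block of `i` and a block of `j` factors, as a map to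
`(Ω¹)^{⊗ n} ⊗ X`; it is zero unless `i + j = n`. -/
def sh (X : BiMod k A) : (n i j : ℕ) → (pre C (pre C X j) i →ₗ[A] pre C X n)
  | 0, 0, 0 => LinearMap.id
  | 0, 0, _ + 1 => 0
  | 0, _ + 1, _ => 0
  | n + 1, i, j => consL (fun i => sh X n i j) i + consR D i (fun j => sh X n i j) j

theorem sh_zero : sh D X 0 0 0 = LinearMap.id := rfl
theorem sh_succ (n i j : ℕ) : sh D X (n + 1) i j
    = consL (fun i => sh D X n i j) i + consR D i (fun j => sh D X n i j) j := by
  rw [sh]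

/-- The total degree `n` is kept as an independent index, with value zero off `i + j = n`, so that
no transport along equations of degrees is needed. -/
theorem sh_eq_zero {n i j : ℕ} (h : i + j ≠ n) : sh D X n i j = 0 := by
  induction n generalizing i j with
  | zero => rcases i with _ | i <;> rcases j with _ | j <;> first | exact absurd rfl h | rfl
  | succ n ih =>
    rw [sh_succ]
    have h1 : consL (fun i => sh D X n i j) i = 0 := by
      rcases i with _ | i
      · rfl
      · change wh C.Om1 (sh D X n i j) = 0
        rw [ih (by omega), wh_zero]
    have h2 : consR D i (fun j => sh D X n i j) j = 0 := by
      rcases j with _ | j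
      · rfl
      · change wh C.Om1 (sh D X n i j) ∘ₗ _ = 0
        rw [ih (by omega), wh_zero, LinearMap.zero_comp]
    rw [h1, h2, add_zero]

theorem sh_zero_left (n : ℕ) : sh D X n 0 n = LinearMap.id := by
  induction n with
  | zero => rfl
  | succ n ih =>
    rw [sh_succ]
    change 0 + wh C.Om1 (sh D X n 0 n) ∘ₗ LinearMap.id = _
    rw [ih, wh_id, zero_add]; rfl

theorem sh_zero_right (n : ℕ) : sh D X n n 0 = LinearMap.id := by
  induction n with
  | zero => rfl
  | succ n ih =>
    rw [sh_succ]
    change wh C.Om1 (sh D X n n 0) + 0 = _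
    rw [ih, wh_id, add_zero]

theorem sh_natural (f : X →ₗ[A] Y) (n i j : ℕ) :
    sh D Y n i j ∘ₗ preL C (preL C f j) i = preL C f n ∘ₗ sh D X n i j := by
  induction n generalizing i j with
  | zero =>
    rcases i with _ | i <;> rcases j with _ | j <;> first | rfl | simp [sh]
  | succ n ih =>
    rw [sh_succ, sh_succ, LinearMap.add_comp, LinearMap.comp_add]
    congr 1
    · rcases i with _ | i
      · simp [consL]
      · simp only [consL, preL_succ, ← wh_comp, ih]
    · rcases j with _ | j
      · simp [consR]
      · simp only [consR, preL_succ]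
        rw [LinearMap.comp_assoc, mv_natural, ← LinearMap.comp_assoc, ← wh_comp, ih, wh_comp,
          LinearMap.comp_assoc]

/-! ### Consequences of the braid relation -/

/-- The braid relation for `σ_E` and `σ`, with an arbitrary tail. -/
def MixedBraid {E : BiMod k A} (s : Hom (tens E C.Om1) (tens C.Om1 E)) : Prop :=
  ∀ F : BiMod k A,
    tailMap D.sigma (tens E F) ∘ₗ wh C.Om1 (tailMap s F) ∘ₗ tailMap s (tens C.Om1 F)
      = wh C.Om1 (tailMap s F) ∘ₗ tailMap s (tens C.Om1 F) ∘ₗ wh E (tailMap D.sigma F)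

variable {D}

/-- Two factors may be braided with each other before or after both have moved past the block: one
use of the braid relation for each factor of the block. -/
theorem mv_mv (hB : MixedBraid D D.sigma) (i : ℕ) :
    tailMap D.sigma (pre C X i) ∘ₗ wh C.Om1 (mv D X i) ∘ₗ mv D (tens C.Om1 X) i
      = wh C.Om1 (mv D X i) ∘ₗ mv D (tens C.Om1 X) i ∘ₗ preL C (tailMap D.sigma X) i := by
  induction i with
  | zero => ext x; simp
  | succ i ih =>
    ext x
    have ih' := fun y => LinearMap.congr_fun (congrArg (wh C.Om1) ih) y
    have hB' := fun y => LinearMap.congr_fun (hB (pre C X i)) y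
    simp only [wh_comp, LinearMap.comp_apply] at ih' hB'
    simp only [mv_succ, preL_succ, wh_comp, LinearMap.comp_apply]
    rw [← tailMap_natural_apply, hB', ih', tailMap_natural_apply]

/-- A factor that passes an already shuffled block may instead pass the two blocks one after the
other before they are shuffled. The case in which the shuffle itself moves a factor of the second
block is `mv_mv`. -/
theorem mv_sh (hB : MixedBraid D D.sigma) (n i j : ℕ) :
    mv D X n ∘ₗ sh D (tens C.Om1 X) n i j
      = wh C.Om1 (sh D X n i j) ∘ₗ mv D (pre C X j) i ∘ₗ preL C (mv D X j) i := by
  induction n generalizing i j with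
  | zero => rcases i with _ | i <;> rcases j with _ | j <;> first | (ext x; simp [sh]) 
  | succ n ih =>
    have ih' := fun i j y => LinearMap.congr_fun (congrArg (wh C.Om1) (ih i j)) y
    simp only [wh_comp, LinearMap.comp_apply] at ih'
    rw [sh_succ, sh_succ, LinearMap.comp_add, wh_add, LinearMap.add_comp]
    congr 1
    · rcases i with _ | i
      · simp [consL]
      · ext x
        simp only [consL, mv_succ, preL_succ, LinearMap.comp_apply, ih', tailMap_natural_apply]
    · rcases j with _ | j
      · simp [consR]
      · ext x
        have h1 := fun y => LinearMap.congr_fun (mv_mv (X := pre C X j) hB i) y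
        have h2 := fun y => LinearMap.congr_fun (mv_natural D (mv D X j) i) y
        simp only [LinearMap.comp_apply] at h1 h2
        simp only [consR, mv_succ, preL_comp, wh_comp, LinearMap.comp_apply, ih', tailMap_natural_apply]
        rw [← h1, h2]

/-- Associativity of the shuffle maps. -/
theorem sh_assoc (hB : MixedBraid D D.sigma) (n i j l m₁ m₂ : ℕ) (h₁ : j + l = m₁)
    (h₂ : i + j = m₂) :
    sh D X n i m₁ ∘ₗ preL C (sh D X m₁ j l) i = sh D X n m₂ l ∘ₗ sh D (pre C X l) m₂ i j := by
  induction n generalizing i j l m₁ m₂ with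
  | zero =>
    by_cases h : i = 0 ∧ j = 0 ∧ l = 0
    · obtain ⟨rfl, rfl, rfl⟩ := h
      subst h₁ h₂
      rfl
    · rw [sh_eq_zero D (by omega), sh_eq_zero D (i := m₂) (j := l) (by omega)]; simp
  | succ n ih =>
    -- The triple shuffles are sorted by the block that supplies the first factor: T₁, T₂, T₃ for
    -- the blocks of length `i`, `j`, `l`. Both sides equal T₁ + T₂ + T₃.
    let T₁ := consL (fun i => sh D X n (i + j) l ∘ₗ sh D (pre C X l) (i + j) i j) i
    let T₂ := consR D i (fun j => sh D X n (i + j) l ∘ₗ sh D (pre C X l) (i + j) i j) j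
    let T₃ := (consR D m₂ (fun l => sh D X n m₂ l) l) ∘ₗ sh D (pre C X l) m₂ i j
    have hl : consL (fun i => sh D X n i m₁) i ∘ₗ preL C (sh D X m₁ j l) i = T₁ := by
      rcases i with _ | i
      · exact LinearMap.zero_comp _
      · simp only [T₁, consL, preL_succ, ← wh_comp, ih i j l m₁ (i + j) h₁ rfl]
    have hr : consR D i (fun m => sh D X n i m) m₁ ∘ₗ preL C (sh D X m₁ j l) i = T₂ + T₃ := by
      rcases m₁ with _ | m₁
      · obtain ⟨rfl, rfl⟩ : j = 0 ∧ l = 0 := by omega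
        simp [T₂, T₃, consR]
      · rw [sh_succ, preL_add, LinearMap.comp_add]
        congr 1
        · rcases j with _ | j
          · simp [T₂, consR, consL, preL_zero]
          · simp only [T₂, consR, consL]
            rw [LinearMap.comp_assoc, mv_natural, ← LinearMap.comp_assoc, ← wh_comp,
              ih i j l m₁ (i + j) (by omega) rfl]
        · rcases l with _ | l
          · simp [T₃, consR, preL_zero]
          · simp only [T₃, consR]
            -- The only case that needs the braid relation: on one side the leading factor of the
            -- third block passes the two blocks separately, on the other it passes their shuffle.
            -- These agree by `mv_sh`.
            rw [preL_comp, LinearMap.comp_assoc, ← LinearMap.comp_assoc (preL C (mv D _ _) _),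
              mv_natural, LinearMap.comp_assoc, ← LinearMap.comp_assoc, ← wh_comp,
              ih i j l m₁ m₂ (by omega) h₂, LinearMap.comp_assoc (sh D _ _ _ _), mv_sh hB, wh_comp]
            rfl
    have hl' : consL (fun m => sh D X n m l) m₂ ∘ₗ sh D (pre C X l) m₂ i j = T₁ + T₂ := by
      rcases m₂ with _ | m₂
      · obtain ⟨rfl, rfl⟩ : i = 0 ∧ j = 0 := by omega
        simp [T₁, T₂, consR, consL]
      · rw [sh_succ, LinearMap.comp_add]
        congr 1
        · rcases i with _ | i
          · simp [T₁, consL]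
          · obtain rfl : i + j = m₂ := by omega
            simp only [T₁, consL, wh_comp]
        · rcases j with _ | j
          · simp [T₂, consR]
          · obtain rfl : i + j = m₂ := by omega
            simp only [T₂, consR, consL, wh_comp, LinearMap.comp_assoc]
    rw [sh_succ, sh_succ, LinearMap.add_comp, LinearMap.add_comp, hl, hr, hl', add_assoc]

end Shuffles

/-! ### Horizontal maps -/

section Horizontal

variable {C : Calculus k A} {M N X Y Z : BiMod k A}

theorem tensorConn_tmR (B : BimodConn C M) (G : LeftConn C X) (m : M) (x : X) :
    (tensorConn B G).nabla (tm m x)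
      = wh C.Om1 (tmR M x) (B.nabla m) + tailMap B.sigma X (tm m (G.nabla x)) := by
  rw [tensorConn_tm, assoc_eq]; rfl

/-- Exact forms suffice in front of a tail, since a db ⊗ x = d(ab) ⊗ x - da ⊗ b x. No compatibility
of `p` with the actions of A is required. -/
theorem om1_tens_induction {p : tens C.Om1 X → Prop} (hd : ∀ a x, p (tm (C.d0 a) x))
    (hadd : ∀ x y, p x → p y → p (x + y)) (z : tens C.Om1 X) : p z := by
  have h0 : p 0 := by simpa [tm_zero_right] using hd 0 0
  have key : ∀ (w : C.Om1) (x : X), p (tm w x) := by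
    intro w
    have hw : w ∈ Submodule.span k {w : C.Om1 | ∃ a b : A, w = a • C.d0 b} := by
      rw [C.span_d0]; trivial
    induction hw using Submodule.span_induction with
    | mem w hw =>
      obtain ⟨a, b, rfl⟩ := hw
      intro x
      have e : tm (a • C.d0 b) x = tm (C.d0 (a * b)) x + tm (C.d0 a) (-(b • x)) := by
        have : tm (C.d0 a) (-(b • x)) = -tm (C.d0 a) (b • x) := map_neg (tmL C.Om1 X (C.d0 a)) _
        rw [C.d0_mul, tm_add_left, this, ← tm_balanced, add_neg_cancel_right]
      rw [e]
      exact hadd _ _ (hd _ _) (hd _ _)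
    | zero => intro x; rwa [tm_zero_left]
    | add w w' _ _ h h' => intro x; rw [tm_add_left]; exact hadd _ _ (h x) (h' x)
    | smul c w _ h => intro x; rw [tm_smul_left, ← tm_smul_right]; exact h _
  induction z using tm_induction with
  | h0 => exact h0
  | htm w x => exact key w x
  | hadd x y hx hy => exact hadd x y hx hy

/-- A left linear map that commutes with the connections. -/
def IsHorizontal (G : LeftConn C X) (H : LeftConn C Y) (f : X →ₗ[A] Y) : Prop :=
  ∀ x, H.nabla (f x) = wh C.Om1 f (G.nabla x)

/-- `g` is the covariant derivative of the left linear map `f`. -/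
def HasDer (G : LeftConn C X) (H : LeftConn C Y) (f : X →ₗ[A] Y) (g : X →ₗ[A] tens C.Om1 Y) : Prop :=
  ∀ x, H.nabla (f x) = wh C.Om1 f (G.nabla x) + g x

/-- The derivative produced by `f` carries a new form, which has to be braided past M to reach the
front. -/
theorem HasDer.wh {G : LeftConn C X} {H : LeftConn C Y} {f : X →ₗ[A] Y}
    {g : X →ₗ[A] tens C.Om1 Y} (h : HasDer G H f g) (B : BimodConn C M) :
    HasDer (tensorConn B G) (tensorConn B H) (wh M f) (tailMap B.sigma Y ∘ₗ NCJet.wh M g) := by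
  intro z
  induction z using tm_induction with
  | h0 => simp
  | htm m x =>
    rw [wh_tm, tensorConn_tmR, tensorConn_tmR, h, tm_add_right, map_add, map_add,
      ← tailMap_natural_apply, ← wh_tmR]
    simp [add_assoc]
  | hadd z z' h h' => simp only [map_add, h, h']; abel

theorem isHorizontal_iff {G : LeftConn C X} {H : LeftConn C Y} {f : X →ₗ[A] Y} :
    IsHorizontal G H f ↔ HasDer G H f 0 := by
  simp [IsHorizontal, HasDer]

theorem IsHorizontal.wh {G : LeftConn C X} {H : LeftConn C Y} {f : X →ₗ[A] Y}
    (h : IsHorizontal G H f) (B : BimodConn C M) :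
    IsHorizontal (tensorConn B G) (tensorConn B H) (wh M f) := by
  have := (isHorizontal_iff.1 h).wh B
  rw [wh_zero, LinearMap.comp_zero] at this
  exact isHorizontal_iff.2 this

theorem IsHorizontal.id (G : LeftConn C X) : IsHorizontal G G LinearMap.id := fun x => by simp

theorem IsHorizontal.zero (G : LeftConn C X) (H : LeftConn C Y) : IsHorizontal G H 0 :=
  fun x => by simp

theorem IsHorizontal.add {G : LeftConn C X} {H : LeftConn C Y} {f g : X →ₗ[A] Y}
    (hf : IsHorizontal G H f) (hg : IsHorizontal G H g) : IsHorizontal G H (f + g) :=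
  fun x => by rw [LinearMap.add_apply, map_add, hf, hg, wh_add, LinearMap.add_apply]

theorem IsHorizontal.comp {G : LeftConn C X} {H : LeftConn C Y} {K : LeftConn C Z}
    {f : X →ₗ[A] Y} {g : Y →ₗ[A] Z} (hg : IsHorizontal H K g) (hf : IsHorizontal G H f) :
    IsHorizontal G K (g ∘ₗ f) :=
  fun x => by rw [LinearMap.comp_apply, hg, hf, wh_comp, LinearMap.comp_apply]

/-- The tensor product connection with an elementary tail. -/
theorem tensorConn_tm₃ (B : BimodConn C M) (B' : BimodConn C N) (G : LeftConn C X)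
    (x : X) (z : tens M N) :
    (tensorConn B (tensorConn B' G)).nabla (wh M (tmR N x) z)
      = wh C.Om1 (wh M (tmR N x)) ((tensorConn B B'.toLeftConn).nabla z)
        + tailMap B.sigma (tens N X) (wh M (tailMap B'.sigma X ∘ₗ tmR N (G.nabla x)) z) := by
  have h : HasDer B'.toLeftConn (tensorConn B' G) (tmR N x)
      (tailMap B'.sigma X ∘ₗ tmR N (G.nabla x)) := fun n => tensorConn_tmR B' G n x
  rw [(h.wh B) z]; rfl

/-- The tensor product of two bimodule connections is again one; its braiding moves the form first
past N, then past M. -/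
theorem tensorConn_ract (B : BimodConn C M) (B' : BimodConn C N) (a : A) (z : tens M N) :
    (tensorConn B B'.toLeftConn).nabla (z <• a) = (tensorConn B B'.toLeftConn).nabla z <• a
      + tailMap B.sigma N (wh M (B'.sigma.toA ∘ₗ tmR N (C.d0 a)) z) := by
  induction z using tm_induction with
  | h0 => simp
  | htm m n =>
    rw [tm_ract, tensorConn_tm, tensorConn_tm, B'.nabla_ract, tm_add_right, map_add, ← tm_ract,
      Hom.ract, ← tm_ract, Hom.ract, smul_add, ← add_assoc, wh_tm]
    rfl
  | hadd z z' h h' => simp only [map_add, smul_add, h, h']; abel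

/-! ### From Leibniz compatibility to the braid relation and horizontal shuffles. -/

variable {D : BimodConn C C.Om1} {E : BiMod k A} {G : BimodConn C E}

/-- Leibniz compatibility at x a, minus its value at x multiplied by a, leaves exactly the braid
relation on x ⊗ da. -/
theorem braid_d0 (hL : LeibnizCompatible D G) (x : tens E C.Om1) (a : A) :
    tailMap D.sigma E (wh C.Om1 (G.sigma.toA ∘ₗ tmR E (C.d0 a)) (G.sigma x))
      = wh C.Om1 G.sigma.toA
        (tailMap G.sigma C.Om1 (wh E (D.sigma.toA ∘ₗ tmR C.Om1 (C.d0 a)) x)) := by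
  have h := hL (x <• a)
  rw [G.sigma.ract, tensorConn_ract, tensorConn_ract, map_add, Hom.ract, hL x] at h
  rw [add_left_cancel h, tmap_id_apply]

/-- Leibniz compatibility implies the mixed braid relation. -/
theorem LeibnizCompatible.mixedBraid (hL : LeibnizCompatible D G) : MixedBraid D G.sigma := by
  intro F
  refine tens_ext₃ fun e v z => ?_
  -- The third form may be taken exact, with an arbitrary tail, where `braid_d0` applies.
  induction z using om1_tens_induction with
  | hd a f =>
    have h1 : wh C.Om1 (tailMap G.sigma F) (tailMap G.sigma (tens C.Om1 F) (tm e (tm v (tm (C.d0 a) f))))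
        = wh C.Om1 (wh C.Om1 (tmR E f)) (wh C.Om1 (G.sigma.toA ∘ₗ tmR E (C.d0 a)) (G.sigma (tm e v))) := by
      rw [tailMap_tm, ← LinearMap.comp_apply, ← LinearMap.comp_apply, ← wh_comp, ← wh_comp]
      congr 2
      ext e'
      simp
    have h2 : wh E (tailMap D.sigma F) (tm e (tm v (tm (C.d0 a) f)))
        = wh E (wh C.Om1 (tmR C.Om1 f)) (wh E (D.sigma.toA ∘ₗ tmR C.Om1 (C.d0 a)) (tm e v)) := by
      simp
    have h3 : tailMap G.sigma F ∘ₗ wh E (tmR C.Om1 f) = wh C.Om1 (tmR E f) ∘ₗ G.sigma.toA := by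
      ext y; simp [tailMap_wh_tmR]
    simp only [LinearMap.comp_apply]
    rw [h1, h2, tailMap_natural_apply, tailMap_natural_apply, braid_d0 hL,
      ← LinearMap.comp_apply (wh C.Om1 (wh C.Om1 (tmR E f))), ← wh_comp, ← h3, wh_comp]
    rfl
  | hadd z z' h h' => simp only [tm_add_right, map_add, h, h']

/-- The braidings are horizontal. -/
theorem LeibnizCompatible.isHorizontal (hL : LeibnizCompatible D G) (H : LeftConn C X) :
    IsHorizontal (tensorConn G (tensorConn D H)) (tensorConn D (tensorConn G H))
      (tailMap G.sigma X) := by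
  have key : ∀ (x : X) (z : tens E C.Om1),
      (tensorConn D (tensorConn G H)).nabla (tailMap G.sigma X (wh E (tmR C.Om1 x) z))
        = wh C.Om1 (tailMap G.sigma X)
          ((tensorConn G (tensorConn D H)).nabla (wh E (tmR C.Om1 x) z)) := by
    intro x z
    have h3 : tailMap G.sigma X ∘ₗ wh E (tmR C.Om1 x) = wh C.Om1 (tmR E x) ∘ₗ G.sigma.toA := by
      ext y; simp [tailMap_wh_tmR]
    rw [tailMap_wh_tmR, tensorConn_tm₃, tensorConn_tm₃, map_add, hL z, tmap_id_apply,
      ← LinearMap.comp_apply (wh C.Om1 (wh C.Om1 (tmR E x))), ← wh_comp, ← h3, wh_comp]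
    congr 1
    -- The terms that differentiate E ⊗ Ω¹ match by Leibniz compatibility. In the remaining ones the
    -- form from ∇x passes both factors, and these match by the braid relation.
    have hB := LinearMap.congr_fun (hL.mixedBraid X) (wh E (tmR C.Om1 (H.nabla x)) z)
    simp only [LinearMap.comp_apply] at hB
    rw [wh_comp, wh_comp, LinearMap.comp_apply, LinearMap.comp_apply, ← hB, tailMap_wh_tmR]
  intro z
  refine LinearMap.congr_fun (f := (tensorConn D (tensorConn G H)).nabla ∘ₗ
      (tailMap G.sigma X).restrictScalars k)
    (g := (wh C.Om1 (tailMap G.sigma X)).restrictScalars k ∘ₗ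
      (tensorConn G (tensorConn D H)).nabla) (tens_extK fun e z => ?_) z
  induction z using tm_induction with
  | h0 => simp [tm_zero_right]
  | htm v x => exact key x (tm e v)
  | hadd z z' h h' => simp only [tm_add_right, map_add, h, h']

theorem mv_isHorizontal (hL : LeibnizCompatible D D) (H : LeftConn C X) (i : ℕ) :
    IsHorizontal (higherConn D (tensorConn D H) i) (tensorConn D (higherConn D H i))
      (mv D X i) := by
  induction i with
  | zero => exact .id _
  | succ i ih => exact (hL.isHorizontal _).comp (ih.wh D)

theorem sh_isHorizontal (hL : LeibnizCompatible D D) (H : LeftConn C X) (n i j : ℕ) :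
    IsHorizontal (higherConn D (higherConn D H j) i) (higherConn D H n) (sh D X n i j) := by
  induction n generalizing i j with
  | zero =>
    rcases i with _ | i <;> rcases j with _ | j <;> first | exact .id _ | exact .zero _ _
  | succ n ih =>
    rw [sh_succ]
    refine .add ?_ ?_
    · rcases i with _ | i
      · exact .zero _ _
      · exact (ih i j).wh D
    · rcases j with _ | j
      · exact .zero _ _
      · exact ((ih i j).wh D).comp (mv_isHorizontal hL _ i)

/-! ### Taylor expansion of a left linear map along its iterated covariant derivatives -/

theorem HasDer.preL {G : LeftConn C X} {H : LeftConn C Y} {f : X →ₗ[A] Y}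
    {g : X →ₗ[A] tens C.Om1 Y} (h : HasDer G H f g) (D : BimodConn C C.Om1) (i : ℕ) :
    HasDer (higherConn D G i) (higherConn D H i) (preL C f i) (mv D Y i ∘ₗ NCJet.preL C g i) := by
  induction i with
  | zero => exact h
  | succ i ih =>
    have := ih.wh D
    rw [wh_comp, ← LinearMap.comp_assoc] at this
    exact this

open Finset in
-- The noncommutative binomial theorem: each further derivative falls either on the argument or on
-- the map.
theorem iterNabla_apply (hL : LeibnizCompatible D D) (G : LeftConn C X) (H : LeftConn C Y)
    (f : ∀ q, X →ₗ[A] pre C Y q) (hf : ∀ q, HasDer G (higherConn D H q) (f q) (f (q + 1)))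
    (n : ℕ) (x : X) :
    iterNabla D H n (f 0 x) = ∑ pq ∈ antidiagonal n,
      sh D Y n pq.1 pq.2 (preL C (f pq.2) pq.1 (iterNabla D G pq.1 x)) := by
  induction n with
  | zero => simp [iterNabla, sh_zero]
  | succ n ih =>
    -- The shuffle is horizontal, so ∇ reaches its argument. The two resulting terms are the `consL`
    -- part of the summand at (p + 1, q) and the `consR` part of the summand at (p, q + 1): Pascal's
    -- rule.
    have hstep : ∀ p q, (higherConn D H n).nabla (sh D Y n p q (preL C (f q) p (iterNabla D G p x)))
        = wh C.Om1 (sh D Y n p q) (preL C (f q) (p + 1) (iterNabla D G (p + 1) x))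
          + wh C.Om1 (sh D Y n p q) (mv D (pre C Y q) p (preL C (f (q + 1)) p (iterNabla D G p x))) := by
      intro p q
      rw [sh_isHorizontal hL H n p q, (hf q).preL D p, map_add]
      rfl
    change (higherConn D H n).nabla (iterNabla D H n (f 0 x)) = _
    rw [ih, map_sum]
    simp only [hstep, sum_add_distrib]
    have hsh : ∀ pq : ℕ × ℕ, sh D Y (n + 1) pq.1 pq.2 (preL C (f pq.2) pq.1 (iterNabla D G pq.1 x))
        = consL (fun i => sh D Y n i pq.2) pq.1 (preL C (f pq.2) pq.1 (iterNabla D G pq.1 x))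
          + consR D pq.1 (fun j => sh D Y n pq.1 j) pq.2
            (preL C (f pq.2) pq.1 (iterNabla D G pq.1 x)) := by
      intro pq
      rw [sh_succ]; rfl
    simp only [hsh, sum_add_distrib]
    congr 1
    -- The extra summand p = 0 contributes nothing, since `consL` vanishes there; likewise q = 0 for
    -- `consR` below.
    · rw [Nat.antidiagonal_succ, sum_cons, sum_map]
      simp [consL]
      rfl
    · rw [Nat.antidiagonal_succ', sum_cons, sum_map]
      simp [consR]
      rfl

theorem hasDer_smulR (H : LeftConn C Y) (y : Y) :
    HasDer (trivConn C) H (smulR y) (smulR (H.nabla y)) := by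
  intro b
  obtain ⟨a, ha⟩ := toSelf_surj b
  rw [ha]
  have e : (trivConn C).nabla (toSelf k a) = tm (C.d0 a) (toSelf k 1) := rfl
  rw [e, wh_tm, smulR_toSelf, smulR_toSelf, smulR_toSelf, one_smul, H.nabla_smul]

open Finset in
/-- The higher Leibniz rule for the left action. -/
theorem iterNabla_smul (hL : LeibnizCompatible D D) (H : LeftConn C Y) (n : ℕ) (a : A) (y : Y) :
    iterNabla D H n (a • y) = ∑ pq ∈ antidiagonal n, sh D Y n pq.1 pq.2
      (preL C (smulR (iterNabla D H pq.2 y)) pq.1 (iterNabla D (trivConn C) pq.1 (toSelf k a))) :=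
  iterNabla_apply hL (trivConn C) H (fun q => smulR (iterNabla D H q y))
    (fun _ => hasDer_smulR _ _) n (toSelf k a)

/-! ### Derivatives of the right action through the iterated braiding of E. -/

theorem sigmaPow_succ (n : ℕ) (z : tens E (TP C (n + 1))) :
    sigmaPow G (n + 1) z = wh C.Om1 (sigmaPow G n).toA (tailMap G.sigma (TP C n) z) :=
  tmap_id_apply _ _

/-- `s ↦ σ^n_E (s ⊗ u)`. -/
def sigmaR (G : BimodConn C E) (n : ℕ) (u : TP C n) : E →ₗ[A] pre C E n :=
  (sigmaPow G n).toA ∘ₗ tmR E u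

theorem sigmaR_apply (n : ℕ) (u : TP C n) (s : E) : sigmaR G n u s = sigmaPow G n (tm s u) := rfl

/-- In degree zero this is the right Leibniz rule of ∇_E, read as horizontality of E ⊗ A → E; each
further degree composes with a horizontal braiding. -/
theorem sigmaPow_isHorizontal (hL : LeibnizCompatible D G) (n : ℕ) :
    IsHorizontal (tensorConn G (higherConn D (trivConn C) n)) (higherConn D G.toLeftConn n)
      (sigmaPow G n).toA := by
  induction n with
  | zero =>
    intro z
    induction z using tm_induction with
    | h0 => simp
    | htm s b =>
      obtain ⟨a, ha⟩ := toSelf_surj b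
      rw [ha]
      have e : (higherConn D (trivConn C) 0).nabla (toSelf k a) = tm (C.d0 a) (toSelf k 1) := rfl
      have h1 : (sigmaPow G 0).toA ∘ₗ tmR E (toSelf k (1 : A)) = LinearMap.id := by
        ext s
        exact (Hom.runit_tm s 1).trans (one_smul Aᵐᵒᵖ s)
      have h2 : ∀ z : tens C.Om1 E,
          wh C.Om1 ((sigmaPow G 0).toA ∘ₗ tmR E (toSelf k a)) z = z <• a := by
        intro z
        induction z using tm_induction with
        | h0 => simp
        | htm w s =>
          rw [wh_tm, tm_ract]
          exact congrArg (tm w) (Hom.runit_tm s a)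
        | hadd z z' h h' => rw [map_add, smul_add, h, h']
      have h3 : (sigmaPow G 0).toA (tm s (toSelf k a)) = s <• a := Hom.runit_tm s a
      rw [tensorConn_tmR, e, tailMap_tm, map_add, h3, ← LinearMap.comp_apply, ← wh_comp, h2,
        ← LinearMap.comp_apply, ← wh_comp, h1, wh_id]
      exact G.nabla_ract s a
    | hadd z z' h h' => simp only [map_add, h, h']
  | succ n ih =>
    have e : (sigmaPow G (n + 1)).toA = wh C.Om1 (sigmaPow G n).toA ∘ₗ tailMap G.sigma (TP C n) :=
      LinearMap.ext (sigmaPow_succ n)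
    rw [e]
    exact (ih.wh D).comp (hL.isHorizontal _)

/-- Horizontality of σ_E^n evaluated at s ⊗ u: the part of the tensor product connection that
differentiates `u` is braided past E, giving σ_E^{n+1}(s ⊗ ∇u). -/
theorem hasDer_sigmaR (hL : LeibnizCompatible D G) (n : ℕ) (u : TP C n) :
    HasDer G.toLeftConn (higherConn D G.toLeftConn n) (sigmaR G n u)
      (sigmaR G (n + 1) ((higherConn D (trivConn C) n).nabla u)) := by
  intro s
  have h := sigmaPow_isHorizontal hL n (tm s u)
  rw [tensorConn_tmR, map_add] at h
  rw [sigmaR_apply (n + 1), sigmaPow_succ, sigmaR, wh_comp]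
  exact h

open Finset in
/-- The higher Leibniz rule for the right action. -/
theorem iterNabla_ract (hL : LeibnizCompatible D D) (hLE : LeibnizCompatible D G)
    (n : ℕ) (s : E) (a : A) :
    iterNabla D G.toLeftConn n (s <• a) = ∑ pq ∈ antidiagonal n, sh D E n pq.1 pq.2
      (preL C (sigmaR G pq.2 (iterNabla D (trivConn C) pq.2 (toSelf k a))) pq.1
        (iterNabla D G.toLeftConn pq.1 s)) := by
  have h := iterNabla_apply hL G.toLeftConn G.toLeftConn
    (fun q => sigmaR G q (iterNabla D (trivConn C) q (toSelf k a)))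
    (fun q => hasDer_sigmaR hLE q _) n s
  have e : sigmaR G 0 (iterNabla D (trivConn C) 0 (toSelf k a)) s = s <• a := Hom.runit_tm s a
  rw [← e]
  exact h

end Horizontal

/-! ### The shuffle composition of families of left linear maps -/

section Convolution

open Finset

/-- The intermediate degrees enter as variables constrained by equations, which matches the form of
`sh_assoc` and avoids rewriting inside dependent types. -/
theorem sum_antidiagonal_assoc {V : Type*} [AddCommMonoid V] (n : ℕ) {f g : ℕ → ℕ → ℕ → ℕ → V}
    (h : ∀ p q r m₁ m₂, q + r = m₁ → p + q = m₂ → f m₁ p q r = g m₂ p q r) :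
    ∑ x ∈ antidiagonal n, ∑ y ∈ antidiagonal x.2, f x.2 x.1 y.1 y.2
      = ∑ x ∈ antidiagonal n, ∑ y ∈ antidiagonal x.1, g x.1 y.1 y.2 x.2 := by
  rw [sum_sigma', sum_sigma']
  refine sum_nbij' (fun x => ⟨(x.1.1 + x.2.1, x.2.2), (x.1.1, x.2.1)⟩)
    (fun x => ⟨(x.2.1, x.2.2 + x.1.2), (x.2.2, x.1.2)⟩) ?_ ?_ ?_ ?_ ?_
  · rintro ⟨⟨a, b⟩, ⟨c, d⟩⟩ hx
    simp only [mem_sigma, HasAntidiagonal.mem_antidiagonal] at hx ⊢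
    exact ⟨by omega, trivial⟩
  · rintro ⟨⟨a, b⟩, ⟨c, d⟩⟩ hx
    simp only [mem_sigma, HasAntidiagonal.mem_antidiagonal] at hx ⊢
    exact ⟨by omega, trivial⟩
  · rintro ⟨⟨a, b⟩, ⟨c, d⟩⟩ hx
    simp only [mem_sigma, HasAntidiagonal.mem_antidiagonal] at hx
    obtain ⟨-, rfl⟩ := hx
    rfl
  · rintro ⟨⟨a, b⟩, ⟨c, d⟩⟩ hx
    simp only [mem_sigma, HasAntidiagonal.mem_antidiagonal] at hx
    obtain ⟨-, rfl⟩ := hx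
    rfl
  · rintro ⟨⟨a, b⟩, ⟨c, d⟩⟩ hx
    simp only [mem_sigma, HasAntidiagonal.mem_antidiagonal] at hx
    exact h _ _ _ _ _ hx.2 rfl

variable {C : Calculus k A} {X Y Z : BiMod k A} (D : BimodConn C C.Om1)

/-- The sequence `∑_{p + q = n} sh (f_q z_p)`. -/
def conv (z : ∀ p, pre C X p) (f : ∀ q, X →ₗ[A] pre C Y q) (n : ℕ) : pre C Y n :=
  ∑ x ∈ antidiagonal n, sh D Y n x.1 x.2 (preL C (f x.2) x.1 (z x.1))

/-- The composition of two families of left linear maps. -/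
def convL (f : ∀ q, X →ₗ[A] pre C Y q) (g : ∀ q, Y →ₗ[A] pre C Z q) (n : ℕ) : X →ₗ[A] pre C Z n :=
  ∑ x ∈ antidiagonal n, sh D Z n x.1 x.2 ∘ₗ preL C (g x.2) x.1 ∘ₗ f x.1

/-- Associativity of shuffles, after naturality has moved `g` inside the inner shuffle. All
multiplicative axioms of the bullet actions are instances of this identity. -/
theorem conv_assoc (hB : MixedBraid D D.sigma) (z : ∀ p, pre C X p) (f : ∀ q, X →ₗ[A] pre C Y q)
    (g : ∀ q, Y →ₗ[A] pre C Z q) (n : ℕ) :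
    conv D (conv D z f) g n = conv D z (convL D f g) n := by
  simp only [conv, convL, map_sum, preL_sum, LinearMap.sum_apply]
  symm
  refine sum_antidiagonal_assoc n
    (f := fun m p q r => sh D Z n p m
      (preL C (sh D Z m q r ∘ₗ preL C (g r) q ∘ₗ f q) p (z p)))
    (g := fun m p q r => sh D Z n m r (preL C (g r) m (sh D Y m p q (preL C (f q) p (z p))))) ?_
  intro p q r m₁ m₂ h₁ h₂
  have h := LinearMap.congr_fun (sh_assoc (X := Z) hB n p q r m₁ m₂ h₁ h₂)
    (preL C (preL C (g r) q) p (preL C (f q) p (z p)))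
  have h' := LinearMap.congr_fun (sh_natural D (g r) m₂ p q) (preL C (f q) p (z p))
  simp only [LinearMap.comp_apply] at h h'
  simp only [preL_comp, LinearMap.comp_apply]
  rw [h, h']

theorem conv_congr_left {z z' : ∀ p, pre C X p} (f : ∀ q, X →ₗ[A] pre C Y q) {n : ℕ}
    (h : ∀ p ≤ n, z p = z' p) : conv D z f n = conv D z' f n := by
  refine sum_congr rfl fun x hx => ?_
  rw [h _ (by rw [HasAntidiagonal.mem_antidiagonal] at hx; omega)]

theorem conv_congr_right (z : ∀ p, pre C X p) {f f' : ∀ q, X →ₗ[A] pre C Y q} {n : ℕ}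
    (h : ∀ p ≤ n, f p = f' p) : conv D z f n = conv D z f' n := by
  refine sum_congr rfl fun x hx => ?_
  rw [h _ (by rw [HasAntidiagonal.mem_antidiagonal] at hx; omega)]

theorem conv_unit_right (z : ∀ p, pre C X p) (f : ∀ q, X →ₗ[A] pre C X q)
    (h0 : f 0 = LinearMap.id) (hf : ∀ q, f (q + 1) = 0) (n : ℕ) : conv D z f n = z n := by
  rw [conv, sum_eq_single (n, 0)]
  · change sh D X n n 0 (preL C (f 0) n (z n)) = z n
    rw [sh_zero_right, h0, preL_id]; rfl
  · rintro ⟨p, q⟩ hpq hne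
    rcases q with _ | q
    · exact absurd (by rw [HasAntidiagonal.mem_antidiagonal] at hpq; ext <;> simp_all) hne
    · change sh D X n p (q + 1) (preL C (f (q + 1)) p (z p)) = 0
      rw [hf, preL_zero]; simp
  · intro h; exact absurd (by simp) h

theorem conv_unit_left (z : ∀ p, pre C X p) (f : ∀ q, X →ₗ[A] pre C Y q)
    (hz : ∀ p, z (p + 1) = 0) (n : ℕ) : conv D z f n = f n (z 0) := by
  rw [conv, sum_eq_single (0, n)]
  · change sh D Y n 0 n (preL C (f n) 0 (z 0)) = _
    rw [sh_zero_left]; rfl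
  · rintro ⟨p, q⟩ hpq hne
    rcases p with _ | p
    · exact absurd (by rw [HasAntidiagonal.mem_antidiagonal] at hpq; ext <;> simp_all) hne
    · change sh D Y n (p + 1) q (preL C (f q) (p + 1) (z (p + 1))) = 0
      rw [hz]; simp
  · intro h; exact absurd (by simp) h

/-- Maps of the form a ↦ a z are fixed by their value at 1, so composing families that start with
them is again a convolution. -/
theorem convL_smulR (z : ∀ p, pre C X p) (f : ∀ q, X →ₗ[A] pre C Y q) (n : ℕ) :
    convL D (fun q => smulR (z q)) f n = smulR (conv D z f n) := by
  ext
  simp [convL, conv, smulR]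

theorem conv_add_left (z z' : ∀ p, pre C X p) (f : ∀ q, X →ₗ[A] pre C Y q) (n : ℕ) :
    conv D (fun p => z p + z' p) f n = conv D z f n + conv D z' f n := by
  simp [conv, sum_add_distrib]

theorem conv_add_right (z : ∀ p, pre C X p) (f f' : ∀ q, X →ₗ[A] pre C Y q) (n : ℕ) :
    conv D z (fun q => f q + f' q) n = conv D z f n + conv D z f' n := by
  simp [conv, sum_add_distrib, preL_add]

end Convolution

/-! ### The braiding of `E` with a tensor power -/

section BraidPower

variable {C : Calculus k A} {X Y : BiMod k A} {D : BimodConn C C.Om1} {E : BiMod k A}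

/-- `E ⊗ (Ω¹)^{⊗ n} ⊗ X → (Ω¹)^{⊗ n} ⊗ E ⊗ X`. -/
def sigmaTail (G : BimodConn C E) (X : BiMod k A) :
    (n : ℕ) → (tens E (pre C X n) →ₗ[A] pre C (tens E X) n)
  | 0 => LinearMap.id
  | n + 1 => wh C.Om1 (sigmaTail G X n) ∘ₗ tailMap G.sigma (pre C X n)

theorem sigmaTail_natural (G : BimodConn C E) (f : X →ₗ[A] Y) (n : ℕ) :
    sigmaTail G Y n ∘ₗ wh E (preL C f n) = preL C (wh E f) n ∘ₗ sigmaTail G X n := by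
  induction n with
  | zero => rfl
  | succ n ih =>
    rw [sigmaTail, sigmaTail, preL_succ, preL_succ, LinearMap.comp_assoc, tailMap_natural,
      ← LinearMap.comp_assoc, ← wh_comp, ih, wh_comp, LinearMap.comp_assoc]

theorem sigmaPow_eq (G : BimodConn C E) (n : ℕ) :
    (sigmaPow G n).toA = preL C (Hom.runit E).toA n ∘ₗ sigmaTail G (BiMod.self k A) n := by
  induction n with
  | zero => rfl
  | succ n ih =>
    rw [sigmaTail, preL_succ, ← LinearMap.comp_assoc, ← wh_comp, ← ih]
    exact LinearMap.ext (sigmaPow_succ n)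

variable {G : BimodConn C E}

theorem sigmaTail_mv (hB : MixedBraid D G.sigma) (i : ℕ) :
    wh C.Om1 (sigmaTail G X i) ∘ₗ tailMap G.sigma (pre C X i) ∘ₗ wh E (mv D X i)
      = mv D (tens E X) i ∘ₗ preL C (tailMap G.sigma X) i ∘ₗ sigmaTail G (tens C.Om1 X) i := by
  induction i with
  | zero => ext z; simp [sigmaTail]
  | succ i ih =>
    ext z
    have ih' := fun y => LinearMap.congr_fun (congrArg (wh C.Om1) ih) y
    have hB' := fun y => LinearMap.congr_fun (hB (pre C X i)) y
    simp only [wh_comp, LinearMap.comp_apply] at ih' hB'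
    simp only [mv_succ, preL_succ, sigmaTail, wh_comp, LinearMap.comp_apply]
    rw [← hB', ← ih']
    simp only [tailMap_natural_apply]

/-- E may cross two blocks before or after they are shuffled; the mixed braid relation enters
through `sigmaTail_mv` when a factor of the second block moves to the front. -/
theorem sigmaTail_sh (hB : MixedBraid D G.sigma) (n i j : ℕ) :
    sigmaTail G X n ∘ₗ wh E (sh D X n i j)
      = sh D (tens E X) n i j ∘ₗ preL C (sigmaTail G X j) i ∘ₗ sigmaTail G (pre C X j) i := by
  induction n generalizing i j with
  | zero => rcases i with _ | i <;> rcases j with _ | j <;> (ext z; simp [sh, sigmaTail])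
  | succ n ih =>
    have ih' := fun i j y => LinearMap.congr_fun (congrArg (wh C.Om1) (ih i j)) y
    simp only [wh_comp, LinearMap.comp_apply] at ih'
    rw [sh_succ, sh_succ, wh_add, LinearMap.comp_add, LinearMap.add_comp]
    congr 1
    · rcases i with _ | i
      · simp [consL]
      · ext z
        simp only [consL, sigmaTail, preL_succ, LinearMap.comp_apply,
          tailMap_natural_apply, ih']
    · rcases j with _ | j
      · simp [consR]
      · ext z
        have h1 := fun y => LinearMap.congr_fun (sigmaTail_mv (X := pre C X j) hB i) y
        have h2 := fun y => LinearMap.congr_fun (mv_natural D (sigmaTail G X j) i) y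
        simp only [LinearMap.comp_apply] at h1 h2
        simp only [consR, sigmaTail, preL_comp, LinearMap.comp_apply, wh_comp,
          tailMap_natural_apply, ih', h1, h2]

/-- Right multiplication by a shuffle product is right multiplication by `u` followed by `w`:
`sigmaTail_sh` with the trailing copies of A absorbed. -/
theorem sigmaR_sh (hB : MixedBraid D G.sigma) (n i j : ℕ) (u : TP C i) (w : TP C j) :
    sigmaR G n (sh D (BiMod.self k A) n i j (preL C (smulR w) i u))
      = sh D E n i j ∘ₗ preL C (sigmaR G j w) i ∘ₗ sigmaR G i u := by
  ext s
  have h1 := fun y => LinearMap.congr_fun (sigmaTail_sh (X := BiMod.self k A) hB n i j) y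
  have h2 := fun y => LinearMap.congr_fun (sh_natural D (Hom.runit E).toA n i j) y
  have h3 := fun y => LinearMap.congr_fun (sigmaTail_natural G (smulR w) i) y
  -- The coefficient a at the end of `u` may act on E from the right or on `w` from the left: s a ⊗
  -- w = s ⊗ a w.
  have h4 : preL C (Hom.runit E).toA j ∘ₗ sigmaTail G (BiMod.self k A) j ∘ₗ wh E (smulR w)
      = sigmaR G j w ∘ₗ (Hom.runit E).toA := by
    rw [← LinearMap.comp_assoc, ← sigmaPow_eq]
    refine tens_ext fun s b => ?_
    obtain ⟨a, ha⟩ := toSelf_surj b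
    rw [ha, LinearMap.comp_apply, wh_tm, smulR_toSelf, ← tm_balanced, ← Hom.runit_tm]
    rfl
  have h4' := fun y => LinearMap.congr_fun (congrArg (fun f => preL C f i) h4) y
  simp only [LinearMap.comp_apply, preL_comp] at h1 h2 h3 h4'
  simp only [LinearMap.comp_apply, sigmaR, sigmaPow_eq, tmR_apply]
  rw [← wh_tm, h1, ← h2, ← wh_tm, h3, h4', sigmaR, sigmaPow_eq]

end BraidPower

/-! ### Wedge products and braidings -/

section Wedge

variable {C : Calculus k A} {M X Y Z : BiMod k A} {D : BimodConn C C.Om1}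

theorem om1_induction {p : C.Om1 → Prop} (hd : ∀ a b : A, p (a • C.d0 b))
    (h0 : p 0) (hadd : ∀ x y, p x → p y → p (x + y)) (hsmul : ∀ (c : k) x, p x → p (c • x))
    (w : C.Om1) : p w := by
  have hw : w ∈ Submodule.span k {w : C.Om1 | ∃ a b : A, w = a • C.d0 b} := by
    rw [C.span_d0]; trivial
  induction hw using Submodule.span_induction with
  | mem w hw => obtain ⟨a, b, rfl⟩ := hw; exact hd a b
  | zero => exact h0
  | add x y _ _ hx hy => exact hadd x y hx hy
  | smul c x _ hx => exact hsmul c x hx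

/-- Comparing ∧∇(x b) = d(x b) with the two right Leibniz rules gives ∧σ(x ⊗ db) = -x ∧ db, and
tensors x ⊗ db span. -/
theorem TorsionFree.wedge_sigma (hT : TorsionFree D.toLeftConn) (z : tens C.Om1 C.Om1) :
    C.wedge (D.sigma z) = -C.wedge z := by
  have key : ∀ w' w : C.Om1, C.wedge (D.sigma (tm w w')) = -C.wedge (tm w w') := by
    intro w'
    induction w' using om1_induction with
    | hd a b =>
      intro w
      rw [← tm_balanced]
      generalize w <• a = x
      have h := hT (x <• b)
      rw [D.nabla_ract, map_add, C.wedge.ract, hT, C.d1_ract, sub_eq_add_neg] at h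
      exact add_left_cancel h
    | h0 => intro w; rw [tm_zero_right]; simp
    | hadd x y hx hy => intro w; rw [tm_add_right, map_add, map_add, map_add, hx, hy, neg_add]
    | hsmul c x hx => intro w; rw [tm_smul_right, map_smul, map_smul, map_smul, hx, smul_neg]
  induction z using tm_induction with
  | h0 => simp
  | htm w w' => exact key w' w
  | hadd x y hx hy => rw [map_add, map_add, map_add, hx, hy, neg_add]

theorem TorsionFree.tailMul_sigma (hT : TorsionFree D.toLeftConn) :
    tailMul C.wedge X ∘ₗ tailMap D.sigma X = -tailMul C.wedge X :=
  tens_ext₃ fun w w' x => by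
    rw [LinearMap.comp_apply, tailMap_tm, tailMul_wh_tmR, hT.wedge_sigma, LinearMap.neg_apply,
      tailMul_tm]
    exact map_neg (tmR C.Om2 x) _

theorem tailMap_comp_wh_tmR {P P' M' : BiMod k A} (s : Hom (tens M P) (tens P' M')) (x : X) :
    tailMap s X ∘ₗ wh M (tmR P x) = wh P' (tmR M' x) ∘ₗ s.toA :=
  LinearMap.ext fun z => tailMap_wh_tmR s x z

theorem tailMul_comp_wh_tmR {P : BiMod k A} (w : Hom (tens M P) Z) (x : X) :
    tailMul w X ∘ₗ wh M (tmR P x) = tmR Z x ∘ₗ w.toA :=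
  LinearMap.ext fun z => tailMul_wh_tmR w x z

/-- The braiding of `Ω²` with `Ω¹` induced by a `∧`-compatible connection. -/
theorem tailMul_sigma_sigma (B : BimodConn C C.Om2)
    (hB : ∀ x : tens C.Om1 C.Om1, B.nabla (C.wedge x)
      = (Hom.id C.Om1).tmap C.wedge ((tensorConn D D.toLeftConn).nabla x)) (F : BiMod k A) :
    wh C.Om1 (tailMul C.wedge F) ∘ₗ tailMap D.sigma (tens C.Om1 F) ∘ₗ wh C.Om1 (tailMap D.sigma F)
      = tailMap B.sigma F ∘ₗ tailMul C.wedge (tens C.Om1 F) := by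
  -- The right Leibniz rule of ∇_{Ω²} at ∧z identifies its braiding with the one induced by σ, at
  -- first on exact forms.
  have key : ∀ (z : tens C.Om1 C.Om1) (a : A),
      wh C.Om1 C.wedge.toA (tailMap D.sigma C.Om1 (wh C.Om1 (D.sigma.toA ∘ₗ tmR C.Om1 (C.d0 a)) z))
        = B.sigma (tm (C.wedge z) (C.d0 a)) := by
    intro z a
    have h := hB (z <• a)
    rw [C.wedge.ract, B.nabla_ract, tensorConn_ract, map_add, Hom.ract, hB] at h
    rw [add_left_cancel h, tmap_id_apply]
  refine tens_ext₃ fun w w' z => ?_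
  induction z using om1_tens_induction with
  | hd a f =>
    have h1 : wh C.Om1 (tailMap D.sigma F) (tm w (tm w' (tm (C.d0 a) f)))
        = wh C.Om1 (wh C.Om1 (tmR C.Om1 f))
          (wh C.Om1 (D.sigma.toA ∘ₗ tmR C.Om1 (C.d0 a)) (tm w w')) := by
      simp
    simp only [LinearMap.comp_apply]
    rw [h1, tailMap_natural_apply, tailMul_tm, tailMap_tm, ← key, ← LinearMap.comp_apply,
      ← wh_comp, tailMul_comp_wh_tmR, wh_comp]
    rfl
  | hadd z z' h h' => simp only [tm_add_right, map_add, h, h']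

variable {E : BiMod k A} {G : BimodConn C E}

/-- The braiding of `E` with `Ω²` induced by an extendable connection. -/
theorem tailMul_sigmaE_sigmaE (s : Hom (tens E C.Om2) (tens C.Om2 E))
    (hs : ∀ (e : E) (x : tens C.Om1 C.Om1),
      s (tm e (C.wedge x)) = wedgeFirst C E (braidTwo G.sigma (tm e x))) (F : BiMod k A) :
    tailMul C.wedge (tens E F) ∘ₗ wh C.Om1 (tailMap G.sigma F) ∘ₗ tailMap G.sigma (tens C.Om1 F)
      = tailMap s F ∘ₗ wh E (tailMul C.wedge F) := by
  refine tens_ext₃ fun e w z => ?_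
  induction z using tm_induction with
  | h0 => simp [tm_zero_right]
  | htm w' f =>
    have h1 : tm e (tm w (tm w' f)) = wh E (wh C.Om1 (tmR C.Om1 f)) (tm e (tm w w')) := by simp
    have h2 : s (tm e (C.wedge (tm w w'))) = tailMul C.wedge E
        (wh C.Om1 G.sigma.toA (tailMap G.sigma C.Om1 (tm e (tm w w')))) := by
      rw [hs]
      exact congrArg (wedgeFirst C E) (tmap_id_apply _ _)
    have h3 := fun y => LinearMap.congr_fun
      (congrArg (wh C.Om1) (tailMap_comp_wh_tmR G.sigma f)) y
    have h4 := fun y => LinearMap.congr_fun (tailMul_natural C.wedge (tmR E f)) y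
    simp only [LinearMap.comp_apply, wh_comp] at h3 h4 ⊢
    rw [wh_tm, tailMul_tm, tailMap_tm s, h2, h1, tailMap_natural_apply, h3, h4]
  | hadd z z' h h' => simp only [tm_add_right, map_add, h, h']

/-! ### Wedge products in arbitrary positions. -/

theorem wedgeAt_succ (n i : ℕ) :
    (wedgeAt C X (n + 2) (i + 1)).toA = wh C.Om1 (wedgeAt C X (n + 1) i).toA :=
  LinearMap.ext fun z => tmap_id_apply (wedgeAt C X (n + 1) i) z

/-- `σ^n_E` intertwines the wedge products. -/
theorem wedgeAt_sigmaPow (hE : Extendable G) (n i : ℕ) :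
    ∃ T : tens E (wedgeCod C (BiMod.self k A) n i) →ₗ[A] wedgeCod C E n i,
      (wedgeAt C E n i).toA ∘ₗ (sigmaPow G n).toA
        = T ∘ₗ wh E (wedgeAt C (BiMod.self k A) n i).toA := by
  obtain ⟨s, hs⟩ := hE
  have e : ∀ n, (sigmaPow G (n + 1)).toA = wh C.Om1 (sigmaPow G n).toA ∘ₗ tailMap G.sigma (TP C n) :=
    fun n => LinearMap.ext (sigmaPow_succ n)
  induction n generalizing i with
  | zero => exact ⟨0, rfl⟩
  | succ n ih =>
    rcases n with _ | n
    · exact ⟨0, rfl⟩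
    · rcases i with _ | i
      · refine ⟨wh C.Om2 (sigmaPow G n).toA ∘ₗ tailMap s (TP C n), ?_⟩
        change tailMul C.wedge (pre C E n) ∘ₗ _ = _ ∘ₗ wh E (tailMul C.wedge (TP C n))
        rw [e, e, LinearMap.comp_assoc, ← tailMul_sigmaE_sigmaE s hs, ← LinearMap.comp_assoc,
          ← LinearMap.comp_assoc, wh_comp, ← LinearMap.comp_assoc, tailMul_natural]
        rfl
      · obtain ⟨T, hT⟩ := ih i
        refine ⟨wh C.Om1 T ∘ₗ tailMap G.sigma _, ?_⟩
        rw [wedgeAt_succ, e, ← LinearMap.comp_assoc, ← wh_comp, hT, wedgeAt_succ, wh_comp,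
          LinearMap.comp_assoc, ← tailMap_natural, LinearMap.comp_assoc]

/-! ### The shuffle product of symmetric forms is symmetric -/

/-- The left linear maps that factor through the wedge products inside the two blocks. -/
inductive BlockKills (C : Calculus k A) (X : BiMod k A) (i j : ℕ) :
    (Z : BiMod k A) → (pre C (pre C X j) i →ₗ[A] Z) → Prop
  | zero (Z : BiMod k A) : BlockKills C X i j Z 0
  | add (Z : BiMod k A) (f g) : BlockKills C X i j Z f → BlockKills C X i j Z g → BlockKills C X i j Z (f + g)
  | left (Z : BiMod k A) (p : ℕ) (T : wedgeCod C (pre C X j) i p →ₗ[A] Z) :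
      BlockKills C X i j Z (T ∘ₗ (wedgeAt C (pre C X j) i p).toA)
  | right (Z : BiMod k A) (q : ℕ) (T : pre C (wedgeCod C X j q) i →ₗ[A] Z) :
      BlockKills C X i j Z (T ∘ₗ preL C (wedgeAt C X j q).toA i)

theorem BlockKills.wh {i j : ℕ} {f : pre C (pre C X j) i →ₗ[A] Z} (h : BlockKills C X i j Z f) :
    BlockKills C X (i + 1) j (tens C.Om1 Z) (wh C.Om1 f) := by
  induction h with
  | zero => rw [wh_zero]; exact .zero _
  | add f g _ _ hf hg => rw [wh_add]; exact .add _ _ _ hf hg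
  | left p T =>
    rcases i with _ | i
    · have : (wedgeAt C (pre C X j) 0 p).toA = 0 := rfl
      rw [this, LinearMap.comp_zero, wh_zero]; exact .zero _
    · rw [wh_comp, ← wedgeAt_succ]
      exact .left (C := C) (X := X) (i := i + 2) (j := j) _ (p + 1) (NCJet.wh C.Om1 T)
  | right q T => rw [wh_comp]; exact .right (C := C) (X := X) (i := i + 1) (j := j) _ q (NCJet.wh C.Om1 T)

/-- A form that passes a block respects a wedge inside that block: it crosses the wedged pair by the
braiding of Ω² with Ω¹ that ∧-compatibility supplies. -/
theorem wh_wedgeAt_mv (hW : WedgeCompatible D) (Y : BiMod k A) (i p : ℕ) :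
    ∃ T : wedgeCod C (tens C.Om1 Y) i p →ₗ[A] tens C.Om1 (wedgeCod C Y i p),
      wh C.Om1 (wedgeAt C Y i p).toA ∘ₗ mv D Y i = T ∘ₗ (wedgeAt C (tens C.Om1 Y) i p).toA := by
  obtain ⟨B, hB⟩ := hW
  induction i generalizing p with
  | zero => exact ⟨0, (congrArg (· ∘ₗ mv D Y 0) wh_zero).trans (LinearMap.zero_comp _)⟩
  | succ i ih =>
    rcases i with _ | i
    · exact ⟨0, (congrArg (· ∘ₗ mv D Y 1) wh_zero).trans (LinearMap.zero_comp _)⟩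
    · rcases p with _ | p
      · refine ⟨tailMap B.sigma _ ∘ₗ wh C.Om2 (mv D Y i), ?_⟩
        change wh C.Om1 (tailMul C.wedge (pre C Y i)) ∘ₗ _
          = _ ∘ₗ tailMul C.wedge (pre C (tens C.Om1 Y) i)
        rw [LinearMap.comp_assoc, ← tailMul_natural, ← LinearMap.comp_assoc,
          ← tailMul_sigma_sigma B hB, mv_succ, mv_succ, wh_comp]
        rfl
      · obtain ⟨T, hT⟩ := ih p
        refine ⟨tailMap D.sigma _ ∘ₗ wh C.Om1 T, ?_⟩
        rw [wedgeAt_succ, wedgeAt_succ, mv_succ, ← LinearMap.comp_assoc, ← tailMap_natural,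
          LinearMap.comp_assoc, ← wh_comp, hT, wh_comp, LinearMap.comp_assoc]

/-- The mirror case: a pair that moves past a block can be wedged beforehand, because extendability
braids each factor of the block with Ω². -/
theorem tailMul_mv_mv (hE : Extendable D) (Y : BiMod k A) (i : ℕ) :
    ∃ T : pre C (tens C.Om2 Y) i →ₗ[A] tens C.Om2 (pre C Y i),
      tailMul C.wedge (pre C Y i) ∘ₗ wh C.Om1 (mv D Y i) ∘ₗ mv D (tens C.Om1 Y) i
        = T ∘ₗ preL C (tailMul C.wedge Y) i := by
  obtain ⟨s, hs⟩ := hE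
  induction i with
  | zero => exact ⟨LinearMap.id, by ext z; simp⟩
  | succ i ih =>
    obtain ⟨T, hT⟩ := ih
    refine ⟨tailMap s _ ∘ₗ wh C.Om1 T, ?_⟩
    have h1 := fun y => LinearMap.congr_fun (tailMul_sigmaE_sigmaE s hs (pre C Y i)) y
    have h2 := fun y => LinearMap.congr_fun (congrArg (wh C.Om1) hT) y
    ext z
    simp only [LinearMap.comp_apply, wh_comp] at h1 h2
    simp only [mv_succ, wh_comp, LinearMap.comp_apply, preL_succ]
    rw [← h2, ← h1, tailMap_natural_apply]

theorem BlockKills.wh_mv (hW : WedgeCompatible D) {i j : ℕ} {f : pre C (pre C X j) i →ₗ[A] Z}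
    (h : BlockKills C X i j Z f) :
    BlockKills C X i (j + 1) (tens C.Om1 Z) (NCJet.wh C.Om1 f ∘ₗ mv D (pre C X j) i) := by
  induction h with
  | zero => rw [wh_zero, LinearMap.zero_comp]; exact .zero _
  | add f g _ _ hf hg => rw [wh_add, LinearMap.add_comp]; exact .add _ _ _ hf hg
  | left p T =>
    obtain ⟨T', hT'⟩ := wh_wedgeAt_mv hW (pre C X j) i p
    rw [wh_comp, LinearMap.comp_assoc, hT', ← LinearMap.comp_assoc]
    exact .left _ p _
  | right q T =>
    rw [wh_comp, LinearMap.comp_assoc, ← mv_natural, ← LinearMap.comp_assoc]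
    rcases j with _ | j
    · have : (wedgeAt C X 0 q).toA = 0 := rfl
      rw [this, wh_zero, preL_zero, LinearMap.comp_zero]; exact .zero _
    · rw [← wedgeAt_succ]
      exact .right _ (q + 1) _

theorem BlockKills.consL {Z : BiMod k A} {i j : ℕ} (f : ∀ i, (pre C (pre C X j) i →ₗ[A] Z))
    (h : ∀ i, BlockKills C X i j Z (f i)) : BlockKills C X i j _ (consL f i) := by
  rcases i with _ | i
  · exact .zero _
  · exact (h i).wh

theorem BlockKills.consR (hW : WedgeCompatible D) {Z : BiMod k A} {i j : ℕ}
    (f : ∀ j, (pre C (pre C X j) i →ₗ[A] Z))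
    (h : ∀ j, BlockKills C X i j Z (f j)) : BlockKills C X i j _ (consR D i f j) := by
  rcases j with _ | j
  · exact .zero _
  · exact (h j).wh_mv hW

theorem wh_comp_consL {Y Z W : BiMod k A} (g : Z →ₗ[A] W) (f : ∀ i, (pre C Y i →ₗ[A] Z)) (i : ℕ) :
    wh C.Om1 g ∘ₗ consL f i = consL (fun i => g ∘ₗ f i) i := by
  rcases i with _ | i
  · exact LinearMap.comp_zero _
  · exact (wh_comp _ _).symm

theorem wh_comp_consR {Z W : BiMod k A} (g : Z →ₗ[A] W) (i : ℕ)
    (f : ∀ j, (pre C (pre C X j) i →ₗ[A] Z)) (j : ℕ) :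
    wh C.Om1 g ∘ₗ consR D i f j = consR D i (fun j => g ∘ₗ f j) j := by
  rcases j with _ | j
  · exact LinearMap.comp_zero _
  · simp only [consR, wh_comp, LinearMap.comp_assoc]

/-- Two steps of the shuffle recursion show where the first two factors come from. If both come from
one block, the wedge can be taken inside it; if they come from different blocks, the two possible
orders differ by a final σ and cancel under ∧. -/
theorem tailMul_sh (hT : TorsionFree D.toLeftConn) (hE : Extendable D) (n i j : ℕ) :
    BlockKills C X i j _ (tailMul C.wedge (pre C X n) ∘ₗ sh D X (n + 2) i j) := by
  have hLL : BlockKills C X i j _ (tailMul C.wedge (pre C X n) ∘ₗ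
      consL (fun i => consL (fun i => sh D X n i j) i) i) := by
    rcases i with _ | _ | i
    · simp only [consL, LinearMap.comp_zero]; exact .zero _
    · simp only [consL, wh_zero, LinearMap.comp_zero]; exact .zero _
    · simp only [consL]
      rw [tailMul_natural]
      exact .left _ 0 _
  have hRR : BlockKills C X i j _ (tailMul C.wedge (pre C X n) ∘ₗ
      consR D i (fun j => consR D i (fun j => sh D X n i j) j) j) := by
    rcases j with _ | _ | j
    · simp only [consR, LinearMap.comp_zero]; exact .zero _
    · simp only [consR, wh_zero, LinearMap.zero_comp, LinearMap.comp_zero]; exact .zero _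
    · simp only [consR]
      obtain ⟨T, hT⟩ := tailMul_mv_mv hE (pre C X j) i
      rw [wh_comp, LinearMap.comp_assoc, ← LinearMap.comp_assoc, tailMul_natural,
        LinearMap.comp_assoc, hT, ← LinearMap.comp_assoc]
      exact .right (j := j + 2) _ 0 _
  have hLR : tailMul C.wedge (pre C X n) ∘ₗ
        (consL (fun i => consR D i (fun j => sh D X n i j) j) i
          + consR D i (fun j => consL (fun i => sh D X n i j) i) j) = 0 := by
    rcases i with _ | i
    · rcases j with _ | j <;> simp [consL, consR]
    · rcases j with _ | j
      · simp [consL, consR]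
      · ext z
        have h1 := fun y => LinearMap.congr_fun (tailMul_natural C.wedge (sh D X n i j)) y
        have h2 := fun y => LinearMap.congr_fun (hT.tailMul_sigma (X := pre C (pre C X j) i)) y
        simp only [LinearMap.comp_apply, LinearMap.neg_apply] at h1 h2
        simp only [consL, consR, mv_succ, wh_comp, LinearMap.comp_apply, LinearMap.add_apply,
          map_add, h1, h2, map_neg, add_neg_cancel, LinearMap.zero_apply]
  have e : sh D X (n + 2) i j = consL (fun i => consL (fun i => sh D X n i j) i) i
      + (consL (fun i => consR D i (fun j => sh D X n i j) j) i
          + consR D i (fun j => consL (fun i => sh D X n i j) i) j)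
      + consR D i (fun j => consR D i (fun j => sh D X n i j) j) j := by
    rw [sh_succ]
    rcases i with _ | i <;> rcases j with _ | j <;>
      simp [consL, consR, sh_succ, LinearMap.add_comp, add_assoc]
  rw [e, LinearMap.comp_add, LinearMap.comp_add, hLR, add_zero]
  exact .add _ _ _ hLL hRR

/-- A wedge that avoids the first factor acts on a shorter shuffle, and prepending a factor keeps
the factorisation; ∧-compatibility is needed when that factor comes from the second block. -/
theorem wedgeAt_sh (hT : TorsionFree D.toLeftConn) (hW : WedgeCompatible D) (hE : Extendable D)
    (n l i j : ℕ) : BlockKills C X i j _ ((wedgeAt C X n l).toA ∘ₗ sh D X n i j) := by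
  induction n generalizing l i j with
  | zero => exact .zero _
  | succ n ih =>
    rcases n with _ | n
    · exact .zero _
    · rcases l with _ | l
      · exact tailMul_sh hT hE n i j
      · rw [wedgeAt_succ, sh_succ, LinearMap.comp_add, wh_comp_consL, wh_comp_consR]
        exact .add _ _ _ (.consL _ fun i => ih l i j) (.consR hW _ fun j => ih l i j)

theorem BlockKills.apply_eq_zero {i j : ℕ} {f : pre C (pre C X j) i →ₗ[A] Z}
    (h : BlockKills C X i j Z f) (z : pre C (pre C X j) i)
    (hl : ∀ p, wedgeAt C (pre C X j) i p z = 0)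
    (hr : ∀ q, preL C (wedgeAt C X j q).toA i z = 0) : f z = 0 := by
  induction h with
  | zero => rfl
  | add f g _ _ hf hg => rw [LinearMap.add_apply, hf, hg, add_zero]
  | left p T => rw [LinearMap.comp_apply, Hom.toA_apply, hl, map_zero]
  | right q T => rw [LinearMap.comp_apply, hr, map_zero]

theorem wedgeAt_natural (f : X →ₗ[A] Y) (n i : ℕ) : ∃ T : wedgeCod C X n i →ₗ[A] wedgeCod C Y n i,
    (wedgeAt C Y n i).toA ∘ₗ preL C f n = T ∘ₗ (wedgeAt C X n i).toA := by
  induction n generalizing i with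
  | zero => exact ⟨0, rfl⟩
  | succ n ih =>
    rcases n with _ | n
    · exact ⟨0, rfl⟩
    · rcases i with _ | i
      · exact ⟨wh C.Om2 (preL C f n), tailMul_natural _ _⟩
      · obtain ⟨T, hT⟩ := ih i
        exact ⟨wh C.Om1 T, by rw [wedgeAt_succ, wedgeAt_succ, preL_succ, ← wh_comp, hT, wh_comp]⟩

theorem wedgeAt_preL_eq_zero (f : X →ₗ[A] Y) (n i : ℕ) {z : pre C X n}
    (h : wedgeAt C X n i z = 0) : wedgeAt C Y n i (preL C f n z) = 0 := by
  obtain ⟨T, hT⟩ := wedgeAt_natural (C := C) f n i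
  have := LinearMap.congr_fun hT z
  simp only [LinearMap.comp_apply, Hom.toA_apply, h, map_zero] at this
  exact this

/-! ### Flatness and the iterated derivatives -/

/-- The derivative of the braiding of a flat extendable connection. -/
theorem extDer_sigma (hF : IsFlat G.toLeftConn) (s : Hom (tens E C.Om2) (tens C.Om2 E))
    (hs : ∀ (e : E) (x : tens C.Om1 C.Om1),
      s (tm e (C.wedge x)) = wedgeFirst C E (braidTwo G.sigma (tm e x))) (w : C.Om1) (e : E) :
    extDer G.toLeftConn (G.sigma (tm e w))
      = tailMul C.wedge E (wh C.Om1 (G.sigma.toA ∘ₗ tmR E w) (G.nabla e)) + s (tm e (C.d1 w)) := by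
  -- Right Leibniz rule of d ⊗ id - id ∧ ∇_E. Flatness at e and at e b then settles w = db; for w =
  -- a db the coefficient moves to e, and differentiating e a produces the term with d(a db) = da ∧
  -- db.
  have hr : ∀ (b : A) (z : tens C.Om1 E), extDer G.toLeftConn (z <• b)
      = extDer G.toLeftConn z <• b
        - tailMul C.wedge E (wh C.Om1 (G.sigma.toA ∘ₗ tmR E (C.d0 b)) z) := by
    intro b z
    induction z using tm_induction with
    | h0 => simp
    | htm w e =>
      rw [tm_ract, extDer_tm, extDer_tm, G.nabla_ract, tm_add_right, map_add, ← tm_ract,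
        ← tm_ract, Hom.ract, smul_sub, sub_add_eq_sub_sub]
      rfl
    | hadd z z' h h' => simp only [map_add, smul_add, h, h']; abel
  have hd : ∀ (b : A) (e : E), extDer G.toLeftConn (G.sigma (tm e (C.d0 b)))
      = tailMul C.wedge E (wh C.Om1 (G.sigma.toA ∘ₗ tmR E (C.d0 b)) (G.nabla e)) := by
    intro b e
    have h1 : extDer G.toLeftConn (G.nabla (e <• b)) = 0 := hF _
    have h2 : extDer G.toLeftConn (G.nabla e) = 0 := hF e
    rw [G.nabla_ract, map_add, hr, h2, smul_zero, zero_sub, neg_add_eq_zero] at h1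
    exact h1.symm
  induction w using om1_induction generalizing e with
  | hd a b =>
    have h1 : ∀ z : tens C.Om1 E, wh C.Om1 (G.sigma.toA ∘ₗ tmR E (C.d0 b)) (z <• a)
        = wh C.Om1 (G.sigma.toA ∘ₗ tmR E (a • C.d0 b)) z := by
      intro z
      induction z using tm_induction with
      | h0 => simp
      | htm w e =>
        rw [tm_ract, wh_tm, wh_tm, LinearMap.comp_apply, LinearMap.comp_apply, tmR_apply,
          tmR_apply, tm_balanced]
      | hadd z z' h h' => simp only [map_add, smul_add, h, h']
    have h2 : s (tm e (C.d1 (a • C.d0 b))) = tailMul C.wedge E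
        (wh C.Om1 (G.sigma.toA ∘ₗ tmR E (C.d0 b)) (G.sigma (tm e (C.d0 a)))) := by
      rw [C.d1_smul, C.d1_d0, smul_zero, add_zero, hs, wh_comp, LinearMap.comp_apply, ← tailMap_tm]
      exact congrArg (wedgeFirst C E) (tmap_id_apply _ _)
    rw [h2, ← tm_balanced, hd, G.nabla_ract, map_add, map_add, h1]
  | h0 =>
    have : tmR E (0 : C.Om1) = 0 := by ext e; simp [tm_zero_right]
    simp [tm_zero_right, this]
  | hadd x y hx hy =>
    have : tmR E (x + y) = tmR E x + tmR E y := by ext e; simp [tm_add_right]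
    rw [tm_add_right, map_add, map_add, hx, hy, this, LinearMap.comp_add, wh_add,
      LinearMap.add_apply, map_add, map_add, tm_add_right, map_add]
    abel
  | hsmul c x hx =>
    have : wh C.Om1 (G.sigma.toA ∘ₗ tmR E (c • x)) (G.nabla e)
        = c • wh C.Om1 (G.sigma.toA ∘ₗ tmR E x) (G.nabla e) := by
      generalize G.nabla e = z
      induction z using tm_induction with
      | h0 => simp
      | htm w e =>
        simp only [wh_tm, LinearMap.comp_apply, tmR_apply, tm_smul_right, Hom.toA_apply, map_smul]
      | hadd z z' h h' => simp only [map_add, smul_add, h, h']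
    have hm : ∀ z, tailMul C.wedge E (c • z) = c • tailMul C.wedge E z :=
      ((tailMul C.wedge E).restrictScalars k).map_smul c
    rw [tm_smul_right, map_smul, map_smul, hx, this, hm, map_smul C.d1, tm_smul_right,
      map_smul s.toLinearMap, smul_add]

/-- The two mixed terms, with ∇_E on one factor and ∇_X on the other, occur in `ha` and `hb` with
opposite signs. What remains is the curvature of E, and that of X braided past E, both zero. -/
theorem IsFlat.tensorConn (hF : IsFlat G.toLeftConn) (hE : Extendable G) {H : LeftConn C X}
    (hH : IsFlat H) : IsFlat (tensorConn G H) := by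
  obtain ⟨s, hs⟩ := hE
  have ha : ∀ (x : X) (z : tens C.Om1 E), extDer (NCJet.tensorConn G H) (wh C.Om1 (tmR E x) z)
      = wh C.Om2 (tmR E x) (extDer G.toLeftConn z)
        - tailMul C.wedge (tens E X) (wh C.Om1 (tailMap G.sigma X ∘ₗ tmR E (H.nabla x)) z) := by
    intro x z
    induction z using tm_induction with
    | h0 => simp
    | htm w e =>
      have h1 := LinearMap.congr_fun (tailMul_natural C.wedge (tmR E x)) (tm w (G.nabla e))
      rw [LinearMap.comp_apply, wh_tm, LinearMap.comp_apply] at h1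
      rw [wh_tm, tmR_apply, extDer_tm, extDer_tm, tensorConn_tmR, map_sub, tm_add_right, map_add,
        wh_tm, wh_tm, sub_add_eq_sub_sub]
      congr 1
      exact congrArg _ h1
    | hadd z z' h h' => simp only [map_add, h, h']; abel
  have hb : ∀ (e : E) (y : tens C.Om1 X),
      extDer (NCJet.tensorConn G H) (tailMap G.sigma X (tm e y))
        = tailMul C.wedge (tens E X) (wh C.Om1 (tailMap G.sigma X ∘ₗ tmR E y) (G.nabla e))
          + tailMap s X (tm e (extDer H y)) := by
    intro e y
    induction y using tm_induction with
    | h0 =>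
      have : tmR E (0 : tens C.Om1 X) = 0 := by ext e; simp [tm_zero_right]
      simp [tm_zero_right, this]
    | htm w x =>
      have h1 : tailMap G.sigma X ∘ₗ tmR E (tm w x)
          = wh C.Om1 (tmR E x) ∘ₗ G.sigma.toA ∘ₗ tmR E w := by
        ext e'; simp
      have h2 := LinearMap.congr_fun (tailMul_sigmaE_sigmaE s hs X) (tm e (tm w (H.nabla x)))
      have h3 := fun z => LinearMap.congr_fun (tailMul_natural C.wedge (tmR E x)) z
      simp only [LinearMap.comp_apply, tailMap_tm, wh_tm] at h2 h3
      have h4 : tm e (extDer H (tm w x))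
          = tm e (tm (C.d1 w) x) - tm e (tailMul C.wedge X (tm w (H.nabla x))) := by
        rw [extDer_tm]
        exact map_sub (tmL E (tens C.Om2 X) e) _ _
      rw [tailMap_tm, ha, extDer_sigma hF s hs, h4, h1]
      simp only [wh_comp, LinearMap.comp_apply, map_add, map_sub, h2, h3, tailMap_tm]
      abel
    | hadd z z' h h' =>
      have : tmR E (z + z') = tmR E z + tmR E z' := by ext e; simp [tm_add_right]
      simp only [tm_add_right, map_add, h, h', this, LinearMap.comp_add, wh_add, LinearMap.add_apply]
      abel
  intro z
  induction z using tm_induction with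
  | h0 => exact map_zero _
  | htm e x =>
    change extDer _ ((NCJet.tensorConn G H).nabla (tm e x)) = 0
    have h1 : extDer G.toLeftConn (G.nabla e) = 0 := hF e
    have h2 : extDer H (H.nabla x) = 0 := hH x
    rw [tensorConn_tmR, map_add, ha, hb, h1, h2, tm_zero_right]
    simp
  | hadd z z' h h' => rw [map_add, h, h', add_zero]

theorem IsFlat.higherConn (hF : IsFlat D.toLeftConn) (hE : Extendable D) {H : LeftConn C X}
    (hH : IsFlat H) (n : ℕ) : IsFlat (higherConn D H n) := by
  induction n with
  | zero => exact hH
  | succ n ih => exact hF.tensorConn hE ih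

theorem d0_one : C.d0 1 = 0 := by
  have h := C.d0_mul 1 1
  rw [mul_one, one_smul, MulOpposite.op_one, one_smul] at h
  simpa using h

theorem isFlat_trivConn : IsFlat (trivConn C) := by
  intro b
  obtain ⟨a, ha⟩ := toSelf_surj b
  rw [ha]
  have h1 : (trivConn C).nabla (toSelf k 1) = 0 := by
    change tm (C.d0 1) (toSelf k 1) = 0
    rw [d0_one, tm_zero_left]
  change extDer (trivConn C) (tm (C.d0 a) (toSelf k 1)) = 0
  rw [extDer_tm, h1, C.d1_d0, tm_zero_left, tm_zero_right, map_zero, sub_zero]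

/-- By torsion freeness ∧∇ = d on the first factor and ∧σ = -∧ in front of ∇_X. Wedging two
successive derivatives therefore gives the curvature. -/
theorem TorsionFree.tailMul_nabla (hT : TorsionFree D.toLeftConn) (H : LeftConn C X)
    (z : tens C.Om1 X) : tailMul C.wedge X ((NCJet.tensorConn D H).nabla z) = extDer H z := by
  induction z using tm_induction with
  | h0 => simp
  | htm w x =>
    have h := LinearMap.congr_fun (hT.tailMul_sigma (X := X)) (tm w (H.nabla x))
    rw [LinearMap.comp_apply] at h
    rw [tensorConn_tmR, map_add, tailMul_wh_tmR, hT, h, extDer_tm, sub_eq_add_neg]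
    rfl
  | hadd z z' h h' => simp only [map_add, h, h']

theorem tailMul_isHorizontal (B : BimodConn C C.Om2)
    (hB : ∀ x : tens C.Om1 C.Om1, B.nabla (C.wedge x)
      = (Hom.id C.Om1).tmap C.wedge ((NCJet.tensorConn D D.toLeftConn).nabla x))
    (H : LeftConn C X) :
    IsHorizontal (tensorConn D (tensorConn D H)) (tensorConn B H) (tailMul C.wedge X) := by
  have key : ∀ (x : X) (z : tens C.Om1 C.Om1),
      (tensorConn B H).nabla (tailMul C.wedge X (wh C.Om1 (tmR C.Om1 x) z))
        = wh C.Om1 (tailMul C.wedge X)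
          ((tensorConn D (tensorConn D H)).nabla (wh C.Om1 (tmR C.Om1 x) z)) := by
    intro x z
    have h1 := LinearMap.congr_fun (tailMul_sigma_sigma B hB X) (wh C.Om1 (tmR C.Om1 (H.nabla x)) z)
    have h2 := fun y => LinearMap.congr_fun
      (congrArg (wh C.Om1) (tailMul_comp_wh_tmR C.wedge x)) y
    simp only [LinearMap.comp_apply, wh_comp, tailMul_wh_tmR] at h1 h2
    rw [tailMul_wh_tmR, tensorConn_tmR, hB, tensorConn_tm₃, map_add, h2, tmap_id_apply,
      wh_comp, LinearMap.comp_apply, h1]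
  intro z
  refine LinearMap.congr_fun (f := (tensorConn B H).nabla ∘ₗ
      (tailMul C.wedge X).restrictScalars k)
    (g := (wh C.Om1 (tailMul C.wedge X)).restrictScalars k ∘ₗ
      (tensorConn D (tensorConn D H)).nabla) (tens_extK fun e z => ?_) z
  induction z using tm_induction with
  | h0 => simp [tm_zero_right]
  | htm v x => exact key x (tm e v)
  | hadd z z' h h' => simp only [tm_add_right, map_add, h, h']

/-- Only the existence of some connection on the target is used: it makes vanishing under ∧_i
persist under ∇. -/
theorem wedgeAt_isHorizontal (hW : WedgeCompatible D) (H : LeftConn C X) (n i : ℕ) :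
    ∃ K : LeftConn C (wedgeCod C X n i), IsHorizontal (higherConn D H n) K (wedgeAt C X n i).toA := by
  have h0 : ∃ K : LeftConn C (BiMod.zero k A), ∀ {Y : BiMod k A} (G : LeftConn C Y),
      IsHorizontal G K (Hom.zero Y (BiMod.zero k A)).toA := by
    refine ⟨⟨0, fun a e => ?_⟩, fun G x => ?_⟩
    · have : e = 0 := Subsingleton.elim (α := PUnit) e 0
      rw [this, tm_zero_right]; simp
    · exact (LinearMap.congr_fun wh_zero _).symm
  obtain ⟨B, hB⟩ := hW
  induction n generalizing i with
  | zero => exact ⟨h0.choose, h0.choose_spec _⟩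
  | succ n ih =>
    rcases n with _ | n
    · exact ⟨h0.choose, h0.choose_spec _⟩
    · rcases i with _ | i
      · refine ⟨tensorConn B (higherConn D H n), ?_⟩
        exact tailMul_isHorizontal B hB _
      · obtain ⟨K, hK⟩ := ih i
        refine ⟨tensorConn D K, ?_⟩
        rw [wedgeAt_succ]
        exact hK.wh D

theorem wedgeAt_iterNabla (hT : TorsionFree D.toLeftConn) (hF : IsFlat D.toLeftConn)
    (hW : WedgeCompatible D) (hE : Extendable D) {H : LeftConn C X} (hH : IsFlat H)
    (n i : ℕ) (x : X) : wedgeAt C X n i (iterNabla D H n x) = 0 := by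
  induction n generalizing i with
  | zero => rfl
  | succ n ih =>
    rcases n with _ | n
    · rfl
    · rcases i with _ | i
      -- ∧₁ of the last two derivatives is the curvature of `higherConn D H n`. The other wedges
      -- avoid the newest form and follow from the previous degree by horizontality.
      · exact (hT.tailMul_nabla (higherConn D H n) _).trans (hF.higherConn hE hH n _)
      · obtain ⟨K, hK⟩ := wedgeAt_isHorizontal hW H (n + 1) i
        have h := hK (iterNabla D H (n + 1) x)
        rw [Hom.toA_apply, ih, map_zero, ← wedgeAt_succ] at h
        exact h.symm

end Wedge

/-! ### Braided binomials are shuffle maps -/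

section Binomial

variable {C : Calculus k A} {X : BiMod k A} (D : BimodConn C C.Om1)

/-- The canonical map `(Ω¹)^{⊗ i} ⊗ (Ω¹)^{⊗ j} ⊗ X → (Ω¹)^{⊗ n} ⊗ X`; it is zero unless
`i + j = n`. -/
def glue (C : Calculus k A) (X : BiMod k A) : (n i j : ℕ) → (pre C (pre C X j) i →ₗ[A] pre C X n)
  | 0, 0, 0 => LinearMap.id
  | 0, 0, _ + 1 => 0
  | 0, _ + 1, _ => 0
  | _ + 1, 0, 0 => 0
  | n + 1, 0, j + 1 => wh C.Om1 (glue C X n 0 j)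
  | n + 1, i + 1, j => wh C.Om1 (glue C X n i j)

theorem glue_zero_left (n : ℕ) : glue C X n 0 n = LinearMap.id := by
  induction n with
  | zero => rfl
  | succ n ih => rw [glue, ih, wh_id]

theorem preAdd_eq (j i : ℕ) : (preAdd C X j i).toA = glue C X (j + i) i j := by
  induction i with
  | zero => exact (glue_zero_left j).symm
  | succ i ih =>
    change _ = wh C.Om1 (glue C X (j + i) i j)
    rw [← ih]
    exact LinearMap.ext fun z => tmap_id_apply _ z

theorem sigmaAt_succ (n i : ℕ) :
    (sigmaAt D X (n + 1) (i + 1)).toA = wh C.Om1 (sigmaAt D X n i).toA := by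
  rcases n with _ | n
  · exact wh_id.symm
  · exact LinearMap.ext fun z => tmap_id_apply (sigmaAt D X (n + 1) i) z

theorem sigmaChain_succ (n m : ℕ) : (sigmaChain D X (n + 1) (m + 1)).toA
    = (sigmaAt D X (n + 1) 0).toA ∘ₗ wh C.Om1 (sigmaChain D X n m).toA := by
  induction m with
  | zero =>
    rw [show (sigmaChain D X n 0).toA = LinearMap.id from rfl, wh_id]; rfl
  | succ m ih =>
    change (sigmaChain D X (n + 1) (m + 1)).toA ∘ₗ (sigmaAt D X (n + 1) (m + 1)).toA
      = _ ∘ₗ wh C.Om1 ((sigmaChain D X n m).toA ∘ₗ (sigmaAt D X n m).toA)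
    rw [ih, sigmaAt_succ, wh_comp, LinearMap.comp_assoc]

/-- The chain σ₁ ⋯ σ_i carries factor i + 1, the first of the second block, to the front. -/
theorem sigmaChain_glue (n i j : ℕ) (h : i + j = n) :
    (sigmaChain D X (n + 1) i).toA ∘ₗ glue C X (n + 1) i (j + 1)
      = wh C.Om1 (glue C X n i j) ∘ₗ mv D (pre C X j) i := by
  induction i generalizing n with
  | zero =>
    obtain rfl : j = n := by omega
    rw [glue_zero_left, glue_zero_left, wh_id]; rfl
  | succ i ih =>
    obtain ⟨n, rfl⟩ : ∃ m, n = m + 1 := ⟨i + j, by omega⟩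
    change _ ∘ₗ wh C.Om1 (glue C X (n + 1) i (j + 1)) = wh C.Om1 (wh C.Om1 (glue C X n i j)) ∘ₗ _
    rw [sigmaChain_succ, LinearMap.comp_assoc, ← wh_comp, ih n (by omega), mv_succ, wh_comp,
      ← LinearMap.comp_assoc, ← LinearMap.comp_assoc, ← tailMap_natural]
    rfl

theorem binom_self (n : ℕ) : (binom D X n n).toA = LinearMap.id := by
  rcases n with _ | n
  · rfl
  · rw [binom, if_pos le_rfl]; rfl

theorem binom_zero (n : ℕ) : (binom D X n 0).toA = LinearMap.id := by
  rcases n with _ | n <;> rfl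

/-- The two recursions coincide: the summand with the chain of σ is `consR`, the other one `consL`.
The boundary values are identities because one block is empty. -/
theorem binom_glue (n i j : ℕ) (h : i + j = n) :
    (binom D X n j).toA ∘ₗ glue C X n i j = sh D X n i j := by
  induction n generalizing i j with
  | zero =>
    obtain ⟨rfl, rfl⟩ : i = 0 ∧ j = 0 := by omega
    rfl
  | succ n ih =>
    rcases j with _ | j
    · obtain rfl : i = n + 1 := by omega
      have h' := ih n 0 rfl
      rw [binom_zero, LinearMap.id_comp] at h' ⊢
      rw [glue, h', sh_zero_right, sh_zero_right, wh_id]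
    · rcases i with _ | i
      · obtain rfl : j = n := by omega
        rw [binom_self, glue_zero_left, sh_zero_left]; rfl
      · obtain rfl : n = i + 1 + j := by omega
        have hb : (binom D X (i + 1 + j + 1) (j + 1)).toA
            = wh C.Om1 (binom D X (i + 1 + j) j).toA ∘ₗ (sigmaChain D X (i + 1 + j + 1) (i + 1)).toA
              + wh C.Om1 (binom D X (i + 1 + j) (j + 1)).toA := by
          rw [binom, if_neg (by omega), show i + 1 + j - j = i + 1 by omega]
          exact LinearMap.ext fun z => congrArg₂ (· + ·) (tmap_id_apply _ _) (tmap_id_apply _ _)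
        rw [hb, LinearMap.add_comp, LinearMap.comp_assoc, sigmaChain_glue D _ _ _ rfl,
          ← LinearMap.comp_assoc, ← wh_comp, ih (i + 1) j rfl, sh_succ]
        refine (add_comm _ _).trans ?_
        congr 1
        rw [glue, ← wh_comp, ih i (j + 1) (by omega)]
        rfl

theorem binom_concat (i j : ℕ) (x : TP C i) (y : TP C j) :
    binom D (BiMod.self k A) (j + i) j (concat C i j (tm x y))
      = sh D (BiMod.self k A) (j + i) i j (preL C (smulR y) i x) := by
  rw [← binom_glue D (j + i) i j (add_comm i j), ← preAdd_eq, ← attach_eq]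
  rfl

end Binomial

/-! ### Existence and uniqueness of the structure maps -/

section SymDataExists

variable {C : Calculus k A} {D : BimodConn C C.Om1} {E : BiMod k A} {G : BimodConn C E} {N : ℕ}

theorem Hom.ext {M P : BiMod k A} {f g : Hom M P} (h : ∀ x, f x = g x) : f = g := by
  obtain ⟨f, _, _⟩ := f
  obtain ⟨g, _, _⟩ := g
  obtain rfl : f = g := LinearMap.ext h
  rfl

theorem Hom.tens_ext {M P Q : BiMod k A} {f g : Hom (tens M P) Q}
    (h : ∀ x y, f (tm x y) = g (tm x y)) : f = g :=
  Hom.ext fun z => LinearMap.congr_fun (NCJet.tens_extK h) z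

theorem OmS.incl_injective (n : ℕ) : Function.Injective (OmS.incl C n) := Subtype.val_injective

theorem OmS.wedgeAt_incl (n i : ℕ) (x : OmS C n) :
    wedgeAt C (BiMod.self k A) n i (OmS.incl C n x) = 0 := x.2 i

theorem OmSE.incl_tm (n : ℕ) (x : OmS C n) (s : E) :
    OmSE.incl C E n (tm x s) = preL C (smulR s) n (OmS.incl C n x) := by
  rw [← attach_eq]
  exact congrArg (attach C E n) (Hom.tmap_tm _ _ _ _)

/-- A linear map with values in the forms killed by all wedge products. -/
def OmS.lift {W : Type*} [AddCommGroup W] [Module k W] {n : ℕ} (f : W →ₗ[k] TP C n)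
    (hf : ∀ w i, wedgeAt C (BiMod.self k A) n i (f w) = 0) : W →ₗ[k] OmS C n where
  toFun w := ⟨f w, hf w⟩
  map_add' w w' := Subtype.ext (map_add f w w')
  map_smul' c w := Subtype.ext (map_smul f c w)

/-- A bimodule map into the target of an injective bimodule map whose image contains the range
lifts to the source. -/
theorem exists_hom_lift {M P Q : BiMod k A} (f : Hom M Q) (ι : Hom P Q)
    (hι : Function.Injective ι) (hf : ∀ x, ∃ y, ι y = f x) : ∃ g : Hom M P, ∀ x, ι (g x) = f x := by
  choose g hg using hf
  refine ⟨⟨⟨⟨g, fun x y => hι ?_⟩, fun c x => hι ?_⟩, fun a x => hι ?_, fun a x => hι ?_⟩, hg⟩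
  · rw [hg, map_add, map_add, hg, hg]
  · rw [hg, RingHom.id_apply, map_smul, map_smul, hg]
  · change ι (g (a • x)) = ι (a • g x)
    rw [hg, f.lact, ι.lact, hg]
  · change ι (g (x <• a)) = ι (g x <• a)
    rw [hg, f.ract, ι.ract, hg]

theorem exists_linear_lift {W : Type*} [AddCommGroup W] [Module k W] {P Q : BiMod k A}
    (f : W →ₗ[k] Q) (ι : Hom P Q) (hι : Function.Injective ι) (hf : ∀ x, ∃ y, ι y = f x) :
    ∃ g : W →ₗ[k] P, ∀ x, ι (g x) = f x := by
  choose g hg using hf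
  refine ⟨⟨⟨g, fun x y => hι ?_⟩, fun c x => hι ?_⟩, hg⟩
  · rw [hg, map_add, map_add, hg, hg]
  · rw [hg, RingHom.id_apply, map_smul, map_smul, hg]

theorem exists_odot (hT : TorsionFree D.toLeftConn) (hW : WedgeCompatible D) (hE : Extendable D)
    (i j : ℕ) : ∃ f : Hom (tens (OmS C i) (OmS C j)) (OmS C (j + i)),
      ∀ (x : OmS C i) (y : OmS C j), OmS.incl C (j + i) (f (tm x y))
        = binom D (BiMod.self k A) (j + i) j
          (concat C i j (tm (OmS.incl C i x) (OmS.incl C j y))) := by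
  let F := ((binom D (BiMod.self k A) (j + i) j).comp (concat C i j)).comp
    ((OmS.incl C i).tmap (OmS.incl C j))
  have hF : ∀ x y, F (tm x y) = binom D (BiMod.self k A) (j + i) j
      (concat C i j (tm (OmS.incl C i x) (OmS.incl C j y))) := fun x y =>
    congrArg (fun z => binom D (BiMod.self k A) (j + i) j (concat C i j z)) (Hom.tmap_tm _ _ _ _)
  obtain ⟨f, hf⟩ := exists_hom_lift F (OmS.incl C (j + i)) (OmS.incl_injective _) (by
    intro z
    induction z using tm_induction with
    | h0 => exact ⟨0, by rw [map_zero, map_zero]⟩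
    | htm x y =>
      refine ⟨⟨F (tm x y), fun l => ?_⟩, rfl⟩
      rw [hF, binom_concat]
      -- Wedges inside the first block vanish by symmetry of x and naturality in the tail, those
      -- inside the second by symmetry of y.
      refine (wedgeAt_sh hT hW hE (j + i) l i j).apply_eq_zero _ (fun p => ?_) (fun q => ?_)
      · exact wedgeAt_preL_eq_zero _ _ _ (OmS.wedgeAt_incl i p x)
      · rw [← LinearMap.comp_apply, ← preL_comp, comp_smulR, Hom.toA_apply, OmS.wedgeAt_incl]
        have : smulR (0 : wedgeCod C (BiMod.self k A) j q) = 0 := by ext; simp [smulR]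
        rw [this, preL_zero]; rfl
    | hadd z z' h h' =>
      obtain ⟨y, hy⟩ := h
      obtain ⟨y', hy'⟩ := h'
      exact ⟨y + y', by rw [map_add, map_add, hy, hy']⟩)
  exact ⟨f, fun x y => (hf _).trans (hF x y)⟩

theorem exists_sigmaS (hE : Extendable G) (n : ℕ) (hP : PreservesOmS C E n) :
    ∃ f : Hom (tens E (OmS C n)) (OmSE C E n), ∀ (e : E) (x : OmS C n),
      OmSE.incl C E n (f (tm e x)) = sigmaPow G n (tm e (OmS.incl C n x)) := by
  obtain ⟨f, hf⟩ := exists_hom_lift ((sigmaPow G n).comp ((Hom.id E).tmap (OmS.incl C n)))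
    (OmSE.incl C E n) hP.1 (by
    intro z
    refine hP.2 _ fun i => ?_
    obtain ⟨T, hT⟩ := wedgeAt_sigmaPow hE n i
    have h1 := LinearMap.congr_fun hT ((Hom.id E).tmap (OmS.incl C n) z)
    have h2 : wh E (wedgeAt C (BiMod.self k A) n i).toA ∘ₗ wh E (OmS.incl C n).toA = 0 := by
      refine NCJet.tens_ext fun e x => ?_
      rw [LinearMap.comp_apply, wh_tm, wh_tm, Hom.toA_apply, Hom.toA_apply, OmS.wedgeAt_incl,
        tm_zero_right]
      rfl
    have h3 := LinearMap.congr_fun h2 z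
    rw [LinearMap.comp_apply] at h3
    refine h1.trans ?_
    rw [LinearMap.comp_apply, tmap_id_apply, h3]
    exact map_zero T)
  exact ⟨f, fun e x => (hf _).trans (congrArg (sigmaPow G n) (Hom.tmap_tm _ _ _ _))⟩

theorem exists_symData (hT : TorsionFree D.toLeftConn) (hF : IsFlat D.toLeftConn)
    (hW : WedgeCompatible D) (hE : Extendable D) (hFE : IsFlat G.toLeftConn) (hEE : Extendable G)
    (hP : ∀ n ≤ N, PreservesOmS C E n) : Nonempty (SymData D G N) := by
  choose f hf using exists_odot hT hW hE
  choose s hs using fun n hn => exists_sigmaS hEE n (hP n hn)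
  choose δ hδ using fun n hn => exists_linear_lift (iterNabla D G.toLeftConn n) (OmSE.incl C E n)
    (hP n hn).1 fun x => (hP n hn).2 _ fun i => wedgeAt_iterNabla hT hF hW hE hFE n i x
  exact ⟨⟨f, hf, s, hs, fun n => OmS.lift (iterNabla D (trivConn C) n) fun x i =>
    wedgeAt_iterNabla hT hF hW hE isFlat_trivConn n i x, fun _ _ => rfl, δ, hδ⟩⟩

theorem SymData.unique (hP : ∀ n ≤ N, PreservesOmS C E n) (S S' : SymData D G N) : S' = S := by
  refine SymData.ext ?_ ?_ ?_ ?_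
  · funext i j
    refine Hom.tens_ext fun x y => OmS.incl_injective _ ?_
    rw [S.odot_spec, S'.odot_spec]
  · funext n hn
    refine Hom.tens_ext fun x y => (hP n hn).1 ?_
    rw [S.sigmaS_spec, S'.sigmaS_spec]
  · funext n
    refine LinearMap.ext fun a => OmS.incl_injective _ ?_
    rw [S.deriv_spec, S'.deriv_spec]
  · funext n hn
    refine LinearMap.ext fun a => (hP n hn).1 ?_
    rw [S.derivE_spec, S'.derivE_spec]

/-! ### The bullet actions in the tensor powers -/

variable (S : SymData D G N)

/-- Naturality of shuffles in the tail carries the formula from tail A, where the product of forms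
lives, to tail E. -/
theorem SymData.incl_odotL (i j : ℕ) (u : OmS C i) (x : OmSE C E j) :
    OmSE.incl C E (j + i) (S.odotL i j (tm u x))
      = sh D E (j + i) i j (preL C (smulR (OmSE.incl C E j x)) i (OmS.incl C i u)) := by
  induction x using tm_induction with
  | h0 =>
    have : smulR (0 : pre C E j) = 0 := by ext; simp [smulR]
    rw [tm_zero_right, map_zero, map_zero, map_zero, this, preL_zero]; simp
  | htm w s =>
    have e : S.odotL i j (tm u (tm w s)) = tm (S.odot i j (tm u w)) s := by
      change ((S.odot i j).tmap (Hom.id E)) (Hom.assocInv _ _ _ (tm u (tm w s))) = _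
      rw [Hom.assocInv_tm, Hom.tmap_tm]; rfl
    have h := LinearMap.congr_fun (sh_natural D (smulR s) (j + i) i j)
      (preL C (smulR (OmS.incl C j w)) i (OmS.incl C i u))
    rw [LinearMap.comp_apply, LinearMap.comp_apply, ← LinearMap.comp_apply (preL C _ i), ← preL_comp,
      comp_smulR] at h
    rw [e, OmSE.incl_tm, S.odot_spec, binom_concat, OmSE.incl_tm, h]
  | hadd x y hx hy =>
    rw [tm_add_right, map_add, map_add, hx, hy, map_add, smulR_add, preL_add, LinearMap.add_apply,
      map_add]

theorem SymData.incl_odotR (i j : ℕ) (hj : j ≤ N) (x : OmSE C E i) (u : OmS C j) :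
    OmSE.incl C E (j + i) (S.odotR i j hj (tm x u))
      = sh D E (j + i) i j (preL C (sigmaR G j (OmS.incl C j u)) i (OmSE.incl C E i x)) := by
  induction x using tm_induction with
  | h0 => rw [tm_zero_left]; simp
  | htm w s =>
    have e : S.odotR i j hj (tm (tm w s) u) = S.odotL i j (tm w (S.sigmaS j hj (tm s u))) := by
      change S.odotL i j (((Hom.id _).tmap (S.sigmaS j hj)) (Hom.assoc _ _ _ (tm (tm w s) u))) = _
      rw [Hom.assoc_tm, Hom.tmap_tm]; rfl
    rw [e, S.incl_odotL, S.sigmaS_spec, OmSE.incl_tm, ← LinearMap.comp_apply (preL C _ i),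
      ← preL_comp, comp_smulR, sigmaR_apply]
  | hadd x y hx hy => rw [tm_add_left, map_add, map_add, hx, hy, map_add, map_add, map_add]

end SymDataExists

/-! ### Jets as sequences in the tensor powers, and the bullet actions as convolutions. -/

section Jets

open Finset

variable {C : Calculus k A} {D : BimodConn C C.Om1} {E : BiMod k A} {G : BimodConn C E} {N : ℕ}

/-- The components of a jet in the tensor powers, extended by zero. -/
def jetSeq {m : ℕ} (x : Jet C E m) (n : ℕ) : pre C E n :=
  if h : n < m + 1 then OmSE.incl C E n (x ⟨n, h⟩) else 0

theorem jetSeq_coe {m : ℕ} (x : Jet C E m) (i : Fin (m + 1)) :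
    jetSeq x i = (OmSE.incl C E i).toLinearMap (x i) := dif_pos i.2

theorem Jet.ext {m : ℕ} (hP : ∀ n ≤ m, PreservesOmS C E n) {x y : Jet C E m}
    (h : ∀ n ≤ m, jetSeq x n = jetSeq y n) : x = y := by
  funext i
  have := h i i.is_le
  rw [jetSeq_coe, jetSeq_coe] at this
  exact (hP i i.is_le).1 this

theorem jetSeq_add {m : ℕ} (x y : Jet C E m) (n : ℕ) :
    jetSeq (x + y) n = jetSeq x n + jetSeq y n := by
  unfold jetSeq
  split_ifs
  · exact map_add _ _ _
  · simp

theorem jetSeq_smul {m : ℕ} (c : k) (x : Jet C E m) (n : ℕ) :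
    jetSeq (c • x) n = c • jetSeq x n := by
  unfold jetSeq
  split_ifs
  · exact (OmSE.incl C E n).toLinearMap.map_smul c _
  · simp

theorem incl_ofEq {m n : ℕ} (h : m = n) (x : OmSE C E m) :
    OmSE.incl C E n (Hom.ofEq (OmSE C E) h x) = Hom.ofEq (pre C E) h (OmSE.incl C E m x) := by
  subst h; rfl

theorem ofEq_sh {m n : ℕ} (h : m = n) (i j : ℕ) (z : pre C (pre C E j) i) :
    Hom.ofEq (pre C E) h (sh D E m i j z) = sh D E n i j z := by
  subst h; rfl

/-- Translates the truncated sums that define the bullet actions into the antidiagonal sums of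
`conv`. -/
theorem sum_fin_eq_antidiagonal {V : Type*} [AddCommMonoid V] {m n : ℕ} (hn : n ≤ m)
    (f : ℕ → ℕ → V) :
    ∑ j : Fin (m + 1), (if (j : ℕ) ≤ n then f (n - j) j else 0)
      = ∑ x ∈ antidiagonal n, f x.1 x.2 := by
  rw [Fin.sum_univ_eq_sum_range (fun j => if j ≤ n then f (n - j) j else 0) (m + 1),
    ← sum_filter, ← Nat.sum_antidiagonal_swap, Nat.sum_antidiagonal_eq_sum_range_succ_mk]
  refine sum_congr ?_ fun _ _ => rfl
  ext j
  simp only [mem_filter, mem_range]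
  omega

/-- The components of the higher differentials of `a`. -/
def dSeq (D : BimodConn C C.Om1) (a : A) (n : ℕ) : TP C n :=
  iterNabla D (trivConn C) n (toSelf k a)

variable (S : SymData D G N)

theorem SymData.jetSeq_bulletL {m n : ℕ} (hn : n ≤ m) (a : A) (x : Jet C E m) :
    jetSeq (S.bulletL m a x) n = conv D (dSeq D a) (fun q => smulR (jetSeq x q)) n := by
  obtain ⟨i, rfl⟩ : ∃ i : Fin (m + 1), n = i := ⟨⟨n, by omega⟩, rfl⟩
  unfold SymData.bulletL
  rw [jetSeq_coe, map_sum, conv, ← sum_fin_eq_antidiagonal hn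
    (fun p q => sh D E i p q (preL C (smulR (jetSeq x q)) p (dSeq D a p)))]
  refine sum_congr rfl fun j _ => ?_
  split_ifs with h
  · rw [incl_ofEq, S.incl_odotL, ofEq_sh, S.deriv_spec, jetSeq_coe]; rfl
  · exact map_zero _

theorem SymData.jetSeq_bulletR {m n : ℕ} (hm : m ≤ N) (hn : n ≤ m) (a : A) (x : Jet C E m) :
    jetSeq (S.bulletR m hm x a) n = conv D (jetSeq x) (fun q => sigmaR G q (dSeq D a q)) n := by
  obtain ⟨i, rfl⟩ : ∃ i : Fin (m + 1), n = i := ⟨⟨n, by omega⟩, rfl⟩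
  unfold SymData.bulletR
  -- For the right action the jet is the first block, so the summation index is the first entry of
  -- the antidiagonal and the pairs are swapped.
  rw [jetSeq_coe, map_sum, conv, ← Nat.sum_antidiagonal_swap]
  refine Eq.trans ?_ (sum_fin_eq_antidiagonal hn
    (fun p q => sh D E i q p (preL C (sigmaR G p (dSeq D a p)) q (jetSeq x q))))
  refine sum_congr rfl fun j _ => ?_
  split_ifs with h
  · rw [incl_ofEq, S.incl_odotR, ofEq_sh, S.deriv_spec, jetSeq_coe]; rfl
  · exact map_zero _

theorem SymData.jetSeq_jet {m n : ℕ} (hm : m ≤ N) (hn : n ≤ m) (s : E) :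
    jetSeq (S.jet m hm s) n = iterNabla D G.toLeftConn n s := by
  obtain ⟨i, rfl⟩ : ∃ i : Fin (m + 1), n = i := ⟨⟨n, by omega⟩, rfl⟩
  rw [jetSeq_coe]
  exact S.derivE_spec _ _ s

/-! ### Properties of the higher differentials -/

theorem dSeq_mul (hL : LeibnizCompatible D D) (a b : A) :
    dSeq D (a * b) = conv D (dSeq D a) (fun q => smulR (dSeq D b q)) := by
  funext n
  exact iterNabla_smul hL (trivConn C) n a (toSelf k b)

theorem dSeq_one_succ (n : ℕ) : dSeq D 1 (n + 1) = 0 := by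
  induction n with
  | zero =>
    change tm (C.d0 1) (toSelf k 1) = 0
    rw [d0_one, tm_zero_left]
  | succ n ih =>
    change (higherConn D (trivConn C) (n + 1)).nabla (dSeq D 1 (n + 1)) = 0
    rw [ih, map_zero]

theorem dSeq_add (a b : A) (n : ℕ) : dSeq D (a + b) n = dSeq D a n + dSeq D b n :=
  map_add (iterNabla D (trivConn C) n) (toSelf k a) (toSelf k b)

theorem dSeq_smul (c : k) (a : A) (n : ℕ) : dSeq D (c • a) n = c • dSeq D a n :=
  map_smul (iterNabla D (trivConn C) n) c (toSelf k a)

theorem sigmaR_zero_one : sigmaR G 0 (toSelf k (1 : A)) = LinearMap.id :=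
  LinearMap.ext fun s => (Hom.runit_tm s 1).trans (one_smul Aᵐᵒᵖ s)

theorem sigmaR_add (n : ℕ) (u w : TP C n) : sigmaR G n (u + w) = sigmaR G n u + sigmaR G n w := by
  ext s
  simp [sigmaR, tm_add_right]

theorem sigmaR_zero (n : ℕ) : sigmaR G n 0 = 0 := by
  ext s
  simp [sigmaR, tm_zero_right]

theorem sigmaR_sum {ι : Type*} (s : Finset ι) (n : ℕ) (u : ι → TP C n) :
    sigmaR G n (∑ i ∈ s, u i) = ∑ i ∈ s, sigmaR G n (u i) :=
  map_sum (AddMonoidHom.mk' (sigmaR G n) (sigmaR_add n)) u s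

/-- The higher Leibniz rule for A, transported through σ_E^n. This is what makes the right action
multiplicative. -/
theorem sigmaR_dSeq_mul (hL : LeibnizCompatible D D) (hLE : LeibnizCompatible D G) (a b : A) (n : ℕ) :
    sigmaR G n (dSeq D (a * b) n)
      = convL D (fun q => sigmaR G q (dSeq D a q)) (fun q => sigmaR G q (dSeq D b q)) n := by
  rw [dSeq_mul hL, conv, sigmaR_sum]
  exact sum_congr rfl fun x _ => sigmaR_sh hLE.mixedBraid n x.1 x.2 _ _

theorem wh_smulK {M X Y : BiMod k A} {f g : X →ₗ[A] Y} {c : k} (h : ∀ x, g x = c • f x)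
    (z : tens M X) : wh M g z = c • wh M f z := by
  induction z using tm_induction with
  | h0 => simp
  | htm m x => rw [wh_tm, wh_tm, h, tm_smul_right]
  | hadd z z' h h' => rw [map_add, map_add, smul_add, h, h']

theorem preL_smulK {X Y : BiMod k A} {f g : X →ₗ[A] Y} {c : k} (h : ∀ x, g x = c • f x)
    (n : ℕ) (z : pre C X n) : preL C g n z = c • preL C f n z := by
  induction n with
  | zero => exact h z
  | succ n ih => exact wh_smulK ih z

theorem conv_smul_right {X Y : BiMod k A} (z : ∀ p, pre C X p) {f g : ∀ q, X →ₗ[A] pre C Y q} {c : k}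
    (h : ∀ q x, g q x = c • f q x) (n : ℕ) : conv D z g n = c • conv D z f n := by
  rw [conv, conv, smul_sum]
  refine sum_congr rfl fun x _ => ?_
  rw [preL_smulK (h x.2)]
  exact ((sh D Y n x.1 x.2).restrictScalars k).map_smul c _

theorem conv_smul_left {X Y : BiMod k A} (z : ∀ p, pre C X p) (f : ∀ q, X →ₗ[A] pre C Y q) (c : k)
    (n : ℕ) : conv D (fun p => c • z p) f n = c • conv D z f n := by
  rw [conv, conv, smul_sum]
  exact sum_congr rfl fun x _ =>
    ((sh D Y n x.1 x.2 ∘ₗ preL C (f x.2) x.1).restrictScalars k).map_smul c _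

/-! ### The bimodule structure of the jets -/

theorem SymData.isBimodule (hL : LeibnizCompatible D D) (hLE : LeibnizCompatible D G)
    (hP : ∀ n ≤ N, PreservesOmS C E n) (m : ℕ) (hm : m ≤ N) :
    IsBimodule k (S.bulletL m) (S.bulletR m hm) := by
  have hP' : ∀ n ≤ m, PreservesOmS C E n := fun n hn => hP n (hn.trans hm)
  have hB := hL.mixedBraid
  -- The sequence of a jet is cut off above degree m, while a convolution is not. Agreement up to m
  -- suffices, since degree n ≤ m involves nothing higher.
  have hl : ∀ (a : A) (x : Jet C E m) {n : ℕ}, n ≤ m → ∀ {f : ∀ q, BiMod.self k A →ₗ[A] pre C E q},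
      (∀ q ≤ m, f q = smulR (jetSeq x q)) → jetSeq (S.bulletL m a x) n = conv D (dSeq D a) f n := by
    intro a x n hn f hf
    rw [S.jetSeq_bulletL hn]
    exact conv_congr_right D _ fun p hp => (hf p (hp.trans hn)).symm
  have hr : ∀ (a : A) (x : Jet C E m) {n : ℕ}, n ≤ m → ∀ {z : ∀ p, pre C E p},
      (∀ q ≤ m, z q = jetSeq x q) →
        jetSeq (S.bulletR m hm x a) n = conv D z (fun q => sigmaR G q (dSeq D a q)) n := by
    intro a x n hn z hz
    rw [S.jetSeq_bulletR hm hn]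
    exact conv_congr_left D _ fun p hp => (hz p (hp.trans hn)).symm
  constructor
  · intro x
    refine Jet.ext hP' fun n hn => ?_
    rw [S.jetSeq_bulletL hn, conv_unit_left D _ _ dSeq_one_succ]
    exact one_smul A _
  · intro a b x
    refine Jet.ext hP' fun n hn => ?_
    rw [hl a _ hn (fun q hq => by rw [S.jetSeq_bulletL hq]), S.jetSeq_bulletL hn, dSeq_mul hL,
      show (conv D (dSeq D a) fun q => smulR (dSeq D b q))
        = fun n => conv D (dSeq D a) (fun q => smulR (dSeq D b q)) n from rfl, conv_assoc D hB]
    exact conv_congr_right D _ fun p _ => convL_smulR D _ _ p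
  · intro a b x
    refine Jet.ext hP' fun n hn => ?_
    rw [jetSeq_add, S.jetSeq_bulletL hn, S.jetSeq_bulletL hn, S.jetSeq_bulletL hn, ← conv_add_left,
      ← funext (dSeq_add a b)]
  · intro a x y
    refine Jet.ext hP' fun n hn => ?_
    rw [jetSeq_add, S.jetSeq_bulletL hn, S.jetSeq_bulletL hn, S.jetSeq_bulletL hn, ← conv_add_right]
    simp only [jetSeq_add, smulR_add]
  · intro c a x
    refine Jet.ext hP' fun n hn => ?_
    rw [jetSeq_smul, S.jetSeq_bulletL hn, S.jetSeq_bulletL hn, ← conv_smul_left,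
      ← funext (dSeq_smul c a)]
  · intro c a x
    refine Jet.ext hP' fun n hn => ?_
    rw [jetSeq_smul, S.jetSeq_bulletL hn, S.jetSeq_bulletL hn]
    refine conv_smul_right _ (fun q b => ?_) n
    rw [jetSeq_smul]
    exact smul_comm (M := A) _ c (jetSeq x q)
  · intro x
    refine Jet.ext hP' fun n hn => ?_
    rw [S.jetSeq_bulletR hm hn]
    exact conv_unit_right D _ _ sigmaR_zero_one (fun q => by rw [dSeq_one_succ, sigmaR_zero]) n
  · intro a b x
    refine Jet.ext hP' fun n hn => ?_
    rw [hr b _ hn (fun q hq => (S.jetSeq_bulletR hm hq a x).symm), S.jetSeq_bulletR hm hn,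
      conv_assoc D hB]
    exact conv_congr_right D _ fun p _ => sigmaR_dSeq_mul hL hLE a b p
  · intro a x y
    refine Jet.ext hP' fun n hn => ?_
    rw [jetSeq_add, S.jetSeq_bulletR hm hn, S.jetSeq_bulletR hm hn, S.jetSeq_bulletR hm hn,
      ← conv_add_left, ← funext (jetSeq_add x y)]
  · intro a b x
    refine Jet.ext hP' fun n hn => ?_
    rw [jetSeq_add, S.jetSeq_bulletR hm hn, S.jetSeq_bulletR hm hn, S.jetSeq_bulletR hm hn,
      ← conv_add_right]
    simp only [dSeq_add, sigmaR_add]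
  · intro c a x
    refine Jet.ext hP' fun n hn => ?_
    rw [jetSeq_smul, S.jetSeq_bulletR hm hn, S.jetSeq_bulletR hm hn, ← conv_smul_left,
      ← funext (jetSeq_smul c x)]
  · intro c a x
    refine Jet.ext hP' fun n hn => ?_
    rw [jetSeq_smul, S.jetSeq_bulletR hm hn, S.jetSeq_bulletR hm hn]
    refine conv_smul_right _ (fun q s => ?_) n
    rw [dSeq_smul, sigmaR_apply, sigmaR_apply, tm_smul_right, map_smul]
  · intro a b x
    refine Jet.ext hP' fun n hn => ?_
    -- The actions commute because both orders bracket the same triple convolution of the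
    -- derivatives of a, the jet, and right multiplication by the derivatives of b.
    rw [hl a _ hn (fun q hq => by rw [S.jetSeq_bulletR hm hq]),
      hr b _ hn (fun q hq => (S.jetSeq_bulletL hq a x).symm), conv_assoc D hB]
    exact conv_congr_right D _ fun p _ => convL_smulR D _ _ p

theorem SymData.jet_smul (hL : LeibnizCompatible D D) (hP : ∀ n ≤ N, PreservesOmS C E n)
    (m : ℕ) (hm : m ≤ N) (a : A) (s : E) : S.jet m hm (a • s) = S.bulletL m a (S.jet m hm s) := by
  refine Jet.ext (fun n hn => hP n (hn.trans hm)) fun n hn => ?_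
  rw [S.jetSeq_jet hm hn, S.jetSeq_bulletL hn, iterNabla_smul hL]
  exact conv_congr_right D (dSeq D a)
    (f := fun q => smulR (iterNabla D G.toLeftConn q s))
    (f' := fun q => smulR (jetSeq (S.jet m hm s) q))
    fun p hp => by rw [S.jetSeq_jet hm (hp.trans hn)]

theorem SymData.jet_ract (hL : LeibnizCompatible D D) (hLE : LeibnizCompatible D G)
    (hP : ∀ n ≤ N, PreservesOmS C E n) (m : ℕ) (hm : m ≤ N) (a : A) (s : E) :
    S.jet m hm (s <• a) = S.bulletR m hm (S.jet m hm s) a := by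
  refine Jet.ext (fun n hn => hP n (hn.trans hm)) fun n hn => ?_
  rw [S.jetSeq_jet hm hn, S.jetSeq_bulletR hm hn, iterNabla_ract hL hLE]
  exact conv_congr_left D (fun q => sigmaR G q (dSeq D a q)) fun p hp =>
    (S.jetSeq_jet hm (hp.trans hn) s).symm

/-! ### The jet projections -/

theorem jetSeq_jetProj {m n : ℕ} (hn : n ≤ m) (x : Jet C E (m + 1)) :
    jetSeq (jetProj C E m x) n = jetSeq x n := by
  rw [jetSeq, jetSeq, dif_pos (Nat.lt_succ_of_le hn), dif_pos (by omega)]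
  rfl

theorem jetProj_surjective (m : ℕ) : Function.Surjective (jetProj C E m) := fun x =>
  ⟨Fin.snoc (α := fun i : Fin (m + 2) => OmSE C E i) x 0, funext fun i =>
    Fin.snoc_castSucc (α := fun i : Fin (m + 2) => OmSE C E i) _ _ i⟩

/-- The actions never lower the degree, so the top component of a jet does not influence the
components that the projection keeps. -/
theorem SymData.jetProj_bulletL (hP : ∀ n ≤ N, PreservesOmS C E n) (m : ℕ) (hm : m + 1 ≤ N) (a : A)
    (x : Jet C E (m + 1)) :
    jetProj C E m (S.bulletL (m + 1) a x) = S.bulletL m a (jetProj C E m x) := by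
  refine Jet.ext (fun n hn => hP n (by omega)) fun n hn => ?_
  rw [jetSeq_jetProj hn, S.jetSeq_bulletL (by omega), S.jetSeq_bulletL hn]
  exact conv_congr_right D _ fun p hp => by rw [jetSeq_jetProj (hp.trans hn)]

theorem SymData.jetProj_bulletR (hP : ∀ n ≤ N, PreservesOmS C E n) (m : ℕ) (hm : m + 1 ≤ N) (a : A)
    (x : Jet C E (m + 1)) : jetProj C E m (S.bulletR (m + 1) hm x a)
      = S.bulletR m (Nat.le_of_succ_le hm) (jetProj C E m x) a := by
  refine Jet.ext (fun n hn => hP n (by omega)) fun n hn => ?_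
  rw [jetSeq_jetProj hn, S.jetSeq_bulletR hm (by omega), S.jetSeq_bulletR _ hn]
  exact conv_congr_left D _ fun p hp => (jetSeq_jetProj (hp.trans hn) x).symm

end Jets

end NCJet

theorem theorem5p6 {k : Type v} {A : Type u} [Field k] [Ring A] [Algebra k A]
    (C : NCJet.Calculus k A)
    (D : NCJet.BimodConn C C.Om1)
    (hTorsion : NCJet.TorsionFree D.toLeftConn)
    (hFlat : NCJet.IsFlat D.toLeftConn)
    (hWedge : NCJet.WedgeCompatible D)
    (hExt : NCJet.Extendable D)
    (hLeib : NCJet.LeibnizCompatible D D)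
    (E : NCJet.BiMod k A)
    (G : NCJet.BimodConn C E)
    (hFlatE : NCJet.IsFlat G.toLeftConn)
    (hExtE : NCJet.Extendable G)
    (hLeibE : NCJet.LeibnizCompatible D G)
    (N : ℕ)
    (hE : ∀ n ≤ N, NCJet.PreservesOmS C E n) :
    ∃ S : NCJet.SymData D G N, (∀ S' : NCJet.SymData D G N, S' = S) ∧
      (∀ (m : ℕ) (hm : m ≤ N),
        NCJet.IsBimodule k (S.bulletL m) (S.bulletR m hm) ∧
        (∀ (a : A) (s : E), S.jet m hm (a • s) = S.bulletL m a (S.jet m hm s)) ∧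
        (∀ (a : A) (s : E), S.jet m hm (s <• a) = S.bulletR m hm (S.jet m hm s) a)) ∧
      (∀ (m : ℕ) (hm : m + 1 ≤ N),
        Function.Surjective (NCJet.jetProj C E m) ∧
        (∀ (a : A) (x : NCJet.Jet C E (m + 1)),
          NCJet.jetProj C E m (S.bulletL (m + 1) a x)
            = S.bulletL m a (NCJet.jetProj C E m x)) ∧
        (∀ (a : A) (x : NCJet.Jet C E (m + 1)),
          NCJet.jetProj C E m (S.bulletR (m + 1) hm x a)
            = S.bulletR m (Nat.le_of_succ_le hm) (NCJet.jetProj C E m x) a) ∧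
        (∀ s : E, NCJet.jetProj C E m (S.jet (m + 1) hm s)
            = S.jet m (Nat.le_of_succ_le hm) s)) := by
  obtain ⟨S⟩ := NCJet.exists_symData (G := G) hTorsion hFlat hWedge hExt hFlatE hExtE hE
  exact ⟨S, S.unique hE, fun m hm => ⟨S.isBimodule hLeib hLeibE hE m hm,
      S.jet_smul hLeib hE m hm, S.jet_ract hLeib hLeibE hE m hm⟩,
    fun m hm => ⟨NCJet.jetProj_surjective m, S.jetProj_bulletL hE m hm,
      S.jetProj_bulletR hE m hm, fun _ => rfl⟩⟩
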